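/- **Theorem 4.1 (gradient flow).** Let $n,m\ge 1$, $A,C\in\mathbb R^{n\times n}$, $B,D\in\mathbb R^{n\times m}$, and let $Q\in\mathbb R^{n\times n}$, $R\in\mathbb R^{m\times m}$ be symmetric positive definite. Let $W$ be a standard one-dimensional Brownian motion relative to a filtration $(\mathcal F_t)_{t\ge0}$ on a probability space, and let $\xi_0$ be a square-integrable $\mathcal F_0$-measurable $\mathbb R^n$-valued random variable whose second moment $\Sigma_0=\mathbb E[\xi_0\xi_0^\top]$ is positive definite. For $K\in\mathbb R^{m\times n}$ consider the closed-loop Itô equation $$dX(t)=(A+BK)X(t)\,dt+(C+DK)X(t)\,dW(t).$$ Let $\mathcal K$ be the set of mean-square stabilizers, i.e. of those $K$ such that for every square-integrable $\mathcal F_0$-measurable initial state the solution satisfies $\lim_{t\to\infty}\mathbb E[X(t)^\top X(t)]=0$. Let $$J(K)=\mathbb E\int_0^\infty X(t)^\top(Q+K^\top RK)X(t)\,dt\in[0,\infty],\qquad X(0)=\xi_0,$$ and for $K_0\in\mathcal K$ let $\mathcal K_0=\{K: J(K)\le J(K_0)\}$. Denote by $\|\cdot\|$ the spectral norm, by $\|\cdot\|_F$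 the Frobenius norm, by $\lambda_1$ and $\lambda_{\max}$ the smallest and largest eigenvalue of a symmetric matrix, and by $\nabla J(K)$ the $m\times n$ matrix of partial derivatives of $J$. Put $$\mu=\frac{4J(K_0)}{\lambda_1(R)\lambda_1(Q)\lambda_1(\Sigma_0)^2}\Big(\|A\|+\frac{\|B\|^2J(K_0)}{\lambda_1(R)\lambda_1(\Sigma_0)}\Big)^2$$ and, if $B\ne0$, $$L=\frac{2J(K_0)}{\lambda_1(Q)}\Big[\lambda_{\max}(R)+\frac{J(K_0)\|D\|^2}{\lambda_1(\Sigma_0)}+\Big(\|B\|+\|C\|\|D\|+\frac{2\|B\|\|D\|_F^2J(K_0)}{\lambda_1(\Sigma_0)\lambda_1(R)}+\frac{\|A\|\|D\|_F^2}{\|B\|}\Big)\xi\Big],$$ $$\xi=\frac{\sqrt n\,J(K_0)}{\lambda_1(\Sigma_0)}\Big(\frac{\tilde\mu J(K_0)}{\lambda_1(\Sigma_0)\lambda_1(Q)}+\sqrt{\Big(\frac{\tilde\mu J(K_0)}{\lambda_1(\Sigma_0)\lambda_1(Q)}\Big)^2+\frac{\lambda_{\max}(R)}{\lambda_1(Q)}}\Big),$$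 $$\tilde\mu=\|B\|+\|D\|\|C\|_F+\frac{2\|B\|J(K_0)\|D\|^2}{\lambda_1(\Sigma_0)\lambda_1(R)}+\frac{\|A\|\|D\|^2}{\|B\|}.$$ Then for every $K_0\in\mathcal K$: $J$ has a minimizer over $\mathcal K$; the gradient flow $\dot K_t=-\nabla J(K_t)$ starting at $K_0$ has a solution $K_t\in\mathcal K$ for all $t\ge0$, along which $J$ is finite and differentiable; and every such solution satisfies the following. (a) $t\mapsto J(K_t)$ is non-increasing, and $K_t\in\mathcal K_0$ for all $t\ge0$. (b) $\nabla J(K_t)\to0$ as $t\to\infty$, and for every $T>0$ the minimum below is attained and $$\min_{0\le t\le T}\|\nabla J(K_t)\|_F^2\le\frac{J(K_0)}{T}.$$ (c) For every minimizer $K_*$ of $J$ over $\mathcal K$: $K_t\to K_*$ as $t\to\infty$ (so the minimizer is unique), $\mu>0$, and for all $t\ge0$ $$J(K_t)-J(K_*)\le\big(J(K_0)-J(K_*)\big)e^{-t/\mu},$$ and, if $B\neq0$, $$\|K_t-K_*\|_F\le4\mu\sqrt{L\,(J(K_0)-J(K_*))}\;e^{-t/(2\mu)}.$$ -/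

import Mathlib

open MeasureTheory ProbabilityTheory Filter Topology
open scoped NNReal ENNReal Matrix

/-! ### Matrix quantities -/

noncomputable section

namespace SLQ

/-- The spectral norm of a rectangular real matrix: the operator norm between Euclidean spaces. -/
def specNorm {k l : ℕ} (M : Matrix (Fin k) (Fin l) ℝ) : ℝ :=
  ‖LinearMap.toContinuousLinearMap (Matrix.toEuclideanLin M)‖

/-- The Frobenius norm. -/
def frobNorm {k l : ℕ} (M : Matrix (Fin k) (Fin l) ℝ) : ℝ := √(∑ i, ∑ j, M i j ^ 2)

/-- Minimal eigenvalue of a symmetric real matrix. -/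
def lamMin {k : ℕ} (M : Matrix (Fin k) (Fin k) ℝ) : ℝ := sInf (spectrum ℝ M)

/-- Maximal eigenvalue of a symmetric real matrix. -/
def lamMax {k : ℕ} (M : Matrix (Fin k) (Fin k) ℝ) : ℝ := sSup (spectrum ℝ M)

/-- The gradient of a function of a matrix variable: the matrix of partial derivatives.
(Matrices carry their entrywise topology, and differentiability does not depend on the norm.) -/
def gradMat {m n : ℕ} (f : Matrix (Fin m) (Fin n) ℝ → ℝ) (K : Matrix (Fin m) (Fin n) ℝ) :
    Matrix (Fin m) (Fin n) ℝ :=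
  Matrix.of fun i j => fderiv ℝ f K (Matrix.single i j 1)

/-! ### Stochastic calculus -/

/-- `W` is a standard one-dimensional Brownian motion relative to the filtration `𝓕`. -/
structure IsBrownianMotion {Ω : Type*} {mΩ : MeasurableSpace Ω} (P : Measure Ω)
    (𝓕 : Filtration ℝ≥0 mΩ) (W : ℝ≥0 → Ω → ℝ) : Prop where
  isBrownian : IsBrownianReal W P
  adapted : StronglyAdapted 𝓕 W
  indep_increment : ∀ s t : ℝ≥0, s ≤ t →
    Indep (MeasurableSpace.comap (fun ω => W t ω - W s ω) inferInstance) (𝓕 s) P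

/-- The left-endpoint Riemann sum of `Y` against `Z` over `[0, t]` along the dyadic grid of mesh
`2⁻ᵏ`, i.e. `∑ᵢ (Z (tᵢ₊₁ ∧ t) - Z (tᵢ ∧ t)) • Y tᵢ` with `tᵢ = i / 2ᵏ < t`. -/
def leftSum {Ω : Type*} {n : ℕ} (Y : ℝ≥0 → Ω → Fin n → ℝ) (Z : ℝ≥0 → Ω → ℝ)
    (t : ℝ≥0) (k : ℕ) (ω : Ω) : Fin n → ℝ :=
  ∑ i ∈ Finset.range ⌈t * 2 ^ k⌉₊,
    (Z (min (((i + 1 : ℕ) : ℝ≥0) / 2 ^ k) t) ω - Z (min ((i : ℝ≥0) / 2 ^ k) t) ω) •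
      Y ((i : ℝ≥0) / 2 ^ k) ω

/-- `I = ∫₀ᵗ Y dZ`, as the mean-square limit of left-endpoint Riemann sums. For an adapted,
mean-square continuous `Y` this is the Itô integral if `Z` is a Brownian motion, and the
mean-square Riemann integral if `Z s = s`. -/
def IsMeanSquareIntegral {Ω : Type*} {mΩ : MeasurableSpace Ω} (P : Measure Ω) {n : ℕ}
    (Y : ℝ≥0 → Ω → Fin n → ℝ) (Z : ℝ≥0 → Ω → ℝ) (t : ℝ≥0) (I : Ω → Fin n → ℝ) : Prop :=
  MemLp I 2 P ∧
    Tendsto (fun k => eLpNorm (fun ω => leftSum Y Z t k ω - I ω) 2 P) atTop (𝓝 0)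

/-- Square-integrable initial states, measurable with respect to (the completion of) `𝓕 0`. -/
def IsInitialState {Ω : Type*} {mΩ : MeasurableSpace Ω} (P : Measure Ω)
    (𝓕 : Filtration ℝ≥0 mΩ) {n : ℕ} (ξ : Ω → Fin n → ℝ) : Prop :=
  AEStronglyMeasurable[𝓕 0] ξ P ∧ MemLp ξ 2 P

/-- `X` is a (mean-square) solution of the linear Itô equation
`dX = F X dt + G X dW`, `X 0 = ξ`: an adapted, square-integrable, mean-square continuous process
with `X t = ξ + ∫₀ᵗ F X ds + ∫₀ᵗ G X dW` almost surely, for every `t`. For square-integrable `ξ`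
such a process is unique up to modification, and the usual solution with continuous paths is one
such modification. -/
structure IsSolution {Ω : Type*} {mΩ : MeasurableSpace Ω} (P : Measure Ω)
    (𝓕 : Filtration ℝ≥0 mΩ) (W : ℝ≥0 → Ω → ℝ) {n : ℕ} (F G : Matrix (Fin n) (Fin n) ℝ)
    (ξ : Ω → Fin n → ℝ) (X : ℝ≥0 → Ω → Fin n → ℝ) : Prop where
  adapted : ∀ t, AEStronglyMeasurable[𝓕 t] (X t) P
  memLp : ∀ t, MemLp (X t) 2 P
  continuous : ∀ t, Tendsto (fun s => eLpNorm (fun ω => X s ω - X t ω) 2 P) (𝓝 t) (𝓝 0)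
  integral_eq : ∀ t, ∃ I₁ I₂ : Ω → Fin n → ℝ,
    IsMeanSquareIntegral P (fun s ω => F *ᵥ X s ω) (fun s _ => (s : ℝ)) t I₁ ∧
    IsMeanSquareIntegral P (fun s ω => G *ᵥ X s ω) W t I₂ ∧
    ∀ᵐ ω ∂P, X t ω = ξ ω + I₁ ω + I₂ ω

/-! ### The stochastic linear-quadratic problem -/

/-- Coefficients of the controlled system `dX = (A X + B u) dt + (C X + D u) dW` and of the cost
`E ∫ (Xᵀ Q X + uᵀ R u) dt`. -/
structure Coeffs (n m : ℕ) where
  A : Matrix (Fin n) (Fin n) ℝ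
  C : Matrix (Fin n) (Fin n) ℝ
  B : Matrix (Fin n) (Fin m) ℝ
  D : Matrix (Fin n) (Fin m) ℝ
  Q : Matrix (Fin n) (Fin n) ℝ
  R : Matrix (Fin m) (Fin m) ℝ

/-- The probabilistic data: a filtration, a driving process and an initial state. -/
structure Noise {Ω : Type*} (mΩ : MeasurableSpace Ω) (n : ℕ) where
  P : Measure Ω
  𝓕 : Filtration ℝ≥0 mΩ
  W : ℝ≥0 → Ω → ℝ
  ξ₀ : Ω → Fin n → ℝ

section Problem

variable {Ω : Type*} {mΩ : MeasurableSpace Ω} {n m : ℕ}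

/-- `X` solves the closed-loop equation `dX = (A + B K) X dt + (C + D K) X dW`, `X 0 = ξ`. -/
def IsClosedLoop (c : Coeffs n m) (N : Noise mΩ n) (K : Matrix (Fin m) (Fin n) ℝ)
    (ξ : Ω → Fin n → ℝ) (X : ℝ≥0 → Ω → Fin n → ℝ) : Prop :=
  IsSolution N.P N.𝓕 N.W (c.A + c.B * K) (c.C + c.D * K) ξ X

/-- The set of mean-square stabilizers: for every initial state, the closed-loop solution
satisfies `E [X(t)ᵀ X(t)] → 0`. -/
def stabilizers (c : Coeffs n m) (N : Noise mΩ n) : Set (Matrix (Fin m) (Fin n) ℝ) :=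
  {K | ∀ ξ, IsInitialState N.P N.𝓕 ξ → ∀ X, IsClosedLoop c N K ξ X →
    Tendsto (fun t => ∫ ω, X t ω ⬝ᵥ X t ω ∂N.P) atTop (𝓝 0)}

/-- The cost of a process under the feedback `u = K X`. The expectation is taken inside the time
integral, which by Tonelli's theorem is the same for a jointly measurable process and does not
depend on the choice of a modification. -/
def processCost (c : Coeffs n m) (N : Noise mΩ n) (K : Matrix (Fin m) (Fin n) ℝ)
    (X : ℝ≥0 → Ω → Fin n → ℝ) : ℝ≥0∞ :=
  ∫⁻ t in Set.Ici (0 : ℝ), ∫⁻ ω,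
    ENNReal.ofReal (X t.toNNReal ω ⬝ᵥ ((c.Q + Kᵀ * c.R * K) *ᵥ X t.toNNReal ω)) ∂N.P

/-- The extended-real cost `E ∫₀^∞ Xᵀ (Q + Kᵀ R K) X dt ∈ [0, ∞]` of the closed-loop solution
started at `ξ₀`. All such solutions are modifications of each other, so that the infimum is over a
single value. -/
def costE (c : Coeffs n m) (N : Noise mΩ n) (K : Matrix (Fin m) (Fin n) ℝ) : ℝ≥0∞ :=
  ⨅ (X : ℝ≥0 → Ω → Fin n → ℝ) (_ : IsClosedLoop c N K N.ξ₀ X), processCost c N K X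

/-- The real-valued cost `J(K)`, meaningful where `costE` is finite. -/
def J (c : Coeffs n m) (N : Noise mΩ n) (K : Matrix (Fin m) (Fin n) ℝ) : ℝ :=
  (costE c N K).toReal

/-- The second moment `E [ξ₀ ξ₀ᵀ]` of the initial state. -/
def Sigma0 (N : Noise mΩ n) : Matrix (Fin n) (Fin n) ℝ :=
  Matrix.of fun i j => ∫ ω, N.ξ₀ ω i * N.ξ₀ ω j ∂N.P

/-- The sublevel set `{K | J(K) ≤ J(K₀)}`, for the extended-real cost. -/
def sublevel (c : Coeffs n m) (N : Noise mΩ n) (K₀ : Matrix (Fin m) (Fin n) ℝ) :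
    Set (Matrix (Fin m) (Fin n) ℝ) :=
  {K | costE c N K ≤ costE c N K₀}

/-- `Ks` minimizes the cost over the stabilizers. -/
def IsOptimal (c : Coeffs n m) (N : Noise mΩ n) (Ks : Matrix (Fin m) (Fin n) ℝ) : Prop :=
  Ks ∈ stabilizers c N ∧ ∀ K ∈ stabilizers c N, J c N Ks ≤ J c N K

/-- The curve `t ↦ K t`, `t ≥ 0`, stays in the set of stabilizers, where the cost is finite and
differentiable along it, and solves `dK/dt = -∇J(K)`, `K 0 = K₀`. At `t = 0` the derivative is
one-sided. -/
structure IsGradientFlow (c : Coeffs n m) (N : Noise mΩ n) (K₀ : Matrix (Fin m) (Fin n) ℝ)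
    (K : ℝ → Matrix (Fin m) (Fin n) ℝ) : Prop where
  initial : K 0 = K₀
  mem : ∀ t, 0 ≤ t → K t ∈ stabilizers c N
  finite : ∀ t, 0 ≤ t → costE c N (K t) ≠ ∞
  differentiable : ∀ t, 0 ≤ t → DifferentiableAt ℝ (J c N) (K t)
  deriv : ∀ t, 0 ≤ t → HasDerivWithinAt K (-gradMat (J c N) (K t)) (Set.Ici 0) t

/-- The gradient-domination constant
`μ = 4 J(K₀) / (λ₁(R) λ₁(Q) λ₁(Σ₀)²) (‖A‖ + ‖B‖² J(K₀) / (λ₁(R) λ₁(Σ₀)))²`. -/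
def mu (c : Coeffs n m) (N : Noise mΩ n) (K₀ : Matrix (Fin m) (Fin n) ℝ) : ℝ :=
  4 * J c N K₀ / (lamMin c.R * lamMin c.Q * lamMin (Sigma0 N) ^ 2) *
    (specNorm c.A + specNorm c.B ^ 2 * J c N K₀ / (lamMin c.R * lamMin (Sigma0 N))) ^ 2

/-- The auxiliary constant `μ̃` in the smoothness constant. -/
def muTilde (c : Coeffs n m) (N : Noise mΩ n) (K₀ : Matrix (Fin m) (Fin n) ℝ) : ℝ :=
  specNorm c.B + specNorm c.D * frobNorm c.C +
    2 * specNorm c.B * J c N K₀ * specNorm c.D ^ 2 / (lamMin (Sigma0 N) * lamMin c.R) +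
    specNorm c.A * specNorm c.D ^ 2 / specNorm c.B

/-- The auxiliary constant `ξ` in the smoothness constant. -/
def xiConst (c : Coeffs n m) (N : Noise mΩ n) (K₀ : Matrix (Fin m) (Fin n) ℝ) : ℝ :=
  √(n : ℝ) * J c N K₀ / lamMin (Sigma0 N) *
    (muTilde c N K₀ * J c N K₀ / (lamMin (Sigma0 N) * lamMin c.Q) +
      √((muTilde c N K₀ * J c N K₀ / (lamMin (Sigma0 N) * lamMin c.Q)) ^ 2 +
        lamMax c.R / lamMin c.Q))

/-- The smoothness constant `L`; its formula presupposes `B ≠ 0`. -/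
def Lconst (c : Coeffs n m) (N : Noise mΩ n) (K₀ : Matrix (Fin m) (Fin n) ℝ) : ℝ :=
  2 * J c N K₀ / lamMin c.Q *
    (lamMax c.R + J c N K₀ * specNorm c.D ^ 2 / lamMin (Sigma0 N) +
      (specNorm c.B + specNorm c.C * specNorm c.D +
        2 * specNorm c.B * frobNorm c.D ^ 2 * J c N K₀ / (lamMin (Sigma0 N) * lamMin c.R) +
        specNorm c.A * frobNorm c.D ^ 2 / specNorm c.B) * xiConst c N K₀)

end Problem

end SLQ

end

/-!
Two facts carry the proof: the second moments of the closed loop obey a deterministic linear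
equation, and the resulting cost, although not convex in the gain, has an exact quadratic expansion.

**Reduction to matrices.** Write `F = A + B K` and `G = C + D K`. The Brownian motion enters only
through the orthogonality and isometry of its increments, so it is treated as a white noise on the
Hilbert space `L²` filtered by the subspaces of past-measurable variables (`IsNoise`, `isNoise`).
Itô integrals are limits of dyadic Riemann sums (`tendsto_integ`), the linear equation is solved by
Picard iteration (`exists_isAbstractSolution`), and the Itô product rule for expectations
(`IsNoise.hasDerivWithinAt_inner`) shows that `M t = 𝔼 [X (X')ᵀ]`, for two solutions `X`
and `X'`, satisfies `M' = F M + M Fᵀ + G M Gᵀ`. Hence `M t` is the image of `M 0` under the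
semigroup `lyapFlow F G` (`moment_eq_lyapFlow`), which preserves positive semidefinite matrices
because second moments are positive semidefinite (`flowPositive`). A gain is a mean-square
stabilizer if and only if this semigroup tends to zero (`mem_stabilizers_iff`), and then
`J K = tr ((Q + Kᵀ R K) S)`, where `S` is the solution of `F S + S Fᵀ + G S Gᵀ = -Σ₀`
(`costE_eq`, `J_eq`).

**Gradient domination and quadratic growth.** Let `P` be the matrix with `J K = tr (P Σ₀)` for every
initial second moment, `U = R + Dᵀ P D ≥ R`, and `E = R K + Bᵀ P + Dᵀ P (C + D K)`. For stabilizers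
`K` and `K' = K + Δ` with solution `S'`, one has exactly
`J K' - J K = tr (Δᵀ U Δ S') + 2 tr (Δᵀ E S')` (`cost_sub_cost`). It follows that
`∇J K = 2 E S` (`gradMat_cost`); completing the square over `Δ` gives
`J K - J K' ≤ ‖E‖² tr S' / λ₁(R)` (`cost_sub_le`); and if `K` is critical, so that `E = 0`, the cost
grows quadratically around it (`mul_frobNorm_sub_sq_le`). On the sublevel set of `K₀` the cost
bounds `tr S'` from above, while testing the Lyapunov equation with an eigenvector of `S` bounds
`λ₁(S)` from below by `λ₁(Σ₀) / (4 d)` with `d = ‖A‖ + ‖B‖² J(K₀) / (λ₁(R) λ₁(Σ₀))`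
(`lamMin_le_driftBound_mul`). Together these are the inequality `J K - J K' ≤ μ ‖∇J K‖²`
(`cost_sub_le_frobNorm_grad`).

**The flow.** Sublevel sets of the cost within the stabilizers are compact (`isCompact_sublevel`):
`K` and `S` are bounded there, and by Lyapunov's criterion (`tendsto_lyapFlow_of_lyap_eq`) a limit
of pairs `(K, S)` again comes from a stabilizer. So a minimizer exists, and the gradient flow, which
does not leave a sublevel set, exists for all times (`exists_descent_solution`). Along it the
derivative of `J` is `-‖∇J‖²`; integrating this gives the bound on the least gradient, and gradient
domination gives the exponential decay of the optimality gap (`cost_sub_le_exp`). Quadratic growth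
around the minimizer turns the latter into convergence of the gains (`frobNorm_sub_sq_le_exp`). The
growth constant `4 d / (λ₁(R) λ₁(Σ₀))` is at most `16 μ² L` (`growth_const_le`), which uses only the
first summand of `L` (`le_Lconst`).
-/

noncomputable section

namespace SLQ

/-! ### Integrators on a Hilbert space -/

section Integrator

section Grid

variable {H : Type*}

/-- The process `r ↦ y ⌊r⌋` with `r` rounded down to a multiple of `2⁻ᵏ`. -/
def stepProc (k : ℕ) (y : ℝ≥0 → H) (r : ℝ≥0) : H := y ((⌊r * 2 ^ k⌋₊ : ℝ≥0) / 2 ^ k)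

theorem stepProc_div (k a : ℕ) (y : ℝ≥0 → H) (j : ℕ) :
    stepProc k y ((j : ℝ≥0) / 2 ^ (k + a)) = y (((j / 2 ^ a : ℕ) : ℝ≥0) / 2 ^ k) := by
  have : (j : ℝ≥0) / 2 ^ (k + a) * 2 ^ k = (j : ℝ≥0) / ((2 ^ a : ℕ) : ℝ≥0) := by
    push_cast
    rw [pow_add]
    field_simp
  rw [stepProc, this, Nat.floor_div_eq_div]

end Grid

variable {H : Type*} [NormedAddCommGroup H] [InnerProductSpace ℝ H]

/-- The point of `[s, t]` closest to `x`. -/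
def clampTo (s t x : ℝ≥0) : ℝ≥0 := max s (min x t)

theorem clampTo_mono (s t : ℝ≥0) : Monotone (clampTo s t) := fun _ _ h =>
  max_le_max le_rfl (min_le_min h le_rfl)

theorem clampTo_of_le {s t x : ℝ≥0} (h : x ≤ t) : clampTo s t x = max s x := by
  simp [clampTo, min_eq_left h]

theorem clampTo_of_ge {s t x : ℝ≥0} (hs : s ≤ t) (h : t ≤ x) : clampTo s t x = t := by
  simp [clampTo, min_eq_right h, hs]

/-- An abstract integrator on a Hilbert space `H` filtered by closed subspaces `S t`: the vector
`d s t y` plays the role of the integral over `(s, t]` of the constant integrand `y ∈ S s`.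
The last field is a common form of the Itô isometry (`κ = 1`) and of the Cauchy-Schwarz inequality
for time integrals (`κ h = h`). -/
structure IsIntegrator (S : ℝ≥0 → Submodule ℝ H) (d : ℝ≥0 → ℝ≥0 → H → H) (κ : ℝ → ℝ) :
    Prop where
  mono : Monotone S
  closed : ∀ t, IsClosed (S t : Set H)
  mem : ∀ {s t y}, s ≤ t → y ∈ S s → d s t y ∈ S t
  self : ∀ s y, d s s y = 0
  add : ∀ {s t y z}, s ≤ t → y ∈ S s → z ∈ S s → d s t (y + z) = d s t y + d s t z
  smul : ∀ {s t y} (a : ℝ), s ≤ t → y ∈ S s → d s t (a • y) = a • d s t y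
  chasles : ∀ {s t u y}, s ≤ t → t ≤ u → y ∈ S s → d s u y = d s t y + d t u y
  kappa_nonneg : ∀ h, 0 ≤ h → 0 ≤ κ h
  bound : ∀ (p : ℕ → ℝ≥0) (y : ℕ → H) (N : ℕ), Monotone p → (∀ i < N, y i ∈ S (p i)) →
    ‖∑ i ∈ Finset.range N, d (p i) (p (i + 1)) (y i)‖ ^ 2 ≤
      κ (p N - p 0) * ∑ i ∈ Finset.range N, ((p (i + 1) : ℝ) - p i) * ‖y i‖ ^ 2

/-- The left-endpoint Riemann sum over `(s, t]` of the process `y` along the dyadic grid of mesh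
`2⁻ᵏ` intersected with `[s, t]`. -/
def riem (d : ℝ≥0 → ℝ≥0 → H → H) (s t : ℝ≥0) (k : ℕ) (y : ℝ≥0 → H) : H :=
  ∑ i ∈ Finset.range ⌈t * 2 ^ k⌉₊,
    d (clampTo s t ((i : ℝ≥0) / 2 ^ k)) (clampTo s t (((i + 1 : ℕ) : ℝ≥0) / 2 ^ k))
      (y ((i : ℝ≥0) / 2 ^ k))

/-- The integral over `(0, t]`: the limit of the Riemann sums. It exists for continuous adapted
integrands (`IsIntegrator.tendsto_integ`) and is a junk value otherwise. -/
def integ (d : ℝ≥0 → ℝ≥0 → H → H) (y : ℝ≥0 → H) (t : ℝ≥0) : H :=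
  limUnder atTop fun k => riem d 0 t k y

theorem dyadic_lt {t : ℝ≥0} {k i : ℕ} (h : i < ⌈t * 2 ^ k⌉₊) : (i : ℝ≥0) / 2 ^ k < t := by
  rw [Nat.lt_ceil] at h
  exact (div_lt_iff₀ (by positivity)).2 h

theorem le_dyadic {t : ℝ≥0} {k i : ℕ} (h : ⌈t * 2 ^ k⌉₊ ≤ i) : t ≤ (i : ℝ≥0) / 2 ^ k := by
  rw [Nat.ceil_le] at h
  exact (le_div_iff₀ (by positivity)).2 h

theorem dyadic_mono (k : ℕ) : Monotone fun i : ℕ => (i : ℝ≥0) / 2 ^ k := fun i j h => by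
  have : (i : ℝ≥0) ≤ j := by exact_mod_cast h
  dsimp only
  gcongr

variable {S : ℝ≥0 → Submodule ℝ H} {d : ℝ≥0 → ℝ≥0 → H → H} {κ : ℝ → ℝ}

/-- The integrand of each term of a Riemann sum lies in the past of the left endpoint of its
interval. -/
theorem mem_clamp {y : ℝ≥0 → H} {s t : ℝ≥0}
    (hy : ∀ r ≤ t, y r ∈ S (max s r)) {k i : ℕ} (h : i < ⌈t * 2 ^ k⌉₊) :
    y ((i : ℝ≥0) / 2 ^ k) ∈ S (clampTo s t ((i : ℝ≥0) / 2 ^ k)) := by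
  rw [clampTo_of_le (dyadic_lt h).le]
  exact hy _ (dyadic_lt h).le

namespace IsIntegrator

theorem norm_riem_sq_le_sum (hd : IsIntegrator S d κ) {y : ℝ≥0 → H} {s t : ℝ≥0} (hst : s ≤ t)
    (hy : ∀ r ≤ t, y r ∈ S (max s r)) (k : ℕ) :
    ‖riem d s t k y‖ ^ 2 ≤ κ (t - s) * ∑ i ∈ Finset.range ⌈t * 2 ^ k⌉₊,
      ((clampTo s t (((i + 1 : ℕ) : ℝ≥0) / 2 ^ k) : ℝ) - clampTo s t ((i : ℝ≥0) / 2 ^ k)) *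
        ‖y ((i : ℝ≥0) / 2 ^ k)‖ ^ 2 := by
  have h := hd.bound (fun i => clampTo s t ((i : ℝ≥0) / 2 ^ k)) (fun i => y ((i : ℝ≥0) / 2 ^ k))
    ⌈t * 2 ^ k⌉₊ ((clampTo_mono s t).comp (dyadic_mono k)) (fun i hi => mem_clamp hy hi)
  have h0 : clampTo s t (((0 : ℕ) : ℝ≥0) / 2 ^ k) = s := by simp [clampTo]
  rw [clampTo_of_ge hst (le_dyadic le_rfl), h0] at h
  exact h

/-- Riemann sums are controlled by any potential `Ψ` whose increments dominate the energy. -/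
theorem norm_riem_sq_le_potential (hd : IsIntegrator S d κ) {y : ℝ≥0 → H} {t : ℝ≥0}
    (hy : ∀ r, y r ∈ S r) (Ψ : ℝ≥0 → ℝ)
    (hΨ : ∀ a b, a ≤ b → b ≤ t → ((b : ℝ) - a) * ‖y a‖ ^ 2 ≤ Ψ b - Ψ a) (k : ℕ) :
    ‖riem d 0 t k y‖ ^ 2 ≤ κ t * (Ψ t - Ψ 0) := by
  have h := hd.norm_riem_sq_le_sum (zero_le (a := t)) (y := y) (fun r _ => by simpa using hy r) k
  simp only [NNReal.coe_zero, sub_zero] at h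
  refine h.trans (mul_le_mul_of_nonneg_left ?_ (hd.kappa_nonneg _ t.2))
  have key : ∀ i ∈ Finset.range ⌈t * 2 ^ k⌉₊,
      ((clampTo 0 t (((i + 1 : ℕ) : ℝ≥0) / 2 ^ k) : ℝ) - clampTo 0 t ((i : ℝ≥0) / 2 ^ k)) *
        ‖y ((i : ℝ≥0) / 2 ^ k)‖ ^ 2 ≤
      Ψ (clampTo 0 t (((i + 1 : ℕ) : ℝ≥0) / 2 ^ k)) - Ψ (clampTo 0 t ((i : ℝ≥0) / 2 ^ k)) := by
    intro i hi
    have hi' := dyadic_lt (Finset.mem_range.1 hi)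
    have h1 : clampTo 0 t ((i : ℝ≥0) / 2 ^ k) = (i : ℝ≥0) / 2 ^ k := by
      rw [clampTo_of_le hi'.le]; simp
    have h2 := hΨ (clampTo 0 t ((i : ℝ≥0) / 2 ^ k)) (clampTo 0 t (((i + 1 : ℕ) : ℝ≥0) / 2 ^ k))
      (clampTo_mono 0 t (dyadic_mono k i.le_succ)) (by simp [clampTo])
    rw [h1] at h2 ⊢
    exact h2
  refine (Finset.sum_le_sum key).trans ?_
  rw [Finset.sum_range_sub (fun i => Ψ (clampTo 0 t ((i : ℝ≥0) / 2 ^ k)))]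
  rw [clampTo_of_ge zero_le (le_dyadic le_rfl)]
  simp [clampTo]

/-- The bound is only needed at the grid points whose cell meets `(s, t]`. -/
theorem norm_riem_sq_le (hd : IsIntegrator S d κ) {y : ℝ≥0 → H} {s t : ℝ≥0} (hst : s ≤ t)
    (hy : ∀ r ≤ t, y r ∈ S (max s r)) {b : ℝ} {k : ℕ}
    (hb : ∀ r ≤ t, s < r + (2 ^ k)⁻¹ → ‖y r‖ ^ 2 ≤ b) :
    ‖riem d s t k y‖ ^ 2 ≤ κ (t - s) * ((t - s) * b) := by
  refine (hd.norm_riem_sq_le_sum hst hy k).trans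
    (mul_le_mul_of_nonneg_left ?_ (hd.kappa_nonneg _ (sub_nonneg.2 (by exact_mod_cast hst))))
  have key : ∀ i ∈ Finset.range ⌈t * 2 ^ k⌉₊,
      ((clampTo s t (((i + 1 : ℕ) : ℝ≥0) / 2 ^ k) : ℝ) - clampTo s t ((i : ℝ≥0) / 2 ^ k)) *
        ‖y ((i : ℝ≥0) / 2 ^ k)‖ ^ 2 ≤
      (clampTo s t (((i + 1 : ℕ) : ℝ≥0) / 2 ^ k) : ℝ) * b -
        (clampTo s t ((i : ℝ≥0) / 2 ^ k) : ℝ) * b := by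
    intro i hi
    have hi' := dyadic_lt (Finset.mem_range.1 hi)
    have hm : (clampTo s t ((i : ℝ≥0) / 2 ^ k) : ℝ) ≤
        clampTo s t (((i + 1 : ℕ) : ℝ≥0) / 2 ^ k) := by
      exact_mod_cast clampTo_mono s t (dyadic_mono k i.le_succ)
    by_cases hc : s < (i : ℝ≥0) / 2 ^ k + (2 ^ k)⁻¹
    · rw [← sub_mul]
      exact mul_le_mul_of_nonneg_left (hb _ hi'.le hc) (sub_nonneg.2 hm)
    · have e : (((i + 1 : ℕ) : ℝ≥0) / 2 ^ k) = (i : ℝ≥0) / 2 ^ k + (2 ^ k)⁻¹ := by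
        push_cast; rw [add_div, one_div]
      have h1 : clampTo s t (((i + 1 : ℕ) : ℝ≥0) / 2 ^ k) = s := by
        rw [e]
        exact max_eq_left ((min_le_left _ _).trans (not_lt.1 hc))
      have h2 : clampTo s t ((i : ℝ≥0) / 2 ^ k) = s :=
        le_antisymm ((clampTo_mono s t (dyadic_mono k i.le_succ)).trans h1.le) (le_max_left _ _)
      rw [h1, h2]; simp
  refine (Finset.sum_le_sum key).trans ?_
  rw [Finset.sum_range_sub (fun i : ℕ => (clampTo s t ((i : ℝ≥0) / 2 ^ k) : ℝ) * b)]
  have h0 : clampTo s t (((0 : ℕ) : ℝ≥0) / 2 ^ k) = s := by simp [clampTo]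
  rw [clampTo_of_ge hst (le_dyadic le_rfl), h0, sub_mul]

theorem sub (hd : IsIntegrator S d κ) {s t : ℝ≥0} {y z : H} (hst : s ≤ t) (hy : y ∈ S s)
    (hz : z ∈ S s) : d s t (y - z) = d s t y - d s t z := by
  have h := hd.add hst hy ((S s).smul_mem (-1) hz)
  rw [hd.smul _ hst hz] at h
  simpa [sub_eq_add_neg] using h

theorem riem_sub (hd : IsIntegrator S d κ) {y z : ℝ≥0 → H} {s t : ℝ≥0}
    (hy : ∀ r ≤ t, y r ∈ S (max s r)) (hz : ∀ r ≤ t, z r ∈ S (max s r)) (k : ℕ) :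
    riem d s t k (fun r => y r - z r) = riem d s t k y - riem d s t k z := by
  rw [riem, riem, riem, ← Finset.sum_sub_distrib]
  refine Finset.sum_congr rfl fun i hi => hd.sub (clampTo_mono s t (dyadic_mono k i.le_succ))
    (mem_clamp hy (Finset.mem_range.1 hi)) (mem_clamp hz (Finset.mem_range.1 hi))

theorem sum_const (hd : IsIntegrator S d κ) {p : ℕ → ℝ≥0} (hp : Monotone p) {y : H}
    (hy : y ∈ S (p 0)) (N : ℕ) :
    ∑ i ∈ Finset.range N, d (p i) (p (i + 1)) y = d (p 0) (p N) y := by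
  induction N with
  | zero => simp [hd.self]
  | succ N ih => rw [Finset.sum_range_succ, ih,
      hd.chasles (hp (Nat.zero_le N)) (hp N.le_succ) hy]

theorem riem_const (hd : IsIntegrator S d κ) {s t : ℝ≥0} (hst : s ≤ t) {y : H} (hy : y ∈ S s)
    (k : ℕ) : riem d s t k (fun _ => y) = d s t y := by
  have h0 : clampTo s t (((0 : ℕ) : ℝ≥0) / 2 ^ k) = s := by simp [clampTo]
  have h := hd.sum_const (p := fun i => clampTo s t ((i : ℝ≥0) / 2 ^ k))
    ((clampTo_mono s t).comp (dyadic_mono k)) (y := y) (by simpa only [h0] using hy) ⌈t * 2 ^ k⌉₊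
  simp only [h0, clampTo_of_ge hst (le_dyadic le_rfl)] at h
  exact h

/-- Beyond the right endpoint the Riemann sum may be continued by vanishing terms. -/
theorem sum_eq_riem (hd : IsIntegrator S d κ) (y : ℝ≥0 → H) {s t : ℝ≥0} (hst : s ≤ t) {k N : ℕ}
    (hN : ⌈t * 2 ^ k⌉₊ ≤ N) :
    ∑ i ∈ Finset.range N, d (clampTo s t ((i : ℝ≥0) / 2 ^ k))
      (clampTo s t (((i + 1 : ℕ) : ℝ≥0) / 2 ^ k)) (y ((i : ℝ≥0) / 2 ^ k)) = riem d s t k y := by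
  rw [riem]
  symm
  refine Finset.sum_subset (Finset.range_mono hN) fun i _ hi => ?_
  have hi' := le_dyadic (not_lt.1 (Finset.mem_range.not.1 hi))
  rw [clampTo_of_ge hst hi', clampTo_of_ge hst (hi'.trans (dyadic_mono k i.le_succ)), hd.self]

/-- Riemann sums are additive in the interval of integration. -/
theorem riem_sub_riem (hd : IsIntegrator S d κ) {y : ℝ≥0 → H} (hy : ∀ r, y r ∈ S r) {s t : ℝ≥0}
    (hst : s ≤ t) (k : ℕ) : riem d 0 t k y - riem d 0 s k y = riem d s t k y := by
  have hle : ⌈s * 2 ^ k⌉₊ ≤ ⌈t * 2 ^ k⌉₊ := Nat.ceil_mono (by gcongr)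
  rw [← hd.sum_eq_riem y (zero_le (a := s)) hle, riem, riem, ← Finset.sum_sub_distrib]
  refine Finset.sum_congr rfl fun i hi => ?_
  have hx : (i : ℝ≥0) / 2 ^ k < t := dyadic_lt (Finset.mem_range.1 hi)
  have hxx : (i : ℝ≥0) / 2 ^ k ≤ ((i + 1 : ℕ) : ℝ≥0) / 2 ^ k := dyadic_mono k i.le_succ
  have hyx := hy ((i : ℝ≥0) / 2 ^ k)
  generalize (i : ℝ≥0) / 2 ^ k = x at *
  generalize ((i + 1 : ℕ) : ℝ≥0) / 2 ^ k = x' at *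
  simp only [clampTo, min_eq_left hx.le, zero_le, sup_of_le_right]
  rcases le_total s x with h | h
  · rw [min_eq_right h, min_eq_right (h.trans hxx), hd.self, max_eq_right h,
      max_eq_right (le_min (h.trans hxx) hst), sub_zero]
  · rw [min_eq_left h, max_eq_left h]
    rcases le_total s x' with h' | h'
    · rw [min_eq_right h', max_eq_right (le_min h' hst), hd.chasles h (le_min h' hst) hyx]
      abel
    · rw [min_eq_left h', min_eq_left (h'.trans hst), max_eq_left h', hd.self, sub_self]

theorem sum_range_two_mul {M : Type*} [AddCommMonoid M] (f : ℕ → M) (N : ℕ) :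
    ∑ i ∈ Finset.range (2 * N), f i = ∑ j ∈ Finset.range N, (f (2 * j) + f (2 * j + 1)) := by
  induction N with
  | zero => simp
  | succ N ih =>
    rw [show 2 * (N + 1) = 2 * N + 1 + 1 by ring, Finset.sum_range_succ, Finset.sum_range_succ,
      Finset.sum_range_succ, ih, add_assoc]

/-- Halving the mesh does not change the Riemann sum of a process that is constant on the cells of
the coarser grid. -/
theorem riem_succ (hd : IsIntegrator S d κ) {y : ℝ≥0 → H} {s t : ℝ≥0} (hst : s ≤ t)
    (hy : ∀ r ≤ t, y r ∈ S (max s r)) {k : ℕ}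
    (hc : ∀ j : ℕ, y (((2 * j + 1 : ℕ) : ℝ≥0) / 2 ^ (k + 1)) = y ((j : ℝ≥0) / 2 ^ k)) :
    riem d s t (k + 1) y = riem d s t k y := by
  have hN : ⌈t * 2 ^ (k + 1)⌉₊ ≤ 2 * ⌈t * 2 ^ k⌉₊ := by
    rw [Nat.ceil_le]
    push_cast
    calc t * 2 ^ (k + 1) = 2 * (t * 2 ^ k) := by ring
      _ ≤ 2 * _ := by gcongr; exact Nat.le_ceil _
  rw [← hd.sum_eq_riem y hst hN, sum_range_two_mul, riem]
  refine Finset.sum_congr rfl fun j hj => ?_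
  have e1 : ∀ a : ℕ, ((2 * a : ℕ) : ℝ≥0) / 2 ^ (k + 1) = (a : ℝ≥0) / 2 ^ k := fun a => by
    push_cast
    rw [pow_succ']
    exact mul_div_mul_left _ _ two_ne_zero
  rw [show 2 * j + 1 + 1 = 2 * (j + 1) by ring, e1, e1, hc]
  have h1 := dyadic_mono (k + 1) (show 2 * j ≤ 2 * j + 1 by lia)
  have h2 := dyadic_mono (k + 1) (show 2 * j + 1 ≤ 2 * (j + 1) by lia)
  simp only [e1] at h1 h2
  exact (hd.chasles (clampTo_mono s t h1) (clampTo_mono s t h2)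
    (mem_clamp hy (Finset.mem_range.1 hj))).symm

end IsIntegrator

theorem stepProc_le (k : ℕ) (r : ℝ≥0) : (⌊r * 2 ^ k⌋₊ : ℝ≥0) / 2 ^ k ≤ r :=
  (div_le_iff₀ (by positivity)).2 (Nat.floor_le zero_le)

theorem lt_stepProc (k : ℕ) (r : ℝ≥0) : r < (⌊r * 2 ^ k⌋₊ : ℝ≥0) / 2 ^ k + (2 ^ k)⁻¹ := by
  rw [← one_div, ← add_div, lt_div_iff₀ (by positivity)]
  exact Nat.lt_floor_add_one _

namespace IsIntegrator

theorem stepProc_mem (hd : IsIntegrator S d κ) {y : ℝ≥0 → H} (hy : ∀ r, y r ∈ S r) (k : ℕ)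
    (r : ℝ≥0) : stepProc k y r ∈ S r :=
  hd.mono (stepProc_le k r) (hy _)

/-- A Riemann sum of `y` is also the Riemann sum, on every finer grid, of the process frozen on the
cells. The difference of two Riemann sums of `y` is thus a Riemann sum of a small process. -/
theorem riem_stepProc (hd : IsIntegrator S d κ) {y : ℝ≥0 → H} (hy : ∀ r, y r ∈ S r) (t : ℝ≥0)
    (k a : ℕ) : riem d 0 t (k + a) (stepProc k y) = riem d 0 t k y := by
  induction a with
  | zero =>
    refine Finset.sum_congr rfl fun i _ => ?_
    have := stepProc_div k 0 y i
    simp only [add_zero, pow_zero, Nat.div_one] at this ⊢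
    rw [this]
  | succ a ih =>
    rw [← ih, ← add_assoc]
    refine hd.riem_succ zero_le (fun r _ => by simpa using hd.stepProc_mem hy k r) fun j => ?_
    rw [add_assoc, stepProc_div, stepProc_div, pow_succ', ← Nat.div_div_eq_div_mul]
    congr 4
    lia

theorem cauchySeq_riem (hd : IsIntegrator S d κ) {y : ℝ≥0 → H} (hy : ∀ r, y r ∈ S r)
    (hc : Continuous y) (t : ℝ≥0) : CauchySeq fun k => riem d 0 t k y := by
  have hu : UniformContinuousOn y (Set.Icc 0 t) :=
    isCompact_Icc.uniformContinuousOn_of_continuous hc.continuousOn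
  rw [Metric.uniformContinuousOn_iff] at hu
  have hpos : 0 < κ t * t + 1 := by
    have := mul_nonneg (hd.kappa_nonneg _ t.2) t.2
    exact lt_of_lt_of_le one_pos (le_add_of_nonneg_left this)
  refine Metric.cauchySeq_iff'.2 fun ε hε => ?_
  obtain ⟨δ, hδ, h⟩ := hu (ε / (κ t * t + 1)) (by positivity)
  obtain ⟨k, hk⟩ := exists_pow_lt_of_lt_one hδ (show (2⁻¹ : ℝ) < 1 by norm_num)
  refine ⟨k, fun l hl => ?_⟩
  obtain ⟨a, rfl⟩ := Nat.exists_eq_add_of_le hl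
  have h1 : ∀ r ≤ t, y r ∈ S (max 0 r) := fun r _ => by simpa using hy r
  have h2 : ∀ r ≤ t, stepProc k y r ∈ S (max 0 r) := fun r _ => by
    simpa using hd.stepProc_mem hy k r
  rw [dist_eq_norm, ← hd.riem_stepProc hy t k a, ← hd.riem_sub h1 h2]
  have hb : ∀ r ≤ t, (0 : ℝ≥0) < r + (2 ^ (k + a))⁻¹ →
      ‖y r - stepProc k y r‖ ^ 2 ≤ (ε / (κ t * t + 1)) ^ 2 := by
    intro r hr _
    refine pow_le_pow_left₀ (norm_nonneg _) ?_ 2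
    rw [← dist_eq_norm]
    refine (h r ⟨zero_le, hr⟩ _ ⟨zero_le, (stepProc_le k r).trans hr⟩ ?_).le
    have h3 : ((⌊r * 2 ^ k⌋₊ : ℝ≥0) / 2 ^ k : ℝ≥0) ≤ (r : ℝ) := by
      exact_mod_cast stepProc_le k r
    have h4 : (r : ℝ) < ((⌊r * 2 ^ k⌋₊ : ℝ≥0) / 2 ^ k : ℝ≥0) + ((2 ^ k)⁻¹ : ℝ≥0) := by
      exact_mod_cast lt_stepProc k r
    rw [NNReal.dist_eq, abs_of_nonneg (sub_nonneg.2 h3)]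
    have h5 : (((2 ^ k)⁻¹ : ℝ≥0) : ℝ) < δ := by
      rw [inv_pow] at hk
      simpa using hk
    linarith
  have h3 := hd.norm_riem_sq_le (zero_le (a := t)) (y := fun r => y r - stepProc k y r)
    (fun r hr => Submodule.sub_mem _ (h1 r hr) (h2 r hr)) hb
  simp only [NNReal.coe_zero, sub_zero] at h3
  refine lt_of_pow_lt_pow_left₀ 2 hε.le (h3.trans_lt ?_)
  rw [← mul_assoc, div_pow, mul_div_assoc', div_lt_iff₀ (by positivity), mul_comm]
  have h0 : 0 ≤ κ t * t := mul_nonneg (hd.kappa_nonneg _ t.2) t.2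
  refine mul_lt_mul_of_pos_left ?_ (by positivity)
  nlinarith

theorem riem_mem (hd : IsIntegrator S d κ) {y : ℝ≥0 → H} (hy : ∀ r, y r ∈ S r) (t : ℝ≥0)
    (k : ℕ) : riem d 0 t k y ∈ S t :=
  Submodule.sum_mem _ fun i hi => hd.mono (by simp [clampTo])
    (hd.mem (clampTo_mono 0 t (dyadic_mono k i.le_succ))
      (mem_clamp (fun r _ => by simpa using hy r) (Finset.mem_range.1 hi)))

theorem integ_zero (y : ℝ≥0 → H) : integ d y 0 = 0 := by
  have : (fun k => riem d 0 0 k y) = fun _ => 0 := by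
    funext k
    simp [riem]
  rw [integ, this]
  exact tendsto_const_nhds.limUnder_eq

variable [CompleteSpace H]

theorem tendsto_integ (hd : IsIntegrator S d κ) {y : ℝ≥0 → H} (hy : ∀ r, y r ∈ S r)
    (hc : Continuous y) (t : ℝ≥0) :
    Tendsto (fun k => riem d 0 t k y) atTop (𝓝 (integ d y t)) :=
  (hd.cauchySeq_riem hy hc t).tendsto_limUnder

theorem integ_mem (hd : IsIntegrator S d κ) {y : ℝ≥0 → H} (hy : ∀ r, y r ∈ S r)
    (hc : Continuous y) (t : ℝ≥0) : integ d y t ∈ S t :=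
  (hd.closed t).mem_of_tendsto (hd.tendsto_integ hy hc t)
    (Eventually.of_forall fun k => hd.riem_mem hy t k)

theorem tendsto_riem (hd : IsIntegrator S d κ) {y : ℝ≥0 → H} (hy : ∀ r, y r ∈ S r)
    (hc : Continuous y) {s t : ℝ≥0} (hst : s ≤ t) :
    Tendsto (fun k => riem d s t k y) atTop (𝓝 (integ d y t - integ d y s)) := by
  simpa only [hd.riem_sub_riem hy hst] using
    (hd.tendsto_integ hy hc t).sub (hd.tendsto_integ hy hc s)

theorem integ_sub (hd : IsIntegrator S d κ) {y z : ℝ≥0 → H} (hy : ∀ r, y r ∈ S r)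
    (hc : Continuous y) (hz : ∀ r, z r ∈ S r) (hcz : Continuous z) (t : ℝ≥0) :
    integ d (fun r => y r - z r) t = integ d y t - integ d z t := by
  refine tendsto_nhds_unique (hd.tendsto_integ (fun r => Submodule.sub_mem _ (hy r) (hz r))
    (hc.sub hcz) t) ?_
  simp only [hd.riem_sub (s := 0) (t := t) (y := y) (z := z) (fun r _ => by simpa using hy r)
    (fun r _ => by simpa using hz r)]
  exact (hd.tendsto_integ hy hc t).sub (hd.tendsto_integ hz hcz t)

theorem norm_integ_sq_le_potential (hd : IsIntegrator S d κ) {y : ℝ≥0 → H} {t : ℝ≥0}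
    (hy : ∀ r, y r ∈ S r) (hc : Continuous y) (Ψ : ℝ≥0 → ℝ)
    (hΨ : ∀ a b, a ≤ b → b ≤ t → ((b : ℝ) - a) * ‖y a‖ ^ 2 ≤ Ψ b - Ψ a) :
    ‖integ d y t‖ ^ 2 ≤ κ t * (Ψ t - Ψ 0) :=
  le_of_tendsto ((hd.tendsto_integ hy hc t).norm.pow 2)
    (Eventually.of_forall fun k => hd.norm_riem_sq_le_potential hy Ψ hΨ k)

/-- The Itô isometry, as an inequality, over `(s, t]`. -/
theorem norm_integ_sub_sq_le (hd : IsIntegrator S d κ) {y : ℝ≥0 → H}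
    (hy : ∀ r, y r ∈ S r) (hc : Continuous y) {s t : ℝ≥0} (hst : s ≤ t) {b : ℝ}
    (hb : ∀ r ≤ t, ‖y r‖ ^ 2 ≤ b) :
    ‖integ d y t - integ d y s‖ ^ 2 ≤ κ (t - s) * ((t - s) * b) :=
  le_of_tendsto ((hd.tendsto_riem hy hc hst).norm.pow 2)
    (Eventually.of_forall fun _ => hd.norm_riem_sq_le hst
      (fun r _ => hd.mono (le_max_right _ _) (hy r)) fun r hr _ => hb r hr)

/-- Over a short interval the integral is close to the integral of the frozen integrand. -/
theorem integ_increment_approx (hd : IsIntegrator S d κ) {y : ℝ≥0 → H}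
    (hy : ∀ r, y r ∈ S r) (hc : Continuous y) (s : ℝ≥0) {ε : ℝ} (hε : 0 < ε) :
    ∃ δ > 0, ∀ t, s ≤ t → t < s + δ →
      ‖integ d y t - integ d y s - d s t (y s)‖ ^ 2 ≤ κ (t - s) * ((t - s) * ε) := by
  obtain ⟨δ, hδ, h⟩ := Metric.continuous_iff.1 hc s (√ε) (Real.sqrt_pos.2 hε)
  refine ⟨⟨δ, hδ.le⟩, hδ, fun t hst ht => ?_⟩
  have ht' : (t : ℝ) < s + δ := by exact_mod_cast ht
  have hyr : ∀ r ≤ t, y r ∈ S (max s r) := fun r _ => hd.mono (le_max_right _ _) (hy r)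
  have hys : ∀ r ≤ t, y s ∈ S (max s r) := fun r _ => hd.mono (le_max_left _ _) (hy s)
  refine le_of_tendsto (((hd.tendsto_riem hy hc hst).sub_const (d s t (y s))).norm.pow 2) ?_
  have h2 : ∀ᶠ k : ℕ in atTop, (2⁻¹ : ℝ) ^ k < δ :=
    (tendsto_pow_atTop_nhds_zero_of_lt_one (by norm_num) (by norm_num)).eventually (gt_mem_nhds hδ)
  filter_upwards [h2] with k hk
  rw [← hd.riem_const hst (hy s) k, ← hd.riem_sub hyr hys]
  refine hd.norm_riem_sq_le hst (fun r hr => Submodule.sub_mem _ (hyr r hr) (hys r hr)) ?_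
  intro r hr hrs
  have hrs' : (s : ℝ) < r + (2 ^ k)⁻¹ := by exact_mod_cast hrs
  have hr' : (r : ℝ) ≤ t := by exact_mod_cast hr
  rw [inv_pow] at hk
  have := (h r (by rw [NNReal.dist_eq, abs_lt]; constructor <;> linarith)).le
  rw [dist_eq_norm] at this
  calc ‖y r - y s‖ ^ 2 ≤ √ε ^ 2 := pow_le_pow_left₀ (norm_nonneg _) this 2
    _ = ε := Real.sq_sqrt hε.le

theorem continuous_integ (hd : IsIntegrator S d κ) (hκ : ∀ T : ℝ, ∃ C, ∀ h, 0 ≤ h → h ≤ T → κ h ≤ C)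
    {y : ℝ≥0 → H} (hy : ∀ r, y r ∈ S r) (hc : Continuous y) : Continuous (integ d y) := by
  rw [continuous_iff_continuousAt]
  intro s
  obtain ⟨b, hb⟩ := (isCompact_Icc (a := (0 : ℝ≥0)) (b := s + 1)).exists_bound_of_continuousOn
    (f := y) hc.continuousOn
  obtain ⟨C, hC⟩ := hκ (s + 1)
  have hC0 : 0 ≤ C := (hd.kappa_nonneg 0 le_rfl).trans (hC 0 le_rfl (by positivity))
  have key : ∀ t ≤ s + 1, ‖integ d y t - integ d y s‖ ^ 2 ≤ C * (|(t : ℝ) - s| * b ^ 2) := by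
    have aux : ∀ u v : ℝ≥0, u ≤ v → v ≤ s + 1 →
        ‖integ d y v - integ d y u‖ ^ 2 ≤ C * (|(v : ℝ) - u| * b ^ 2) := by
      intro u v huv hv
      have huv' : (u : ℝ) ≤ v := by exact_mod_cast huv
      have hv' : (v : ℝ) ≤ s + 1 := by exact_mod_cast hv
      rw [abs_of_nonneg (sub_nonneg.2 huv')]
      refine (hd.norm_integ_sub_sq_le hy hc huv (b := b ^ 2) fun r hr =>
        pow_le_pow_left₀ (norm_nonneg _) (hb r ⟨zero_le, hr.trans hv⟩) 2).trans ?_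
      refine mul_le_mul_of_nonneg_right (hC _ (sub_nonneg.2 huv') ?_)
        (mul_nonneg (sub_nonneg.2 huv') (sq_nonneg _))
      have := u.2
      linarith
    intro t ht
    rcases le_total s t with h | h
    · exact aux s t h ht
    · rw [norm_sub_rev, abs_sub_comm]
      exact aux t s h (le_add_of_nonneg_right zero_le)
  have hlim : Tendsto (fun t : ℝ≥0 => √(C * (|(t : ℝ) - s| * b ^ 2))) (𝓝 s) (𝓝 0) := by
    have : Continuous fun t : ℝ≥0 => √(C * (|(t : ℝ) - s| * b ^ 2)) := by fun_prop
    simpa using this.tendsto s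
  rw [ContinuousAt, tendsto_iff_norm_sub_tendsto_zero]
  refine squeeze_zero' (Eventually.of_forall fun _ => norm_nonneg _) ?_ hlim
  filter_upwards [Iic_mem_nhds (show s < s + 1 from lt_add_of_pos_right s one_pos)] with t ht
  exact Real.le_sqrt_of_sq_le (key t ht)

end IsIntegrator

end Integrator

/-! ### White noise and the Itô product rule -/

section ItoRule

variable {H : Type*} [NormedAddCommGroup H] [InnerProductSpace ℝ H]

/-- The integrator of time integrals. -/
def timeInt (s t : ℝ≥0) (y : H) : H := ((t : ℝ) - s) • y

/-- An abstract white noise on a filtered Hilbert space: `d s t y` stands for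
`(W t - W s) y` with `y ∈ S s`. -/
structure IsNoise (S : ℝ≥0 → Submodule ℝ H) (d : ℝ≥0 → ℝ≥0 → H → H) : Prop where
  mono : Monotone S
  closed : ∀ t, IsClosed (S t : Set H)
  mem : ∀ {s t y}, s ≤ t → y ∈ S s → d s t y ∈ S t
  self : ∀ s y, d s s y = 0
  add : ∀ {s t y z}, s ≤ t → y ∈ S s → z ∈ S s → d s t (y + z) = d s t y + d s t z
  smul : ∀ {s t y} (a : ℝ), s ≤ t → y ∈ S s → d s t (a • y) = a • d s t y
  chasles : ∀ {s t u y}, s ≤ t → t ≤ u → y ∈ S s → d s u y = d s t y + d t u y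
  orth : ∀ {s t y z}, s ≤ t → y ∈ S s → z ∈ S s → inner ℝ z (d s t y) = 0
  norm_sq : ∀ {s t y}, s ≤ t → y ∈ S s → ‖d s t y‖ ^ 2 = ((t : ℝ) - s) * ‖y‖ ^ 2

variable {S : ℝ≥0 → Submodule ℝ H} {d : ℝ≥0 → ℝ≥0 → H → H}

/-- For time integrals, the energy bound is the Cauchy-Schwarz inequality. -/
theorem isIntegrator_timeInt (hm : Monotone S) (hc : ∀ t, IsClosed (S t : Set H)) :
    IsIntegrator S (timeInt (H := H)) id where
  mono := hm
  closed := hc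
  mem hst hy := Submodule.smul_mem _ _ (hm hst hy)
  self := by simp [timeInt]
  add := by simp [timeInt]
  smul a _ _ := by simp [timeInt, smul_comm a]
  chasles _ _ _ := by simp only [timeInt]; rw [← add_smul]; congr 1; ring
  kappa_nonneg _ h := h
  bound p y N hp _ := by
    have hΔ : ∀ i, 0 ≤ (p (i + 1) : ℝ) - p i := fun i =>
      sub_nonneg.2 (by exact_mod_cast hp i.le_succ)
    have h1 : ‖∑ i ∈ Finset.range N, timeInt (p i) (p (i + 1)) (y i)‖ ≤
        ∑ i ∈ Finset.range N, √((p (i + 1) : ℝ) - p i) *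
          (√((p (i + 1) : ℝ) - p i) * ‖y i‖) := by
      refine (norm_sum_le _ _).trans (Finset.sum_le_sum fun i _ => ?_)
      rw [timeInt, norm_smul, Real.norm_of_nonneg (hΔ i), ← mul_assoc, Real.mul_self_sqrt (hΔ i)]
    refine (pow_le_pow_left₀ (norm_nonneg _) h1 2).trans
      ((Finset.sum_mul_sq_le_sq_mul_sq _ _ _).trans_eq ?_)
    simp only [mul_pow, Real.sq_sqrt (hΔ _)]
    rw [Finset.sum_range_sub (fun i => (p i : ℝ)), id]

namespace IsNoise

/-- The Itô isometry, by orthogonality of the increments. -/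
theorem isIntegrator (hd : IsNoise S d) : IsIntegrator S d fun _ => 1 where
  mono := hd.mono
  closed := hd.closed
  mem := hd.mem
  self := hd.self
  add := hd.add
  smul := hd.smul
  chasles := hd.chasles
  kappa_nonneg _ _ := zero_le_one
  bound p y N hp hy := by
    rw [one_mul]
    refine le_of_eq ?_
    have hmem : ∀ M ≤ N, ∑ i ∈ Finset.range M, d (p i) (p (i + 1)) (y i) ∈ S (p M) := fun M hM =>
      Submodule.sum_mem _ fun i hi => hd.mono (hp (Finset.mem_range.1 hi))
        (hd.mem (hp i.le_succ) (hy i ((Finset.mem_range.1 hi).trans_le hM)))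
    have key : ∀ M ≤ N, ‖∑ i ∈ Finset.range M, d (p i) (p (i + 1)) (y i)‖ ^ 2 =
        ∑ i ∈ Finset.range M, ((p (i + 1) : ℝ) - p i) * ‖y i‖ ^ 2 := by
      intro M
      induction M with
      | zero => simp
      | succ M ih =>
        intro hM
        have hyM := hy M hM
        rw [Finset.sum_range_succ, Finset.sum_range_succ, norm_add_sq_real,
          hd.orth (hp M.le_succ) hyM (hmem M (by lia)), ih (by lia),
          hd.norm_sq (hp M.le_succ) hyM]
        ring
    exact key N le_rfl

theorem inner_eq (hd : IsNoise S d) {s t : ℝ≥0} {y z : H} (hst : s ≤ t) (hy : y ∈ S s)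
    (hz : z ∈ S s) : inner ℝ (d s t y) (d s t z) = ((t : ℝ) - s) * inner ℝ y z := by
  have h := hd.norm_sq hst (Submodule.add_mem _ hy hz)
  rw [hd.add hst hy hz, norm_add_sq_real, norm_add_sq_real, hd.norm_sq hst hy,
    hd.norm_sq hst hz] at h
  linarith

theorem orth_riem (hd : IsNoise S d) {y : ℝ≥0 → H} (hy : ∀ r, y r ∈ S r) {s t : ℝ≥0}
    {z : H} (hz : z ∈ S s) (k : ℕ) : inner ℝ z (riem d s t k y) = 0 := by
  rw [riem, inner_sum]
  refine Finset.sum_eq_zero fun i hi => ?_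
  exact hd.orth (clampTo_mono s t (dyadic_mono k i.le_succ))
    (mem_clamp (fun r _ => hd.mono (le_max_right _ _) (hy r)) (Finset.mem_range.1 hi))
    (hd.mono (le_max_left _ _) hz)

variable [CompleteSpace H]

/-- Stochastic integrals have orthogonal increments (the martingale property). -/
theorem orth_integ (hd : IsNoise S d) {y : ℝ≥0 → H} (hy : ∀ r, y r ∈ S r) (hc : Continuous y)
    {s t : ℝ≥0} (hst : s ≤ t) {z : H} (hz : z ∈ S s) :
    inner ℝ z (integ d y t - integ d y s) = 0 := by
  refine tendsto_nhds_unique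
    ((tendsto_const_nhds (x := z)).inner (hd.isIntegrator.tendsto_riem hy hc hst)) ?_
  simp only [hd.orth_riem hy hz]
  exact tendsto_const_nhds

end IsNoise

section Limits

variable [CompleteSpace H] {κ : ℝ → ℝ}

/-- To first order the integral over `(s, t]` is that of the integrand frozen at time `s`. The error
is `o (φ (t - s))`, with `φ h = h` for time integrals and `φ h = √h` for stochastic ones. -/
theorem IsIntegrator.tendsto_slope (hd : IsIntegrator S d κ) {y : ℝ≥0 → H}
    (hy : ∀ r, y r ∈ S r) (hc : Continuous y) (s : ℝ≥0) (φ : ℝ → ℝ)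
    (hφ : ∀ h, 0 < h → 0 < φ h ∧ κ h * h ≤ φ h ^ 2) :
    Tendsto (fun t : ℝ => (φ (t - s))⁻¹ •
      (integ d y t.toNNReal - integ d y s - d s t.toNNReal (y s))) (𝓝[>] (s : ℝ)) (𝓝 0) := by
  rw [Metric.tendsto_nhds]
  intro ε hε
  obtain ⟨δ, hδ, h⟩ := hd.integ_increment_approx hy hc s (ε := (ε / 2) ^ 2) (by positivity)
  filter_upwards [Ioo_mem_nhdsGT (show (s : ℝ) < s + δ by simpa using hδ)] with t ht
  have ht0 : 0 ≤ t := s.2.trans ht.1.le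
  have h1 : s ≤ t.toNNReal := by rw [← NNReal.coe_le_coe, Real.coe_toNNReal _ ht0]; exact ht.1.le
  have h2 : t.toNNReal < s + δ := by
    rw [← NNReal.coe_lt_coe, Real.coe_toNNReal _ ht0]; exact_mod_cast ht.2
  have h3 := h _ h1 h2
  rw [Real.coe_toNNReal _ ht0] at h3
  obtain ⟨h4, h5⟩ := hφ _ (sub_pos.2 ht.1)
  rw [dist_zero_right, norm_smul, norm_inv, Real.norm_of_nonneg h4.le, inv_mul_lt_iff₀ h4]
  have h6 : ‖integ d y t.toNNReal - integ d y s - d s t.toNNReal (y s)‖ ^ 2 ≤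
      (φ (t - s) * (ε / 2)) ^ 2 := by
    rw [mul_pow]
    refine h3.trans ?_
    rw [← mul_assoc]
    exact mul_le_mul_of_nonneg_right h5 (sq_nonneg _)
  have h7 := (pow_le_pow_iff_left₀ (norm_nonneg _) (by positivity) two_ne_zero).1 h6
  exact h7.trans_lt (mul_lt_mul_of_pos_left (half_lt_self hε) h4)

/-- Integrals are continuous under locally uniform convergence of the integrand. -/
theorem IsIntegrator.tendsto_integ_of_uniform (hd : IsIntegrator S d κ) {y : ℕ → ℝ≥0 → H}
    {z : ℝ≥0 → H} (hy : ∀ J r, y J r ∈ S r) (hc : ∀ J, Continuous (y J)) (hz : ∀ r, z r ∈ S r)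
    (hcz : Continuous z) {t : ℝ≥0} (h : TendstoUniformlyOn y z atTop (Set.Icc 0 t)) :
    Tendsto (fun J => integ d (y J) t) atTop (𝓝 (integ d z t)) := by
  rw [Metric.tendsto_nhds]
  intro ε hε
  have h0 : 0 ≤ κ t * t := mul_nonneg (hd.kappa_nonneg _ t.2) t.2
  have hpos : 0 < κ t * t + 1 := by linarith
  filter_upwards [Metric.tendstoUniformlyOn_iff.1 h (ε / (κ t * t + 1)) (by positivity)] with J hJ
  rw [dist_eq_norm, ← hd.integ_sub (hy J) (hc J) hz hcz]
  have h1 := hd.norm_integ_sub_sq_le (y := fun r => y J r - z r)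
    (fun r => Submodule.sub_mem _ (hy J r) (hz r)) ((hc J).sub hcz) (zero_le (a := t))
    (b := (ε / (κ t * t + 1)) ^ 2) (fun r hr => by
      refine pow_le_pow_left₀ (norm_nonneg _) ?_ 2
      rw [← dist_eq_norm, dist_comm]
      exact (hJ r ⟨zero_le, hr⟩).le)
  rw [integ_zero, sub_zero, NNReal.coe_zero, sub_zero] at h1
  refine lt_of_pow_lt_pow_left₀ 2 hε.le (h1.trans_lt ?_)
  rw [← mul_assoc, div_pow, mul_div_assoc', div_lt_iff₀ (by positivity), mul_comm]
  refine mul_lt_mul_of_pos_left ?_ (by positivity)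
  nlinarith

/-- The Itô product rule in mean: for `u = u₀ + ∫ f dt + ∫ g dW` and `w = w₀ + ∫ f' dt + ∫ g' dW`
the function `⟪u, w⟫` has right derivative `⟪u, f'⟫ + ⟪f, w⟫ + ⟪g, g'⟫`. -/
theorem IsNoise.hasDerivWithinAt_inner (hd : IsNoise S d) {u w f f' g g' : ℝ≥0 → H} {u₀ w₀ : H}
    (hu : ∀ r, u r ∈ S r) (hw : ∀ r, w r ∈ S r)
    (hf : ∀ r, f r ∈ S r) (hf' : ∀ r, f' r ∈ S r) (hg : ∀ r, g r ∈ S r) (hg' : ∀ r, g' r ∈ S r)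
    (hfc : Continuous f) (hfc' : Continuous f') (hgc : Continuous g) (hgc' : Continuous g')
    (hue : ∀ t, u t = u₀ + integ timeInt f t + integ d g t)
    (hwe : ∀ t, w t = w₀ + integ timeInt f' t + integ d g' t) (s : ℝ≥0) :
    HasDerivWithinAt (fun t : ℝ => inner ℝ (u t.toNNReal) (w t.toNNReal))
      (inner ℝ (u s) (f' s) + inner ℝ (f s) (w s) + inner ℝ (g s) (g' s)) (Set.Ici (s : ℝ)) s := by
  rw [← hasDerivWithinAt_Ioi_iff_Ici, hasDerivWithinAt_iff_tendsto_slope' (by simp)]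
  have hτ := isIntegrator_timeInt hd.mono hd.closed
  set l := 𝓝[>] (s : ℝ) with hl
  -- `a`, `a'` are the time integrals divided by `t - s`, up to their limits
  set a : ℝ → H := fun t => (t - s)⁻¹ •
      (integ timeInt f t.toNNReal - integ timeInt f s - timeInt s t.toNNReal (f s)) with ha
  set a' : ℝ → H := fun t => (t - s)⁻¹ •
      (integ timeInt f' t.toNNReal - integ timeInt f' s - timeInt s t.toNNReal (f' s)) with ha'
  -- `e`, `e'` are the errors of the stochastic integrals, divided by `√(t - s)`
  set e : ℝ → H := fun t => (√(t - s))⁻¹ •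
      (integ d g t.toNNReal - integ d g s - d s t.toNNReal (g s)) with he
  set e' : ℝ → H := fun t => (√(t - s))⁻¹ •
      (integ d g' t.toNNReal - integ d g' s - d s t.toNNReal (g' s)) with he'
  set b : ℝ → H := fun t => (√(t - s))⁻¹ • d s t.toNNReal (g s) with hb
  set b' : ℝ → H := fun t => (√(t - s))⁻¹ • d s t.toNNReal (g' s) with hb'
  have ta : Tendsto a l (𝓝 0) :=
    hτ.tendsto_slope hf hfc s id fun h hh => ⟨hh, by simp [sq]⟩
  have ta' : Tendsto a' l (𝓝 0) :=
    hτ.tendsto_slope hf' hfc' s id fun h hh => ⟨hh, by simp [sq]⟩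
  have te : Tendsto e l (𝓝 0) := hd.isIntegrator.tendsto_slope hg hgc s Real.sqrt
    fun h hh => ⟨Real.sqrt_pos.2 hh, by simp [Real.sq_sqrt hh.le]⟩
  have te' : Tendsto e' l (𝓝 0) := hd.isIntegrator.tendsto_slope hg' hgc' s Real.sqrt
    fun h hh => ⟨Real.sqrt_pos.2 hh, by simp [Real.sq_sqrt hh.le]⟩
  have tsq : Tendsto (fun t : ℝ => √(t - s)) l (𝓝 0) := by
    have : Continuous fun t : ℝ => √(t - s) := by fun_prop
    simpa using (this.tendsto (s : ℝ)).mono_left nhdsWithin_le_nhds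
  have hpos : ∀ᶠ t in l, (s : ℝ) < t := self_mem_nhdsWithin
  have hle : ∀ {t : ℝ}, (s : ℝ) < t → s ≤ t.toNNReal ∧ ((t.toNNReal : ℝ≥0) : ℝ) = t := by
    intro t ht
    have h0 : 0 ≤ t := s.2.trans ht.le
    exact ⟨by rw [← NNReal.coe_le_coe, Real.coe_toNNReal _ h0]; exact ht.le,
      Real.coe_toNNReal _ h0⟩
  have hbn : ∀ {y : H}, y ∈ S s → ∀ {t : ℝ}, (s : ℝ) < t →
      ‖(√(t - s))⁻¹ • d s t.toNNReal y‖ = ‖y‖ := by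
    intro y hy t ht
    obtain ⟨h1, h2⟩ := hle ht
    have h3 := hd.norm_sq h1 hy
    rw [h2] at h3
    have h4 : 0 < t - s := sub_pos.2 ht
    refine (pow_left_inj₀ (norm_nonneg _) (norm_nonneg _) two_ne_zero).1 ?_
    rw [norm_smul, mul_pow, h3, norm_inv, Real.norm_of_nonneg (Real.sqrt_nonneg _), inv_pow,
      Real.sq_sqrt h4.le, inv_mul_cancel_left₀ h4.ne']
  -- products of a null sequence with a bounded one vanish
  have tb : ∀ {z v : ℝ → H} {C : ℝ}, Tendsto z l (𝓝 0) → (∀ᶠ t in l, ‖v t‖ ≤ C) →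
      Tendsto (fun t => inner ℝ (z t) (v t)) l (𝓝 0) := by
    intro z v C hz hv
    have hz' : Tendsto (fun t => ‖z t‖ * C) l (𝓝 0) := by simpa using hz.norm.mul_const C
    refine squeeze_zero_norm' ?_ hz'
    filter_upwards [hv] with t ht
    exact (norm_inner_le_norm _ _).trans (mul_le_mul_of_nonneg_left ht (norm_nonneg _))
  have bb : ∀ᶠ t in l, ‖b t‖ ≤ ‖g s‖ := hpos.mono fun t ht => (hbn (hg s) ht).le
  have bb' : ∀ᶠ t in l, ‖b' t‖ ≤ ‖g' s‖ := hpos.mono fun t ht => (hbn (hg' s) ht).le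
  have tp : Tendsto (fun t => √(t - s) • (f s + a t)) l (𝓝 0) := by
    simpa using tsq.smul (tendsto_const_nhds.add ta)
  have tp' : Tendsto (fun t => √(t - s) • (f' s + a' t)) l (𝓝 0) := by
    simpa using tsq.smul (tendsto_const_nhds.add ta')
  have tmain : Tendsto (fun t => inner ℝ (u s) (f' s + a' t) + inner ℝ (f s + a t) (w s) +
      inner ℝ (√(t - s) • (f s + a t)) (√(t - s) • (f' s + a' t)) +
      (inner ℝ (√(t - s) • (f s + a t)) (e' t) + inner ℝ (√(t - s) • (f s + a t)) (b' t)) +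
      (inner ℝ (e t) (√(t - s) • (f' s + a' t)) + inner ℝ (√(t - s) • (f' s + a' t)) (b t)) +
      (inner ℝ (e t) (e' t) + inner ℝ (e t) (b' t) + inner ℝ (e' t) (b t) +
        inner ℝ (g s) (g' s))) l
      (𝓝 (inner ℝ (u s) (f' s) + inner ℝ (f s) (w s) + inner ℝ (g s) (g' s))) := by
    have h1 : Tendsto (fun t => inner ℝ (u s) (f' s + a' t)) l (𝓝 (inner ℝ (u s) (f' s))) := by
      simpa using (tendsto_const_nhds (x := u s)).inner ((tendsto_const_nhds (x := f' s)).add ta')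
    have h2 : Tendsto (fun t => inner ℝ (f s + a t) (w s)) l (𝓝 (inner ℝ (f s) (w s))) := by
      simpa using ((tendsto_const_nhds (x := f s)).add ta).inner (tendsto_const_nhds (x := w s))
    have h3 := tp.inner (𝕜 := ℝ) tp'
    have h4 := (tp.inner (𝕜 := ℝ) te').add (tb tp bb')
    have h5 := (te.inner (𝕜 := ℝ) tp').add (tb tp' bb)
    have h6 := ((((te.inner (𝕜 := ℝ) te').add (tb te bb')).add (tb te' bb)).add
      (tendsto_const_nhds (x := inner ℝ (g s) (g' s))))
    simpa using ((((h1.add h2).add h3).add h4).add h5).add h6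
  refine tmain.congr' ?_
  filter_upwards [hpos] with t ht
  obtain ⟨h1, h2⟩ := hle ht
  have hh : 0 < t - s := sub_pos.2 ht
  have hsq : √(t - s) * √(t - s) = t - s := Real.mul_self_sqrt hh.le
  have hs0 : √(t - s) ≠ 0 := (Real.sqrt_pos.2 hh).ne'
  -- the increments in terms of the normalised quantities
  have ep : ∀ y : ℝ≥0 → H, integ timeInt y t.toNNReal - integ timeInt y s =
      (t - s) • (y s + (t - s)⁻¹ • (integ timeInt y t.toNNReal - integ timeInt y s -
        timeInt s t.toNNReal (y s))) := by
    intro y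
    rw [smul_add, smul_inv_smul₀ hh.ne', timeInt, h2]
    abel
  have eq : ∀ y : ℝ≥0 → H, integ d y t.toNNReal - integ d y s = √(t - s) • ((√(t - s))⁻¹ •
      (integ d y t.toNNReal - integ d y s - d s t.toNNReal (y s)) +
        (√(t - s))⁻¹ • d s t.toNNReal (y s)) := by
    intro y
    rw [smul_add, smul_inv_smul₀ hs0, smul_inv_smul₀ hs0]
    abel
  have eu : u t.toNNReal = u s + ((t - s) • (f s + a t) + √(t - s) • (e t + b t)) := by
    rw [ha, he, hb, ← ep, ← eq, hue, hue s]
    abel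
  have ew : w t.toNNReal = w s + ((t - s) • (f' s + a' t) + √(t - s) • (e' t + b' t)) := by
    rw [ha', he', hb', ← ep, ← eq, hwe, hwe s]
    abel
  have o1 : inner ℝ (u s) (e' t + b' t) = 0 := by
    have := hd.orth_integ hg' hgc' h1 (hu s)
    rw [eq, inner_smul_right] at this
    exact (mul_eq_zero.1 this).resolve_left hs0
  have o2 : inner ℝ (e t + b t) (w s) = 0 := by
    have := hd.orth_integ hg hgc h1 (hw s)
    rw [eq, inner_smul_right] at this
    rw [real_inner_comm]
    exact (mul_eq_zero.1 this).resolve_left hs0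
  have o3 : inner ℝ (b t) (b' t) = inner ℝ (g s) (g' s) := by
    simp only [hb, hb', inner_smul_left, inner_smul_right, hd.inner_eq h1 (hg s) (hg' s), h2]
    simp only [conj_trivial]
    field_simp
    rw [sq, hsq]
  have hst' : ((s : ℝ≥0) : ℝ).toNNReal = s := Real.toNNReal_coe
  rw [slope_def_field, hst', eu, ew]
  rw [eq_div_iff hh.ne']
  simp only [inner_add_left, inner_add_right, real_inner_smul_left,
    real_inner_smul_right] at o1 o2 ⊢
  rw [real_inner_comm (b t) (e' t), real_inner_comm (b t) (f' s), real_inner_comm (b t) (a' t)]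
  linear_combination (-√(t - s)) * o1 - √(t - s) * o2 - √(t - s) * √(t - s) * o3 +
    ((t - s) * (inner ℝ (f s) (f' s) + inner ℝ (f s) (a' t) +
      (inner ℝ (a t) (f' s) + inner ℝ (a t) (a' t))) -
    (inner ℝ (e t) (e' t) + inner ℝ (e t) (b' t) + (inner ℝ (b t) (e' t) +
        inner ℝ (g s) (g' s)))) * hsq

end Limits

end ItoRule

/-! ### Linear equations driven by white noise -/

section LinearEquation

variable {H : Type*} [NormedAddCommGroup H] [InnerProductSpace ℝ H] {n : ℕ}
  {S : ℝ≥0 → Submodule ℝ H} {d : ℝ≥0 → ℝ≥0 → H → H}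

/-- The action of a real matrix on vectors with entries in `H`. -/
def matAct (F : Matrix (Fin n) (Fin n) ℝ) (x : Fin n → H) : Fin n → H :=
  fun i => ∑ j, F i j • x j

theorem continuous_matAct (F : Matrix (Fin n) (Fin n) ℝ) {x : ℝ≥0 → Fin n → H}
    (hx : Continuous x) (i : Fin n) : Continuous fun r => matAct F (x r) i := by
  unfold matAct
  exact continuous_finsetSum _ fun j _ => ((continuous_apply j).comp hx).const_smul _

theorem matAct_mem (F : Matrix (Fin n) (Fin n) ℝ) {V : Submodule ℝ H} {x : Fin n → H}
    (hx : ∀ i, x i ∈ V) (i : Fin n) : matAct F x i ∈ V :=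
  Submodule.sum_mem _ fun j _ => V.smul_mem _ (hx j)

theorem matAct_sub (F : Matrix (Fin n) (Fin n) ℝ) (x y : Fin n → H) (i : Fin n) :
    matAct F (x - y) i = matAct F x i - matAct F y i := by
  simp [matAct, smul_sub, Finset.sum_sub_distrib]

theorem norm_matAct_le (F : Matrix (Fin n) (Fin n) ℝ) (x : Fin n → H) (i : Fin n) :
    ‖matAct F x i‖ ≤ (∑ i, ∑ j, |F i j|) * ‖x‖ := by
  refine (norm_sum_le _ _).trans ?_
  calc ∑ j, ‖F i j • x j‖ ≤ ∑ j, |F i j| * ‖x‖ := Finset.sum_le_sum fun j _ => by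
        rw [norm_smul, Real.norm_eq_abs]
        exact mul_le_mul_of_nonneg_left (norm_le_pi_norm x j) (abs_nonneg _)
    _ = (∑ j, |F i j|) * ‖x‖ := by rw [Finset.sum_mul]
    _ ≤ _ := mul_le_mul_of_nonneg_right (Finset.single_le_sum (f := fun i => ∑ j, |F i j|)
        (fun i _ => Finset.sum_nonneg fun j _ => abs_nonneg _) (Finset.mem_univ i)) (norm_nonneg _)

/-- A solution of `dx = F x dt + G x dW`, `x 0 = x₀`, in a filtered Hilbert space with noise. -/
structure IsAbstractSolution (S : ℝ≥0 → Submodule ℝ H) (d : ℝ≥0 → ℝ≥0 → H → H)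
    (F G : Matrix (Fin n) (Fin n) ℝ) (x₀ : Fin n → H) (x : ℝ≥0 → Fin n → H) : Prop where
  mem : ∀ t i, x t i ∈ S t
  cont : Continuous x
  eq : ∀ t i, x t i = x₀ i + integ timeInt (fun r => matAct F (x r) i) t +
    integ d (fun r => matAct G (x r) i) t

/-- The Picard iterates of the equation `dx = F x dt + G x dW`, `x 0 = x₀`. -/
def picardIter (d : ℝ≥0 → ℝ≥0 → H → H) (F G : Matrix (Fin n) (Fin n) ℝ) (x₀ : Fin n → H) :
    ℕ → ℝ≥0 → Fin n → H
  | 0 => fun _ => x₀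
  | J + 1 => fun t i => x₀ i + integ timeInt (fun r => matAct F (picardIter d F G x₀ J r) i) t +
      integ d (fun r => matAct G (picardIter d F G x₀ J r) i) t

variable [CompleteSpace H]

/-- The second moments of two solutions of the same equation satisfy the Lyapunov equation
`M' = F M + M Fᵀ + G M Gᵀ`. -/
theorem IsAbstractSolution.hasDerivWithinAt_moment (hd : IsNoise S d)
    {F G : Matrix (Fin n) (Fin n) ℝ} {x₀ x₀' : Fin n → H} {x x' : ℝ≥0 → Fin n → H}
    (h : IsAbstractSolution S d F G x₀ x) (h' : IsAbstractSolution S d F G x₀' x')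
    (i j : Fin n) (s : ℝ≥0) :
    HasDerivWithinAt (fun t : ℝ => inner ℝ (x t.toNNReal i) (x' t.toNNReal j))
      ((F * Matrix.of (fun a b => inner ℝ (x s a) (x' s b)) +
        Matrix.of (fun a b => inner ℝ (x s a) (x' s b)) * Fᵀ +
        G * Matrix.of (fun a b => inner ℝ (x s a) (x' s b)) * Gᵀ) i j) (Set.Ici (s : ℝ)) s := by
  have key := hd.hasDerivWithinAt_inner (u := fun r => x r i) (w := fun r => x' r j)
    (fun r => h.mem r i) (fun r => h'.mem r j)
    (fun r => matAct_mem F (h.mem r) i) (fun r => matAct_mem F (h'.mem r) j)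
    (fun r => matAct_mem G (h.mem r) i) (fun r => matAct_mem G (h'.mem r) j)
    (continuous_matAct F h.cont i) (continuous_matAct F h'.cont j)
    (continuous_matAct G h.cont i) (continuous_matAct G h'.cont j)
    (fun t => h.eq t i) (fun t => h'.eq t j) s
  convert key using 1
  simp only [Matrix.add_apply, Matrix.mul_apply, Matrix.of_apply, Matrix.transpose_apply, matAct,
    sum_inner, inner_sum, real_inner_smul_left, real_inner_smul_right]
  have e1 : ∑ k, F i k * inner ℝ (x s k) (x' s j) +
      ∑ k, inner ℝ (x s i) (x' s k) * F j k = ∑ k, F j k * inner ℝ (x s i) (x' s k) +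
      ∑ k, F i k * inner ℝ (x s k) (x' s j) := by
    rw [add_comm]
    simp only [mul_comm]
  rw [e1]
  congr 1
  simp only [Finset.sum_mul]
  exact Finset.sum_congr rfl fun k _ => Finset.sum_congr rfl fun l _ => by ring

section Existence

theorem picardIter_mem_cont (hd : IsNoise S d) (F G : Matrix (Fin n) (Fin n) ℝ) {x₀ : Fin n → H}
    (h0 : ∀ i, x₀ i ∈ S 0) (J : ℕ) :
    (∀ t i, picardIter d F G x₀ J t i ∈ S t) ∧ Continuous (picardIter d F G x₀ J) := by
  have hτ := isIntegrator_timeInt hd.mono hd.closed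
  induction J with
  | zero => exact ⟨fun t i => hd.mono zero_le (h0 i), continuous_const⟩
  | succ J ih =>
    refine ⟨fun t i => ?_, continuous_pi fun i => ?_⟩
    · exact Submodule.add_mem _ (Submodule.add_mem _ (hd.mono zero_le (h0 i))
        (hτ.integ_mem (fun r => matAct_mem F (ih.1 r) i) (continuous_matAct F ih.2 i) t))
        (hd.isIntegrator.integ_mem (fun r => matAct_mem G (ih.1 r) i)
          (continuous_matAct G ih.2 i) t)
    · exact (continuous_const.add (hτ.continuous_integ (fun T => ⟨T, fun h _ hT => hT⟩)
        (fun r => matAct_mem F (ih.1 r) i) (continuous_matAct F ih.2 i))).add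
        (hd.isIntegrator.continuous_integ (fun T => ⟨1, fun _ _ _ => le_rfl⟩)
          (fun r => matAct_mem G (ih.1 r) i) (continuous_matAct G ih.2 i))

/-- Integrands of exponential size have integrals of exponential size, with a gain `1 / l`. -/
theorem IsIntegrator.norm_integ_sq_le_exp {κ : ℝ → ℝ} (hd : IsIntegrator S d κ) {y : ℝ≥0 → H}
    {t : ℝ≥0} (hy : ∀ r, y r ∈ S r) (hc : Continuous y) {c l : ℝ} (hc0 : 0 ≤ c) (hl : 0 < l)
    (hb : ∀ r ≤ t, ‖y r‖ ^ 2 ≤ c * Real.exp (l * r)) :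
    ‖integ d y t‖ ^ 2 ≤ κ t * (c / l * Real.exp (l * t)) := by
  refine (hd.norm_integ_sq_le_potential hy hc (fun a => c / l * Real.exp (l * a)) ?_).trans ?_
  · intro a b hab hbt
    have hab' : (0 : ℝ) ≤ b - a := sub_nonneg.2 (by exact_mod_cast hab)
    refine (mul_le_mul_of_nonneg_left (hb a (hab.trans hbt)) hab').trans ?_
    have h1 := Real.add_one_le_exp (l * (b - a))
    have h2 : Real.exp (l * b) = Real.exp (l * a) * Real.exp (l * (b - a)) := by
      rw [← Real.exp_add]; congr 1; ring
    rw [h2, ← mul_sub, show Real.exp (l * a) * Real.exp (l * (b - a)) - Real.exp (l * a) =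
      Real.exp (l * a) * (Real.exp (l * (b - a)) - 1) by ring, div_mul_eq_mul_div,
      le_div_iff₀ hl]
    have h3 := mul_le_mul_of_nonneg_left (show l * (b - a) ≤ Real.exp (l * (b - a)) - 1 by linarith)
      (mul_nonneg hc0 (Real.exp_pos (l * a)).le)
    linarith
  · refine mul_le_mul_of_nonneg_left ?_ (hd.kappa_nonneg _ t.2)
    have : 0 ≤ c / l * Real.exp (l * ((0 : ℝ≥0) : ℝ)) := by positivity
    linarith

/-- The Picard iterates converge geometrically on bounded intervals: in the norm weighted with
`exp (-l t / 2)`, the Picard map is a contraction if `l` is large. -/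
theorem exists_picardIter_bound (hd : IsNoise S d) (F G : Matrix (Fin n) (Fin n) ℝ)
    {x₀ : Fin n → H} (h0 : ∀ i, x₀ i ∈ S 0) (T : ℝ≥0) :
    ∃ C : ℝ, ∀ J, ∀ t ≤ T,
      ‖picardIter d F G x₀ (J + 1) t - picardIter d F G x₀ J t‖ ≤ C * (1 / 2) ^ J := by
  have hτ := isIntegrator_timeInt hd.mono hd.closed
  have hX := picardIter_mem_cont hd F G h0
  set X := picardIter d F G x₀ with hXdef
  set f := ∑ i, ∑ j, |F i j|
  set g := ∑ i, ∑ j, |G i j|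
  obtain ⟨b, hb⟩ := (isCompact_Icc (a := (0 : ℝ≥0)) (b := T)).exists_bound_of_continuousOn
    (f := fun t => X 1 t - X 0 t) ((hX 1).2.sub (hX 0).2).continuousOn
  have hb0 : 0 ≤ b := (norm_nonneg _).trans (hb 0 ⟨le_rfl, zero_le⟩)
  set l := 8 * (T * f ^ 2 + g ^ 2) + 1 with hl
  have hl0 : 0 < l := by positivity
  -- this weight makes the squared contraction factor at most `1 / 4`
  have key : ∀ J, ∀ t ≤ T, ‖X (J + 1) t - X J t‖ ^ 2 ≤
      b ^ 2 * (1 / 4) ^ J * Real.exp (l * t) := by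
    intro J
    induction J with
    | zero =>
      intro t ht
      rw [pow_zero, mul_one, zero_add]
      refine (pow_le_pow_left₀ (norm_nonneg _) (hb t ⟨zero_le, ht⟩) 2).trans
        (le_mul_of_one_le_right (sq_nonneg b) (Real.one_le_exp (by positivity)))
    | succ J ih =>
      intro t ht
      have hrhs : 0 ≤ b ^ 2 * (1 / 4) ^ (J + 1) * Real.exp (l * t) := by positivity
      refine (Real.le_sqrt (norm_nonneg _) hrhs).1 ?_
      rw [pi_norm_le_iff_of_nonneg (Real.sqrt_nonneg _)]
      intro i
      refine Real.le_sqrt_of_sq_le ?_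
      set c := b ^ 2 * (1 / 4) ^ J with hcdef
      have hc0 : 0 ≤ c := by positivity
      have hact : ∀ (A : Matrix (Fin n) (Fin n) ℝ), ∀ r ≤ t,
          ‖matAct A (X (J + 1) r) i - matAct A (X J r) i‖ ^ 2 ≤
            (∑ i, ∑ j, |A i j|) ^ 2 * c * Real.exp (l * r) := by
        intro A r hr
        rw [← matAct_sub]
        refine (pow_le_pow_left₀ (norm_nonneg _) (norm_matAct_le A _ i) 2).trans ?_
        rw [mul_pow, mul_assoc]
        exact mul_le_mul_of_nonneg_left (ih r (hr.trans ht)) (sq_nonneg _)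
      have e : (X (J + 1 + 1) t - X (J + 1) t) i =
          integ timeInt (fun r => matAct F (X (J + 1) r) i - matAct F (X J r) i) t +
          integ d (fun r => matAct G (X (J + 1) r) i - matAct G (X J r) i) t := by
        rw [hτ.integ_sub (fun r => matAct_mem F ((hX _).1 r) i) (continuous_matAct F (hX _).2 i)
          (fun r => matAct_mem F ((hX _).1 r) i) (continuous_matAct F (hX _).2 i),
          hd.isIntegrator.integ_sub (fun r => matAct_mem G ((hX _).1 r) i)
          (continuous_matAct G (hX _).2 i)
          (fun r => matAct_mem G ((hX _).1 r) i) (continuous_matAct G (hX _).2 i)]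
        simp only [hXdef, Pi.sub_apply, picardIter]
        abel
      rw [e]
      have b1 := hτ.norm_integ_sq_le_exp (t := t)
        (y := fun r => matAct F (X (J + 1) r) i - matAct F (X J r) i)
        (fun r => Submodule.sub_mem _ (matAct_mem F ((hX _).1 r) i) (matAct_mem F ((hX _).1 r) i))
        ((continuous_matAct F (hX _).2 i).sub (continuous_matAct F (hX _).2 i))
        (by positivity) hl0 (hact F)
      have b2 := hd.isIntegrator.norm_integ_sq_le_exp (t := t)
        (y := fun r => matAct G (X (J + 1) r) i - matAct G (X J r) i)
        (fun r => Submodule.sub_mem _ (matAct_mem G ((hX _).1 r) i) (matAct_mem G ((hX _).1 r) i))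
        ((continuous_matAct G (hX _).2 i).sub (continuous_matAct G (hX _).2 i))
        (by positivity) hl0 (hact G)
      refine (pow_le_pow_left₀ (norm_nonneg _) (norm_add_le _ _) 2).trans
        ((add_sq_le).trans ?_)
      have ht' : (t : ℝ) ≤ T := by exact_mod_cast ht
      have hE : 0 < Real.exp (l * t) := Real.exp_pos _
      have b3 : id (t : ℝ) * ((f ^ 2 * c) / l * Real.exp (l * t)) ≤
          (T : ℝ) * ((f ^ 2 * c) / l * Real.exp (l * t)) :=
        mul_le_mul_of_nonneg_right ht' (by positivity)
      refine (mul_le_mul_of_nonneg_left (add_le_add (b1.trans b3) b2) zero_le_two).trans ?_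
      have e2 : 2 * ((T : ℝ) * ((f ^ 2 * c) / l * Real.exp (l * t)) +
          1 * ((g ^ 2 * c) / l * Real.exp (l * t))) =
          (2 * (T * f ^ 2 + g ^ 2)) * (c * Real.exp (l * t)) / l := by ring
      rw [e2, div_le_iff₀ hl0]
      have e3 : b ^ 2 * (1 / 4) ^ (J + 1) * Real.exp (l * t) * l =
          (l / 4) * (c * Real.exp (l * t)) := by rw [hcdef]; ring
      rw [e3]
      refine mul_le_mul_of_nonneg_right ?_ (by positivity)
      rw [hl]; linarith
  refine ⟨√(b ^ 2 * Real.exp (l * T)), fun J t ht => ?_⟩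
  refine (pow_le_pow_iff_left₀ (norm_nonneg _) (by positivity) two_ne_zero).1 ?_
  refine (key J t ht).trans ?_
  rw [mul_pow, Real.sq_sqrt (by positivity), ← pow_mul, mul_comm J 2, pow_mul]
  have : Real.exp (l * t) ≤ Real.exp (l * T) :=
    Real.exp_le_exp.2 (mul_le_mul_of_nonneg_left (by exact_mod_cast ht) hl0.le)
  calc b ^ 2 * (1 / 4) ^ J * Real.exp (l * t) ≤ b ^ 2 * (1 / 4) ^ J * Real.exp (l * T) :=
        mul_le_mul_of_nonneg_left this (by positivity)
    _ = _ := by norm_num; ring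

theorem exists_isAbstractSolution (hd : IsNoise S d) (F G : Matrix (Fin n) (Fin n) ℝ)
    {x₀ : Fin n → H} (h0 : ∀ i, x₀ i ∈ S 0) : ∃ x, IsAbstractSolution S d F G x₀ x := by
  have hτ := isIntegrator_timeInt hd.mono hd.closed
  have hX := picardIter_mem_cont hd F G h0
  have hbound := exists_picardIter_bound hd F G h0
  set X := picardIter d F G x₀ with hXdef
  choose C hC using hbound
  have hcau : ∀ t, CauchySeq fun J => X J t := fun t =>
    cauchySeq_of_le_geometric (1 / 2) (C t) (by norm_num) fun J => by
      rw [dist_comm, dist_eq_norm]; exact hC t J t le_rfl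
  choose x hx using fun t => cauchySeq_tendsto_of_complete (hcau t)
  have hunif : ∀ T, TendstoUniformlyOn X x atTop (Set.Icc 0 T) := by
    intro T
    rw [Metric.tendstoUniformlyOn_iff]
    intro ε hε
    have hlim : Tendsto (fun J : ℕ => C T * (1 / 2) ^ J / (1 - 1 / 2)) atTop (𝓝 0) := by
      have := ((tendsto_pow_atTop_nhds_zero_of_lt_one (r := (1 / 2 : ℝ)) (by norm_num)
        (by norm_num)).const_mul (C T)).div_const (1 - 1 / 2)
      simpa using this
    filter_upwards [hlim.eventually (gt_mem_nhds hε)] with J hJ t ht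
    rw [dist_comm]
    refine lt_of_le_of_lt (dist_le_of_le_geometric_of_tendsto (1 / 2) (C T) (by norm_num)
      (fun J => ?_) (hx t) J) hJ
    rw [dist_comm, dist_eq_norm]; exact hC T J t ht.2
  have hmem : ∀ t i, x t i ∈ S t := fun t i =>
    (hd.closed t).mem_of_tendsto ((tendsto_pi_nhds.1 (hx t)) i)
      (Eventually.of_forall fun J => (hX J).1 t i)
  have hcont : Continuous x := by
    rw [continuous_iff_continuousAt]
    intro t
    have := (hunif (t + 1)).continuousOn (Frequently.of_forall fun J => (hX J).2.continuousOn)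
    exact this.continuousAt (mem_of_superset (Iic_mem_nhds (lt_add_of_pos_right t one_pos))
      fun r hr => ⟨zero_le, hr⟩)
  refine ⟨x, hmem, hcont, fun t i => ?_⟩
  have hact : ∀ A : Matrix (Fin n) (Fin n) ℝ,
      TendstoUniformlyOn (fun J r => matAct A (X J r) i) (fun r => matAct A (x r) i) atTop
        (Set.Icc 0 t) := by
    intro A
    refine UniformContinuous.comp_tendstoUniformlyOn (g := fun z : Fin n → H => matAct A z i)
      ?_ (hunif t)
    have hL : LipschitzWith (Real.toNNReal (∑ i, ∑ j, |A i j|))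
        (fun z : Fin n → H => matAct A z i) := by
      refine LipschitzWith.of_dist_le_mul fun z w => ?_
      rw [dist_eq_norm, dist_eq_norm, ← matAct_sub]
      exact (norm_matAct_le A _ i).trans
        (mul_le_mul_of_nonneg_right (Real.le_coe_toNNReal _) (norm_nonneg _))
    exact hL.uniformContinuous
  have l1 := hτ.tendsto_integ_of_uniform (fun J r => matAct_mem F ((hX J).1 r) i)
    (fun J => continuous_matAct F (hX J).2 i) (fun r => matAct_mem F (hmem r) i)
    (continuous_matAct F hcont i) (hact F)
  have l2 := hd.isIntegrator.tendsto_integ_of_uniform (fun J r => matAct_mem G ((hX J).1 r) i)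
    (fun J => continuous_matAct G (hX J).2 i) (fun r => matAct_mem G (hmem r) i)
    (continuous_matAct G hcont i) (hact G)
  have l3 : Tendsto (fun J => X (J + 1) t i) atTop (𝓝 (x t i)) :=
    ((tendsto_pi_nhds.1 (hx t)) i).comp (tendsto_add_atTop_nat 1)
  exact tendsto_nhds_unique l3 ((tendsto_const_nhds.add l1).add l2)

end Existence

end LinearEquation

/-! ### Brownian motion as a white noise on `L²` -/

section BrownianNoise

variable {Ω : Type*} {mΩ : MeasurableSpace Ω} {P : Measure Ω} {𝓕 : Filtration ℝ≥0 mΩ}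
  {W : ℝ≥0 → Ω → ℝ}

/-- The square-integrable random variables that are measurable with respect to (the completion
of) `𝓕 t`. -/
def pastSpace (P : Measure Ω) (𝓕 : Filtration ℝ≥0 mΩ) (t : ℝ≥0) : Submodule ℝ (Lp ℝ 2 P) :=
  lpMeas ℝ ℝ (𝓕 t) 2 P

theorem mem_pastSpace {t : ℝ≥0} {y : Lp ℝ 2 P} :
    y ∈ pastSpace P 𝓕 t ↔ AEStronglyMeasurable[𝓕 t] y P :=
  mem_lpMeas_iff_aestronglyMeasurable

open scoped Classical in
/-- The product of the increment `W t - W s` with `y`; it is set to zero where the product is not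
square-integrable, which does not happen for `y` in the past of `s`. -/
def mulIncr (P : Measure Ω) (W : ℝ≥0 → Ω → ℝ) (s t : ℝ≥0) (y : Lp ℝ 2 P) : Lp ℝ 2 P :=
  if h : MemLp (fun ω => (W t ω - W s ω) * y ω) 2 P then h.toLp else 0

namespace IsBrownianMotion

theorem hasLaw_increment (hW : IsBrownianMotion P 𝓕 W) {s t : ℝ≥0} (hst : s ≤ t) :
    HasLaw (fun ω => W t ω - W s ω) (gaussianReal 0 (t - s)) P := by
  have h := hW.isBrownian.hasLaw_sub t s
  have e : nndist t.1 s.1 = t - s := by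
    rw [← NNReal.coe_inj, coe_nndist, Real.dist_eq, NNReal.coe_sub hst]
    exact abs_of_nonneg (sub_nonneg.2 (by exact_mod_cast hst))
  rw [e] at h
  exact h

theorem integral_increment (hW : IsBrownianMotion P 𝓕 W) {s t : ℝ≥0} (hst : s ≤ t) :
    ∫ ω, (W t ω - W s ω) ∂P = 0 := by
  rw [(hW.hasLaw_increment hst).integral_eq, integral_id_gaussianReal]

theorem memLp_increment (hW : IsBrownianMotion P 𝓕 W) {s t : ℝ≥0} (hst : s ≤ t) :
    MemLp (fun ω => W t ω - W s ω) 2 P :=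
  (hW.hasLaw_increment hst).hasGaussianLaw.memLp_two

theorem integral_increment_sq (hW : IsBrownianMotion P 𝓕 W) {s t : ℝ≥0} (hst : s ≤ t) :
    ∫ ω, (W t ω - W s ω) ^ 2 ∂P = t - s := by
  have h := (hW.hasLaw_increment hst).variance_eq
  rw [variance_of_integral_eq_zero (hW.hasLaw_increment hst).aemeasurable
    (hW.integral_increment hst), variance_id_gaussianReal, NNReal.coe_sub hst] at h
  exact h

theorem indepFun_increment (hW : IsBrownianMotion P 𝓕 W) {s t : ℝ≥0} (hst : s ≤ t) {y : Ω → ℝ}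
    (hy : AEStronglyMeasurable[𝓕 s] y P) : IndepFun (fun ω => W t ω - W s ω) y P := by
  obtain ⟨z, hz, hyz⟩ := hy
  have h : IndepFun (fun ω => W t ω - W s ω) z P := by
    rw [IndepFun_iff_Indep]
    exact indep_of_indep_of_le_right (hW.indep_increment s t hst) hz.measurable.comap_le
  exact h.congr EventuallyEq.rfl hyz.symm

theorem integrable_mul_sq (hW : IsBrownianMotion P 𝓕 W) {s t : ℝ≥0} (hst : s ≤ t)
    {y : Lp ℝ 2 P} (hy : y ∈ pastSpace P 𝓕 s) :
    Integrable (fun ω => ((W t ω - W s ω) * y ω) ^ 2) P ∧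
      ∫ ω, ((W t ω - W s ω) * y ω) ^ 2 ∂P = (t - s) * ∫ ω, y ω ^ 2 ∂P := by
  have hi := (hW.indepFun_increment hst (mem_pastSpace.1 hy)).comp
    (φ := fun x : ℝ => x ^ 2) (ψ := fun x : ℝ => x ^ 2) (by fun_prop) (by fun_prop)
  have h1 : Integrable ((fun x : ℝ => x ^ 2) ∘ fun ω => W t ω - W s ω) P :=
    (hW.memLp_increment hst).integrable_sq
  have h2 : Integrable ((fun x : ℝ => x ^ 2) ∘ y) P := (Lp.memLp y).integrable_sq
  have e : (fun ω => ((W t ω - W s ω) * y ω) ^ 2) =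
      ((fun x : ℝ => x ^ 2) ∘ fun ω => W t ω - W s ω) * ((fun x : ℝ => x ^ 2) ∘ y) := by
    funext ω
    simp [mul_pow]
  rw [e]
  refine ⟨hi.integrable_mul h1 h2, ?_⟩
  rw [hi.integral_mul_eq_mul_integral h1.1 h2.1]
  congr 1
  exact hW.integral_increment_sq hst

theorem memLp_mul (hW : IsBrownianMotion P 𝓕 W) {s t : ℝ≥0} (hst : s ≤ t)
    {y : Lp ℝ 2 P} (hy : y ∈ pastSpace P 𝓕 s) :
    MemLp (fun ω => (W t ω - W s ω) * y ω) 2 P :=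
  (memLp_two_iff_integrable_sq ((hW.memLp_increment hst).1.mul (Lp.memLp y).1)).2
    (hW.integrable_mul_sq hst hy).1

theorem coeFn_mulIncr (hW : IsBrownianMotion P 𝓕 W) {s t : ℝ≥0} (hst : s ≤ t)
    {y : Lp ℝ 2 P} (hy : y ∈ pastSpace P 𝓕 s) :
    mulIncr P W s t y =ᵐ[P] fun ω => (W t ω - W s ω) * y ω := by
  rw [mulIncr, dif_pos (hW.memLp_mul hst hy)]
  exact MemLp.coeFn_toLp _

theorem pastSpace_mono : Monotone (pastSpace P 𝓕) := fun _ _ h _ hy =>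
  mem_pastSpace.2 ((mem_pastSpace.1 hy).mono (𝓕.mono h))

/-- Multiplication with Brownian increments is a white noise on the filtered Hilbert space
`L²`. -/
theorem isNoise (hW : IsBrownianMotion P 𝓕 W) : IsNoise (pastSpace P 𝓕) (mulIncr P W) where
  mono := pastSpace_mono
  closed t := isClosed_aestronglyMeasurable (𝓕.le t)
  mem {s t y} hst hy := by
    rw [mem_pastSpace]
    refine AEStronglyMeasurable.congr ?_ (hW.coeFn_mulIncr hst hy).symm
    have h1 : AEStronglyMeasurable[𝓕 t] (fun ω => W t ω - W s ω) P :=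
      ((hW.adapted t).sub ((hW.adapted s).mono (𝓕.mono hst))).aestronglyMeasurable
    exact h1.mul ((mem_pastSpace.1 hy).mono (𝓕.mono hst))
  self s y := by
    have h : MemLp (fun ω => (W s ω - W s ω) * y ω) 2 P := by simp
    rw [mulIncr, dif_pos h]
    refine Lp.ext ?_
    filter_upwards [MemLp.coeFn_toLp h, Lp.coeFn_zero ℝ 2 P] with ω h1 h2
    rw [h1, h2, sub_self, zero_mul, Pi.zero_apply]
  add {s t y z} hst hy hz := by
    refine Lp.ext ?_
    filter_upwards [hW.coeFn_mulIncr hst hy, hW.coeFn_mulIncr hst hz, Lp.coeFn_add y z,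
      hW.coeFn_mulIncr hst (Submodule.add_mem _ hy hz),
      Lp.coeFn_add (mulIncr P W s t y) (mulIncr P W s t z)] with ω h1 h2 h3 h4 h5
    rw [h4, h5, h3, Pi.add_apply, Pi.add_apply, h1, h2, mul_add]
  smul {s t y} a hst hy := by
    refine Lp.ext ?_
    filter_upwards [hW.coeFn_mulIncr hst hy, Lp.coeFn_smul a y,
      hW.coeFn_mulIncr hst (Submodule.smul_mem _ a hy),
      Lp.coeFn_smul a (mulIncr P W s t y)] with ω h1 h2 h3 h4
    rw [h3, h4, h2, Pi.smul_apply, Pi.smul_apply, h1, smul_eq_mul, smul_eq_mul]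
    ring
  chasles {s t u y} hst htu hy := by
    refine Lp.ext ?_
    filter_upwards [hW.coeFn_mulIncr hst hy, hW.coeFn_mulIncr htu (pastSpace_mono hst hy),
      hW.coeFn_mulIncr (hst.trans htu) hy,
      Lp.coeFn_add (mulIncr P W s t y) (mulIncr P W t u y)] with ω h1 h2 h3 h4
    rw [h3, h4, Pi.add_apply, h1, h2]
    ring
  orth {s t y z} hst hy hz := by
    rw [L2.inner_def]
    have h1 : AEStronglyMeasurable[𝓕 s] (fun ω => z ω * y ω) P :=
      (mem_pastSpace.1 hz).mul (mem_pastSpace.1 hy)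
    have h2 := (hW.indepFun_increment hst h1).integral_mul_eq_mul_integral
      (hW.memLp_increment hst).1 (h1.mono (𝓕.le s))
    rw [hW.integral_increment hst, zero_mul] at h2
    rw [← h2]
    refine integral_congr_ae ?_
    filter_upwards [hW.coeFn_mulIncr hst hy] with ω h
    rw [h]
    simp only [Pi.mul_apply, RCLike.inner_apply, conj_trivial]
    ring
  norm_sq {s t y} hst hy := by
    rw [← real_inner_self_eq_norm_sq, ← real_inner_self_eq_norm_sq, L2.inner_def, L2.inner_def]
    have h := (hW.integrable_mul_sq hst hy).2
    simp only [RCLike.inner_apply, conj_trivial, ← sq]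
    rw [← h]
    refine integral_congr_ae ?_
    filter_upwards [hW.coeFn_mulIncr hst hy] with ω h
    rw [h]

end IsBrownianMotion

end BrownianNoise

/-! ### Solutions of the Itô equation and their second moments -/

section ItoEquation

variable {Ω : Type*} {mΩ : MeasurableSpace Ω} {P : Measure Ω} {𝓕 : Filtration ℝ≥0 mΩ}
  {W : ℝ≥0 → Ω → ℝ} {n : ℕ}

theorem eLpNorm_apply_le (f : Ω → Fin n → ℝ) (i : Fin n) :
    eLpNorm (fun ω => f ω i) 2 P ≤ eLpNorm f 2 P :=
  eLpNorm_mono fun ω => norm_le_pi_norm (f ω) i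

theorem eLpNorm_le_sum {f : Ω → Fin n → ℝ} (hf : ∀ i, AEStronglyMeasurable (fun ω => f ω i) P) :
    eLpNorm f 2 P ≤ ∑ i, eLpNorm (fun ω => f ω i) 2 P := by
  have h1 : eLpNorm f 2 P ≤ eLpNorm (∑ i, fun ω => ‖f ω i‖) 2 P := by
    refine eLpNorm_mono fun ω => ?_
    rw [Finset.sum_apply, Real.norm_of_nonneg (Finset.sum_nonneg fun i _ => norm_nonneg _),
      pi_norm_le_iff_of_nonneg (Finset.sum_nonneg fun i _ => norm_nonneg _)]
    exact fun i => Finset.single_le_sum (f := fun i => ‖f ω i‖) (fun _ _ => norm_nonneg _)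
      (Finset.mem_univ i)
  refine h1.trans ((eLpNorm_sum_le (fun i _ => (hf i).norm) one_le_two).trans_eq ?_)
  exact Finset.sum_congr rfl fun i _ => eLpNorm_norm _

/-- Mean-square convergence of random vectors is convergence in `L²` of the coordinates. -/
theorem tendsto_eLpNorm_iff {ι : Type*} {l : Filter ι} {f : ι → Ω → Fin n → ℝ}
    {g : Ω → Fin n → ℝ} {u : ι → Fin n → Lp ℝ 2 P} {v : Fin n → Lp ℝ 2 P}
    (hu : ∀ k i, (fun ω => f k ω i) =ᵐ[P] u k i) (hv : ∀ i, (fun ω => g ω i) =ᵐ[P] v i) :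
    Tendsto (fun k => eLpNorm (fun ω => f k ω - g ω) 2 P) l (𝓝 0) ↔
      ∀ i, Tendsto (fun k => u k i) l (𝓝 (v i)) := by
  have hcomp : ∀ k i, eLpNorm (fun ω => (f k ω - g ω) i) 2 P =
      eLpNorm (⇑(u k i) - ⇑(v i)) 2 P := by
    intro k i
    refine eLpNorm_congr_ae ?_
    filter_upwards [hu k i, hv i] with ω h1 h2
    simp only [Pi.sub_apply, ← h1, ← h2]
  have hmeas : ∀ k i, AEStronglyMeasurable (fun ω => (f k ω - g ω) i) P := fun k i =>
    ((Lp.memLp (u k i)).1.sub (Lp.memLp (v i)).1).congr (by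
      filter_upwards [hu k i, hv i] with ω h1 h2
      simp only [Pi.sub_apply, ← h1, ← h2])
  simp only [Lp.tendsto_Lp_iff_tendsto_eLpNorm', ← hcomp]
  refine ⟨fun h i => ?_, fun h => ?_⟩
  · exact tendsto_of_tendsto_of_tendsto_of_le_of_le tendsto_const_nhds h (fun _ => zero_le)
      fun k => eLpNorm_apply_le _ i
  · have h' : Tendsto (fun k => ∑ i, eLpNorm (fun ω => (f k ω - g ω) i) 2 P) l (𝓝 0) := by
      simpa using tendsto_finsetSum Finset.univ fun i _ => h i
    exact tendsto_of_tendsto_of_tendsto_of_le_of_le tendsto_const_nhds h' (fun _ => zero_le)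
      fun k => eLpNorm_le_sum (hmeas k)

theorem coeFn_matAct (F : Matrix (Fin n) (Fin n) ℝ) {X : Ω → Fin n → ℝ} {x : Fin n → Lp ℝ 2 P}
    (h : ∀ i, (fun ω => X ω i) =ᵐ[P] x i) (i : Fin n) :
    (fun ω => (F *ᵥ X ω) i) =ᵐ[P] (matAct F x i : Lp ℝ 2 P) := by
  have h1 : ∀ᵐ ω ∂P, ∀ j, X ω j = x j ω := ae_all_iff.2 h
  have h2 : ∀ᵐ ω ∂P, ∀ j, (F i j • x j : Lp ℝ 2 P) ω = F i j * x j ω :=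
    ae_all_iff.2 fun j => Lp.coeFn_smul (F i j) (x j)
  filter_upwards [h1, h2, Lp.coeFn_fun_finsetSum Finset.univ fun j => F i j • x j] with ω a1 a2 a3
  rw [matAct, a3, Matrix.mulVec, dotProduct]
  exact Finset.sum_congr rfl fun j _ => by rw [a2, a1]

theorem clampTo_zero_left (t x : ℝ≥0) : clampTo 0 t x = min x t := by simp [clampTo]

theorem leftSum_time_ae {Y : ℝ≥0 → Ω → Fin n → ℝ} {y : ℝ≥0 → Fin n → Lp ℝ 2 P}
    (h : ∀ r i, (fun ω => Y r ω i) =ᵐ[P] y r i) (t : ℝ≥0) (k : ℕ) (i : Fin n) :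
    (fun ω => leftSum Y (fun s _ => (s : ℝ)) t k ω i) =ᵐ[P]
      (riem timeInt 0 t k (fun r => y r i) : Lp ℝ 2 P) := by
  have h1 : ∀ᵐ ω ∂P, ∀ j : ℕ, Y ((j : ℝ≥0) / 2 ^ k) ω i = y ((j : ℝ≥0) / 2 ^ k) i ω :=
    ae_all_iff.2 fun j => h _ i
  have h2 : ∀ᵐ ω ∂P, ∀ j : ℕ, (timeInt (clampTo 0 t ((j : ℝ≥0) / 2 ^ k))
      (clampTo 0 t (((j + 1 : ℕ) : ℝ≥0) / 2 ^ k)) (y ((j : ℝ≥0) / 2 ^ k) i) : Lp ℝ 2 P) ω =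
      ((clampTo 0 t (((j + 1 : ℕ) : ℝ≥0) / 2 ^ k) : ℝ) - clampTo 0 t ((j : ℝ≥0) / 2 ^ k)) *
        y ((j : ℝ≥0) / 2 ^ k) i ω := ae_all_iff.2 fun j => Lp.coeFn_smul _ _
  filter_upwards [h1, h2, Lp.coeFn_fun_finsetSum (Finset.range ⌈t * 2 ^ k⌉₊) fun j : ℕ =>
    (timeInt (clampTo 0 t ((j : ℝ≥0) / 2 ^ k))
      (clampTo 0 t (((j + 1 : ℕ) : ℝ≥0) / 2 ^ k)) (y ((j : ℝ≥0) / 2 ^ k) i) : Lp ℝ 2 P)]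
    with ω a1 a2 a3
  rw [riem, a3, leftSum, Finset.sum_apply]
  refine Finset.sum_congr rfl fun j _ => ?_
  rw [a2, clampTo_zero_left, clampTo_zero_left, Pi.smul_apply, a1, smul_eq_mul]

theorem leftSum_noise_ae (hW : IsBrownianMotion P 𝓕 W) {Y : ℝ≥0 → Ω → Fin n → ℝ}
    {y : ℝ≥0 → Fin n → Lp ℝ 2 P} (h : ∀ r i, (fun ω => Y r ω i) =ᵐ[P] y r i)
    (hy : ∀ r i, y r i ∈ pastSpace P 𝓕 r) (t : ℝ≥0) (k : ℕ) (i : Fin n) :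
    (fun ω => leftSum Y W t k ω i) =ᵐ[P]
      (riem (mulIncr P W) 0 t k (fun r => y r i) : Lp ℝ 2 P) := by
  have h1 : ∀ᵐ ω ∂P, ∀ j : ℕ, Y ((j : ℝ≥0) / 2 ^ k) ω i = y ((j : ℝ≥0) / 2 ^ k) i ω :=
    ae_all_iff.2 fun j => h _ i
  have h2 : ∀ᵐ ω ∂P, ∀ j ∈ Finset.range ⌈t * 2 ^ k⌉₊,
      (mulIncr P W (clampTo 0 t ((j : ℝ≥0) / 2 ^ k))
        (clampTo 0 t (((j + 1 : ℕ) : ℝ≥0) / 2 ^ k)) (y ((j : ℝ≥0) / 2 ^ k) i)) ω =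
      (W (clampTo 0 t (((j + 1 : ℕ) : ℝ≥0) / 2 ^ k)) ω - W (clampTo 0 t ((j : ℝ≥0) / 2 ^ k)) ω) *
        y ((j : ℝ≥0) / 2 ^ k) i ω := by
    rw [Finset.eventually_all]
    exact fun j hj => hW.coeFn_mulIncr (clampTo_mono 0 t (dyadic_mono k j.le_succ))
      (mem_clamp (S := pastSpace P 𝓕) (y := fun r => y r i) (fun r _ => by simpa using hy r i)
        (Finset.mem_range.1 hj))
  filter_upwards [h1, h2, Lp.coeFn_fun_finsetSum (Finset.range ⌈t * 2 ^ k⌉₊) fun j : ℕ =>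
    mulIncr P W (clampTo 0 t ((j : ℝ≥0) / 2 ^ k))
      (clampTo 0 t (((j + 1 : ℕ) : ℝ≥0) / 2 ^ k)) (y ((j : ℝ≥0) / 2 ^ k) i)] with ω a1 a2 a3
  rw [riem, a3, leftSum, Finset.sum_apply]
  refine Finset.sum_congr rfl fun j hj => ?_
  rw [a2 j hj, clampTo_zero_left, clampTo_zero_left, Pi.smul_apply, a1, smul_eq_mul]

/-- The coordinates of a solution of the Itô equation solve the abstract equation in `L²`. -/
theorem IsSolution.isAbstractSolution (hW : IsBrownianMotion P 𝓕 W)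
    {F G : Matrix (Fin n) (Fin n) ℝ} {ξ : Ω → Fin n → ℝ} {X : ℝ≥0 → Ω → Fin n → ℝ}
    (hX : IsSolution P 𝓕 W F G ξ X) {x₀ : Fin n → Lp ℝ 2 P} {x : ℝ≥0 → Fin n → Lp ℝ 2 P}
    (hx₀ : ∀ i, (fun ω => ξ ω i) =ᵐ[P] x₀ i) (hx : ∀ t i, (fun ω => X t ω i) =ᵐ[P] x t i) :
    IsAbstractSolution (pastSpace P 𝓕) (mulIncr P W) F G x₀ x := by
  have hmem : ∀ t i, x t i ∈ pastSpace P 𝓕 t := fun t i => mem_pastSpace.2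
    (((continuous_apply i).comp_aestronglyMeasurable (hX.adapted t)).congr (hx t i))
  have hcont : Continuous x := by
    rw [continuous_iff_continuousAt]
    intro t
    exact tendsto_pi_nhds.2 ((tendsto_eLpNorm_iff (f := X) (u := x) hx (hx t)).1 (hX.continuous t))
  refine ⟨hmem, hcont, fun t i => ?_⟩
  have hd := hW.isNoise
  have hτ := isIntegrator_timeInt hd.mono hd.closed
  obtain ⟨I₁, I₂, ⟨m₁, l₁⟩, ⟨m₂, l₂⟩, he⟩ := hX.integral_eq t
  have c₁ := fun i => ((memLp_pi_iff.1 m₁) i).coeFn_toLp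
  have c₂ := fun i => ((memLp_pi_iff.1 m₂) i).coeFn_toLp
  have t₁ := (tendsto_eLpNorm_iff (fun k i => leftSum_time_ae
    (fun r i => coeFn_matAct F (hx r) i) t k i) (fun i => (c₁ i).symm)).1 l₁ i
  have t₂ := (tendsto_eLpNorm_iff (fun k i => leftSum_noise_ae hW
    (fun r i => coeFn_matAct G (hx r) i) (fun r i => matAct_mem G (hmem r) i) t k i)
    (fun i => (c₂ i).symm)).1 l₂ i
  have e₁ := tendsto_nhds_unique (hτ.tendsto_integ (fun r => matAct_mem F (hmem r) i)
    (continuous_matAct F hcont i) t) t₁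
  have e₂ := tendsto_nhds_unique (hd.isIntegrator.tendsto_integ (fun r => matAct_mem G (hmem r) i)
    (continuous_matAct G hcont i) t) t₂
  rw [e₁, e₂]
  refine Lp.ext ?_
  filter_upwards [hx t i, hx₀ i, c₁ i, c₂ i, he,
    Lp.coeFn_add (x₀ i + (memLp_pi_iff.1 m₁ i).toLp) (memLp_pi_iff.1 m₂ i).toLp,
    Lp.coeFn_add (x₀ i) (memLp_pi_iff.1 m₁ i).toLp] with ω a1 a2 a3 a4 a5 a6 a7
  rw [a6, Pi.add_apply, a7, Pi.add_apply, a3, a4, ← a1, ← a2, a5]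
  rfl

/-- A solution of the abstract equation in `L²` yields a solution of the Itô equation. -/
theorem IsAbstractSolution.isSolution (hW : IsBrownianMotion P 𝓕 W)
    {F G : Matrix (Fin n) (Fin n) ℝ} {ξ : Ω → Fin n → ℝ}
    {x₀ : Fin n → Lp ℝ 2 P} {x : ℝ≥0 → Fin n → Lp ℝ 2 P}
    (h : IsAbstractSolution (pastSpace P 𝓕) (mulIncr P W) F G x₀ x)
    (hx₀ : ∀ i, (fun ω => ξ ω i) =ᵐ[P] x₀ i) :
    IsSolution P 𝓕 W F G ξ (fun t ω i => x t i ω) := by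
  have hd := hW.isNoise
  have hτ := isIntegrator_timeInt hd.mono hd.closed
  refine ⟨fun t => ?_, fun t => memLp_pi_iff.2 fun i => Lp.memLp _, fun t => ?_, fun t => ?_⟩
  · choose z hz hxz using fun i => mem_pastSpace.1 (h.mem t i)
    refine ⟨fun ω i => z i ω, (@measurable_pi_iff _ _ _ (𝓕 t) _ _ |>.2
      fun i => (hz i).measurable).stronglyMeasurable, ?_⟩
    filter_upwards [ae_all_iff.2 hxz] with ω hω
    exact funext hω
  · refine (tendsto_eLpNorm_iff (u := x) (fun _ _ => EventuallyEq.rfl)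
      fun _ => EventuallyEq.rfl).2 fun i => ?_
    exact ((continuous_apply i).comp h.cont).tendsto t
  · refine ⟨fun ω i => integ timeInt (fun r => matAct F (x r) i) t ω,
      fun ω i => integ (mulIncr P W) (fun r => matAct G (x r) i) t ω,
      ⟨memLp_pi_iff.2 fun i => Lp.memLp _, ?_⟩, ⟨memLp_pi_iff.2 fun i => Lp.memLp _, ?_⟩, ?_⟩
    · refine (tendsto_eLpNorm_iff (fun k i => leftSum_time_ae
        (fun r i => coeFn_matAct F (fun _ => EventuallyEq.rfl) i) t k i)
        (v := fun i => integ timeInt (fun r => matAct F (x r) i) t)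
        (fun i => EventuallyEq.rfl)).2 fun i => ?_
      exact hτ.tendsto_integ (fun r => matAct_mem F (h.mem r) i) (continuous_matAct F h.cont i) t
    · refine (tendsto_eLpNorm_iff (fun k i => leftSum_noise_ae hW
        (fun r i => coeFn_matAct G (fun _ => EventuallyEq.rfl) i)
        (fun r i => matAct_mem G (h.mem r) i) t k i)
        (v := fun i => integ (mulIncr P W) (fun r => matAct G (x r) i) t)
        (fun i => EventuallyEq.rfl)).2 fun i => ?_
      exact hd.isIntegrator.tendsto_integ (fun r => matAct_mem G (h.mem r) i)
        (continuous_matAct G h.cont i) t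
    · have hall : ∀ᵐ ω ∂P, ∀ i, x t i ω = ξ ω i +
          integ timeInt (fun r => matAct F (x r) i) t ω +
          integ (mulIncr P W) (fun r => matAct G (x r) i) t ω := by
        refine ae_all_iff.2 fun i => ?_
        have := h.eq t i
        filter_upwards [hx₀ i, Lp.coeFn_add (x₀ i + integ timeInt (fun r => matAct F (x r) i) t)
          (integ (mulIncr P W) (fun r => matAct G (x r) i) t),
          Lp.coeFn_add (x₀ i) (integ timeInt (fun r => matAct F (x r) i) t)] with ω a1 a2 a3
        rw [this, a2, Pi.add_apply, a3, Pi.add_apply, a1]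
      filter_upwards [hall] with ω hω
      exact funext hω

theorem exists_isSolution (hW : IsBrownianMotion P 𝓕 W) (F G : Matrix (Fin n) (Fin n) ℝ)
    {ξ : Ω → Fin n → ℝ} (hξ : IsInitialState P 𝓕 ξ) : ∃ X, IsSolution P 𝓕 W F G ξ X := by
  have c := fun i => ((memLp_pi_iff.1 hξ.2) i).coeFn_toLp
  obtain ⟨x, hx⟩ := exists_isAbstractSolution hW.isNoise F G
    (x₀ := fun i => ((memLp_pi_iff.1 hξ.2) i).toLp) fun i => mem_pastSpace.2
      (((continuous_apply i).comp_aestronglyMeasurable hξ.1).congr (c i).symm)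
  exact ⟨_, hx.isSolution hW fun i => (c i).symm⟩

/-- The matrix of mixed second moments of two processes. -/
def moment (P : Measure Ω) (X X' : ℝ≥0 → Ω → Fin n → ℝ) (t : ℝ) : Matrix (Fin n) (Fin n) ℝ :=
  Matrix.of fun i j => ∫ ω, X t.toNNReal ω i * X' t.toNNReal ω j ∂P

/-- The mixed second moments of two solutions are continuous, start at those of the initial states
and solve the Lyapunov differential equation. -/
theorem moment_deriv (hW : IsBrownianMotion P 𝓕 W) {F G : Matrix (Fin n) (Fin n) ℝ}
    {ξ ξ' : Ω → Fin n → ℝ} (hξ : IsInitialState P 𝓕 ξ) (hξ' : IsInitialState P 𝓕 ξ')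
    {X X' : ℝ≥0 → Ω → Fin n → ℝ} (hX : IsSolution P 𝓕 W F G ξ X)
    (hX' : IsSolution P 𝓕 W F G ξ' X') :
    moment P X X' 0 = Matrix.of (fun i j => ∫ ω, ξ ω i * ξ' ω j ∂P) ∧
    (∀ i j, Continuous fun t => moment P X X' t i j) ∧
    ∀ i j, ∀ s : ℝ, 0 ≤ s → HasDerivWithinAt (fun t => moment P X X' t i j)
      ((F * moment P X X' s + moment P X X' s * Fᵀ + G * moment P X X' s * Gᵀ) i j)
      (Set.Ici s) s := by
  have key : ∀ {ζ : Ω → Fin n → ℝ} {Z : ℝ≥0 → Ω → Fin n → ℝ}, IsInitialState P 𝓕 ζ →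
      IsSolution P 𝓕 W F G ζ Z → ∃ z₀ z, IsAbstractSolution (pastSpace P 𝓕) (mulIncr P W) F G z₀ z ∧
        (∀ i, (fun ω => ζ ω i) =ᵐ[P] z₀ i) ∧ ∀ t i, (fun ω => Z t ω i) =ᵐ[P] z t i := by
    intro ζ Z hζ hZ
    have c₀ := fun i => ((memLp_pi_iff.1 hζ.2) i).coeFn_toLp
    have c := fun t i => ((memLp_pi_iff.1 (hZ.memLp t)) i).coeFn_toLp
    exact ⟨_, _, hZ.isAbstractSolution hW (fun i => (c₀ i).symm) (fun t i => (c t i).symm),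
      fun i => (c₀ i).symm, fun t i => (c t i).symm⟩
  obtain ⟨x₀, x, hx, hx₀, hxX⟩ := key hξ hX
  obtain ⟨x₀', x', hx', hx₀', hxX'⟩ := key hξ' hX'
  have e : ∀ t i j, moment P X X' t i j = inner ℝ (x t.toNNReal i) (x' t.toNNReal j) := by
    intro t i j
    rw [L2.inner_def]
    refine integral_congr_ae ?_
    filter_upwards [hxX t.toNNReal i, hxX' t.toNNReal j] with ω h1 h2
    simp only [RCLike.inner_apply, conj_trivial]
    rw [← h1, ← h2, mul_comm]
  have z1 : ∀ i, x 0 i = x₀ i := fun i => by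
    rw [hx.eq, IsIntegrator.integ_zero, IsIntegrator.integ_zero]
    simp
  have z2 : ∀ i, x' 0 i = x₀' i := fun i => by
    rw [hx'.eq, IsIntegrator.integ_zero, IsIntegrator.integ_zero]
    simp
  refine ⟨?_, fun i j => ?_, fun i j s hs => ?_⟩
  · ext i j
    rw [e, Real.toNNReal_zero, z1, z2, L2.inner_def]
    refine integral_congr_ae ?_
    filter_upwards [hx₀ i, hx₀' j] with ω h1 h2
    simp only [RCLike.inner_apply, conj_trivial]
    rw [← h1, ← h2, mul_comm]
  · simp only [e]
    exact ((continuous_apply i).comp (hx.cont.comp continuous_real_toNNReal)).inner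
      ((continuous_apply j).comp (hx'.cont.comp continuous_real_toNNReal))
  · simp only [e]
    have h := hx.hasDerivWithinAt_moment hW.isNoise hx' i j ⟨s, hs⟩
    have es : s.toNNReal = ⟨s, hs⟩ := Real.toNNReal_of_nonneg hs
    have em : moment P X X' s = Matrix.of (fun a b => inner ℝ (x ⟨s, hs⟩ a) (x' ⟨s, hs⟩ b)) := by
      ext a b
      rw [e, es, Matrix.of_apply]
    rw [em]
    exact h

end ItoEquation

/-! ### The Lyapunov operator and its semigroup -/

theorem exists_transpose_mul_self {n : ℕ} {M : Matrix (Fin n) (Fin n) ℝ} (hM : M.PosSemidef) :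
    ∃ B : Matrix (Fin n) (Fin n) ℝ, M = Bᵀ * B := by
  open scoped MatrixOrder in
  obtain ⟨B, hB⟩ := CStarAlgebra.nonneg_iff_eq_star_mul_self.1 hM.nonneg
  exact ⟨B, by rw [hB, Matrix.star_eq_conjTranspose, Matrix.conjTranspose_eq_transpose_of_trivial]⟩

section Lyapunov

-- Operators on matrices are used as elements of a normed algebra. For this, the topology of the
-- space of matrices has to be the one that instance search derives from its norm; the entrywise
-- topology is the same only after unfolding definitions.
attribute [local instance] Matrix.normedAddCommGroup Matrix.normedSpace
attribute [-instance] instTopologicalSpaceMatrix Matrix.instUniformSpace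

variable {n : ℕ}

theorem posSemidef_iff_real {M : Matrix (Fin n) (Fin n) ℝ} :
    M.PosSemidef ↔ Mᵀ = M ∧ ∀ v, 0 ≤ v ⬝ᵥ (M *ᵥ v) := by
  rw [Matrix.posSemidef_iff_dotProduct_mulVec]
  simp [Matrix.IsHermitian, Matrix.conjTranspose_eq_transpose_of_trivial]

theorem posDef_iff_real {M : Matrix (Fin n) (Fin n) ℝ} :
    M.PosDef ↔ Mᵀ = M ∧ ∀ v ≠ 0, 0 < v ⬝ᵥ (M *ᵥ v) := by
  rw [Matrix.posDef_iff_dotProduct_mulVec]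
  simp [Matrix.IsHermitian, Matrix.conjTranspose_eq_transpose_of_trivial]

theorem transpose_mul_self_eq_sum {k l : ℕ} (B : Matrix (Fin k) (Fin l) ℝ) :
    Bᵀ * B = ∑ i, Matrix.vecMulVec (B i) (B i) := by
  ext a b
  simp [Matrix.mul_apply, Matrix.sum_apply, Matrix.vecMulVec_apply]

theorem posSemidef_vecMulVec (v : Fin n → ℝ) : (Matrix.vecMulVec v v).PosSemidef := by
  simpa using Matrix.posSemidef_vecMulVec_self_star v

/-- The cone of positive semidefinite matrices is self-dual for the trace pairing. -/
theorem trace_mul_nonneg {M N : Matrix (Fin n) (Fin n) ℝ} (hM : M.PosSemidef)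
    (hN : N.PosSemidef) : 0 ≤ (M * N).trace := by
  obtain ⟨B, rfl⟩ := exists_transpose_mul_self hN
  rw [← Matrix.mul_assoc, Matrix.trace_mul_comm, ← Matrix.mul_assoc]
  have := (hM.mul_mul_conjTranspose_same B).trace_nonneg
  rwa [Matrix.conjTranspose_eq_transpose_of_trivial] at this

/-- The Lyapunov operator `M ↦ F M + M Fᵀ + G M Gᵀ`, the generator of the second moments of
`dX = F X dt + G X dW`. -/
def lyap (F G : Matrix (Fin n) (Fin n) ℝ) :
    Matrix (Fin n) (Fin n) ℝ →L[ℝ] Matrix (Fin n) (Fin n) ℝ :=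
  LinearMap.toContinuousLinearMap
    { toFun := fun M => F * M + M * Fᵀ + G * M * Gᵀ
      map_add' := fun M N => by simp only [Matrix.mul_add, Matrix.add_mul]; abel
      map_smul' := fun a M => by
        simp only [Matrix.mul_smul, Matrix.smul_mul, smul_add, RingHom.id_apply] }

theorem lyap_apply (F G M : Matrix (Fin n) (Fin n) ℝ) :
    lyap F G M = F * M + M * Fᵀ + G * M * Gᵀ := rfl

theorem lyap_transpose (F G M : Matrix (Fin n) (Fin n) ℝ) :
    lyap F G Mᵀ = (lyap F G M)ᵀ := by
  simp only [lyap_apply, Matrix.transpose_add, Matrix.transpose_mul, Matrix.transpose_transpose,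
    Matrix.mul_assoc]
  abel

/-- The semigroup generated by the Lyapunov operator. -/
def lyapFlow (F G : Matrix (Fin n) (Fin n) ℝ) (t : ℝ) :
    Matrix (Fin n) (Fin n) ℝ →L[ℝ] Matrix (Fin n) (Fin n) ℝ :=
  NormedSpace.exp (t • lyap F G)

theorem lyapFlow_zero (F G : Matrix (Fin n) (Fin n) ℝ) : lyapFlow F G 0 = 1 := by
  let _ : NormedAlgebra ℚ (Matrix (Fin n) (Fin n) ℝ →L[ℝ] Matrix (Fin n) (Fin n) ℝ) :=
    .restrictScalars ℚ ℝ _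
  rw [lyapFlow, zero_smul, NormedSpace.exp_zero]

theorem lyapFlow_add (F G : Matrix (Fin n) (Fin n) ℝ) (s t : ℝ) :
    lyapFlow F G (s + t) = lyapFlow F G s * lyapFlow F G t := by
  let _ : NormedAlgebra ℚ (Matrix (Fin n) (Fin n) ℝ →L[ℝ] Matrix (Fin n) (Fin n) ℝ) :=
    .restrictScalars ℚ ℝ _
  rw [lyapFlow, add_smul]
  exact NormedSpace.exp_add_of_commute
    (((Commute.refl (lyap F G)).smul_left s).smul_right t)

theorem continuous_lyapFlow (F G : Matrix (Fin n) (Fin n) ℝ) : Continuous (lyapFlow F G) :=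
  let _ : NormedAlgebra ℚ (Matrix (Fin n) (Fin n) ℝ →L[ℝ] Matrix (Fin n) (Fin n) ℝ) :=
    .restrictScalars ℚ ℝ _
  NormedSpace.exp_continuous.comp (continuous_id.smul continuous_const)

theorem hasDerivAt_lyapFlow (F G M : Matrix (Fin n) (Fin n) ℝ) (t : ℝ) :
    HasDerivAt (fun t => lyapFlow F G t M) (lyap F G (lyapFlow F G t M)) t := by
  have h := (hasDerivAt_exp_smul_const' (𝕂 := ℝ) (lyap F G) t).clm_apply (hasDerivAt_const t M)
  simpa [lyapFlow] using h

theorem hasDerivAt_lyapFlow' (F G M : Matrix (Fin n) (Fin n) ℝ) (t : ℝ) :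
    HasDerivAt (fun t => lyapFlow F G t M) (lyapFlow F G t (lyap F G M)) t := by
  have h := (hasDerivAt_exp_smul_const (𝕂 := ℝ) (lyap F G) t).clm_apply (hasDerivAt_const t M)
  simpa [lyapFlow] using h

theorem hasDerivAt_linear_lyapFlow (φ : Matrix (Fin n) (Fin n) ℝ →ₗ[ℝ] ℝ)
    (F G M : Matrix (Fin n) (Fin n) ℝ) (t : ℝ) :
    HasDerivAt (fun t => φ (lyapFlow F G t M)) (φ (lyapFlow F G t (lyap F G M))) t :=
  (LinearMap.toContinuousLinearMap φ).hasFDerivAt.comp_hasDerivAt t (hasDerivAt_lyapFlow' F G M t)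

/-- The quadratic form at `v`, as a linear functional of the matrix. -/
def quadLin (v : Fin n → ℝ) : Matrix (Fin n) (Fin n) ℝ →ₗ[ℝ] ℝ where
  toFun M := v ⬝ᵥ (M *ᵥ v)
  map_add' M N := by rw [Matrix.add_mulVec, dotProduct_add]
  map_smul' a M := by rw [Matrix.smul_mulVec, dotProduct_smul]; rfl

theorem quadLin_apply (v : Fin n → ℝ) (M : Matrix (Fin n) (Fin n) ℝ) :
    quadLin v M = v ⬝ᵥ (M *ᵥ v) := rfl

/-- The functional `M ↦ tr (Q M)`. -/
def traceLin (Q : Matrix (Fin n) (Fin n) ℝ) : Matrix (Fin n) (Fin n) ℝ →ₗ[ℝ] ℝ where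
  toFun M := (Q * M).trace
  map_add' M N := by rw [Matrix.mul_add, Matrix.trace_add]
  map_smul' a M := by rw [Matrix.mul_smul, Matrix.trace_smul]; rfl

theorem traceLin_apply (Q M : Matrix (Fin n) (Fin n) ℝ) : traceLin Q M = (Q * M).trace := rfl

theorem tendsto_linear (φ : Matrix (Fin n) (Fin n) ℝ →ₗ[ℝ] ℝ) {ι : Type*} {l : Filter ι}
    {f : ι → Matrix (Fin n) (Fin n) ℝ} {M : Matrix (Fin n) (Fin n) ℝ} (h : Tendsto f l (𝓝 M)) :
    Tendsto (fun t => φ (f t)) l (𝓝 (φ M)) :=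
  ((LinearMap.toContinuousLinearMap φ).continuous.tendsto M).comp h

/-- Stability of the second-moment semigroup: it tends to zero in the operator norm. -/
def LyapStable (F G : Matrix (Fin n) (Fin n) ℝ) : Prop :=
  Tendsto (fun t => lyapFlow F G t) atTop (𝓝 0)

theorem LyapStable.tendsto_apply {F G : Matrix (Fin n) (Fin n) ℝ} (h : LyapStable F G)
    (M : Matrix (Fin n) (Fin n) ℝ) : Tendsto (fun t => lyapFlow F G t M) atTop (𝓝 0) := by
  have h' : Tendsto (fun t => lyapFlow F G t) atTop (𝓝 0) := h
  exact (((ContinuousLinearMap.apply ℝ _ M).continuous.tendsto 0).comp h')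

theorem opNorm_le_sum_single
    (T : Matrix (Fin n) (Fin n) ℝ →L[ℝ] Matrix (Fin n) (Fin n) ℝ) :
    ‖T‖ ≤ ∑ i, ∑ j, ‖T (Matrix.single i j 1)‖ := by
  refine T.opNorm_le_bound (Finset.sum_nonneg fun i _ => Finset.sum_nonneg fun j _ =>
    norm_nonneg _) fun M => ?_
  have e : T M = ∑ i, ∑ j, M i j • T (Matrix.single i j 1) := by
    conv_lhs => rw [Matrix.matrix_eq_sum_single M]
    simp only [map_sum]
    refine Finset.sum_congr rfl fun i _ => Finset.sum_congr rfl fun j _ => ?_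
    rw [← map_smul, Matrix.smul_single, smul_eq_mul, mul_one]
  rw [e, Finset.sum_mul]
  refine (norm_sum_le _ _).trans (Finset.sum_le_sum fun i _ => ?_)
  rw [Finset.sum_mul]
  refine (norm_sum_le _ _).trans (Finset.sum_le_sum fun j _ => ?_)
  rw [norm_smul, mul_comm]
  exact mul_le_mul_of_nonneg_left (Matrix.norm_entry_le_entrywise_sup_norm M) (norm_nonneg _)

theorem lyapStable_of_single {F G : Matrix (Fin n) (Fin n) ℝ}
    (h : ∀ i j, Tendsto (fun t => lyapFlow F G t (Matrix.single i j 1)) atTop (𝓝 0)) :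
    LyapStable F G := by
  rw [LyapStable, tendsto_zero_iff_norm_tendsto_zero]
  have h' : Tendsto (fun t => ∑ i, ∑ j, ‖lyapFlow F G t (Matrix.single i j 1)‖) atTop (𝓝 0) := by
    simpa using tendsto_finsetSum Finset.univ fun i _ =>
      tendsto_finsetSum Finset.univ fun j _ => (h i j).norm
  exact squeeze_zero (fun _ => norm_nonneg _) (fun t => opNorm_le_sum_single _) h'

/-- Stability is equivalent to contractivity at some positive time. -/
theorem lyapStable_iff {F G : Matrix (Fin n) (Fin n) ℝ} :
    LyapStable F G ↔ ∃ t > 0, ‖lyapFlow F G t‖ < 1 := by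
  constructor
  · intro h
    have h1 : Tendsto (fun t => ‖lyapFlow F G t‖) atTop (𝓝 0) := by simpa using h.norm
    obtain ⟨t, ht, ht0⟩ :=
      ((h1.eventually (gt_mem_nhds one_pos)).and (eventually_gt_atTop 0)).exists
    exact ⟨t, ht0, ht⟩
  · rintro ⟨t₀, h0, h1⟩
    obtain ⟨b, hb⟩ := (isCompact_Icc (a := (0 : ℝ)) (b := t₀)).exists_bound_of_continuousOn
      (continuous_lyapFlow F G).continuousOn
    have hpow : ∀ k : ℕ, lyapFlow F G (k * t₀) = lyapFlow F G t₀ ^ k := by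
      intro k
      induction k with
      | zero => simp [lyapFlow_zero]
      | succ k ih => rw [pow_succ, ← ih, ← lyapFlow_add]; congr 1; push_cast; ring
    have hfl : Tendsto (fun t : ℝ => ⌊t / t₀⌋₊) atTop atTop :=
      tendsto_nat_floor_atTop.comp (tendsto_id.atTop_div_const h0)
    have hlim : Tendsto (fun t : ℝ => ‖lyapFlow F G t₀‖ ^ ⌊t / t₀⌋₊ * b) atTop (𝓝 0) := by
      simpa using ((tendsto_pow_atTop_nhds_zero_of_lt_one (norm_nonneg _) h1).comp hfl).mul_const b
    rw [LyapStable, tendsto_zero_iff_norm_tendsto_zero]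
    refine squeeze_zero' (Eventually.of_forall fun _ => norm_nonneg _) ?_ hlim
    filter_upwards [eventually_ge_atTop 0] with t ht
    have e : t = ⌊t / t₀⌋₊ * t₀ + (t - ⌊t / t₀⌋₊ * t₀) := by ring
    conv_lhs => rw [e, lyapFlow_add, hpow]
    have hb0 := hb (t - ⌊t / t₀⌋₊ * t₀) ⟨by
        have := (le_div_iff₀ h0).1 (Nat.floor_le (div_nonneg ht h0.le)); linarith, by
        have := (div_lt_iff₀ h0).1 (Nat.lt_floor_add_one (t / t₀)); linarith⟩
    refine (norm_mul_le _ _).trans (mul_le_mul ?_ hb0 (norm_nonneg _) (by positivity))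
    rcases Nat.eq_zero_or_pos ⌊t / t₀⌋₊ with hz | hz
    · rw [hz, pow_zero, pow_zero]
      exact ContinuousLinearMap.norm_id_le
    · exact norm_pow_le' _ hz

/-- An element of the kernel would be a fixed point of the semigroup. -/
theorem LyapStable.injective {F G : Matrix (Fin n) (Fin n) ℝ} (h : LyapStable F G) :
    Function.Injective (lyap F G) := by
  rw [injective_iff_map_eq_zero]
  intro M hM
  have hc : ∀ t, lyapFlow F G t M = M := by
    have hd : ∀ t, HasDerivAt (fun t => lyapFlow F G t M) 0 t := fun t => by
      simpa [hM] using hasDerivAt_lyapFlow' F G M t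
    intro t
    have := is_const_of_deriv_eq_zero (fun t => (hd t).differentiableAt) (fun t => (hd t).deriv) t 0
    simpa [lyapFlow_zero] using this
  have := h.tendsto_apply M
  simp only [hc] at this
  exact tendsto_nhds_unique tendsto_const_nhds this

theorem LyapStable.isUnit {F G : Matrix (Fin n) (Fin n) ℝ} (h : LyapStable F G) :
    IsUnit (lyap F G) := by
  have hinj := h.injective
  have hsurj : Function.Surjective (lyap F G) :=
    LinearMap.surjective_of_injective (f := (lyap F G).toLinearMap) hinj
  exact ContinuousLinearMap.isUnit_iff_bijective.2 ⟨hinj, hsurj⟩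

/-- The solution `S` of the Lyapunov equation `F S + S Fᵀ + G S Gᵀ + M = 0`, in the stable
case; where the Lyapunov operator is not invertible, `Ring.inverse` makes it zero. -/
def lyapSol (F G M : Matrix (Fin n) (Fin n) ℝ) : Matrix (Fin n) (Fin n) ℝ :=
  -(Ring.inverse (lyap F G) M)

theorem LyapStable.lyap_lyapSol {F G : Matrix (Fin n) (Fin n) ℝ} (h : LyapStable F G)
    (M : Matrix (Fin n) (Fin n) ℝ) : lyap F G (lyapSol F G M) = -M := by
  have := Ring.mul_inverse_cancel _ h.isUnit
  have h2 := congrArg (fun T => T M) this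
  rw [lyapSol, map_neg]
  exact congrArg Neg.neg h2

theorem LyapStable.eq_lyapSol {F G M S : Matrix (Fin n) (Fin n) ℝ} (h : LyapStable F G)
    (hS : lyap F G S = -M) : S = lyapSol F G M :=
  h.injective (hS.trans (h.lyap_lyapSol M).symm)

theorem LyapStable.lyapSol_lyap {F G : Matrix (Fin n) (Fin n) ℝ} (h : LyapStable F G)
    (M : Matrix (Fin n) (Fin n) ℝ) : lyapSol F G (lyap F G M) = -M :=
  (h.eq_lyapSol (map_neg _ _)).symm

theorem LyapStable.lyapSol_transpose {F G : Matrix (Fin n) (Fin n) ℝ} (h : LyapStable F G)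
    (M : Matrix (Fin n) (Fin n) ℝ) : lyapSol F G Mᵀ = (lyapSol F G M)ᵀ := by
  refine (h.eq_lyapSol ?_).symm
  rw [lyap_transpose, h.lyap_lyapSol, Matrix.transpose_neg]

/-- Positivity of all second-moment semigroups in dimension `n`; see `flowPositive`. -/
def FlowPositive (n : ℕ) : Prop :=
  ∀ (F G M : Matrix (Fin n) (Fin n) ℝ) (t : ℝ), 0 ≤ t → M.PosSemidef → (lyapFlow F G t M).PosSemidef

/-- The solution is `∫₀^∞ Φ t M dt`, hence positive. The integral is avoided by monotonicity of
`t ↦ Φ t S`. -/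
theorem LyapStable.lyapSol_posSemidef (hpos : FlowPositive n) {F G : Matrix (Fin n) (Fin n) ℝ}
    (h : LyapStable F G) {M : Matrix (Fin n) (Fin n) ℝ} (hM : M.PosSemidef) :
    (lyapSol F G M).PosSemidef := by
  refine posSemidef_iff_real.2 ⟨?_, fun v => ?_⟩
  · rw [← h.lyapSol_transpose, (posSemidef_iff_real.1 hM).1]
  · -- the quadratic form of `Φ t S` decreases from its value at `S` to zero
    have hd := hasDerivAt_linear_lyapFlow (quadLin v) F G (lyapSol F G M)
    have hanti : AntitoneOn (fun t => quadLin v (lyapFlow F G t (lyapSol F G M))) (Set.Ici 0) := by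
      refine antitoneOn_of_deriv_nonpos (convex_Ici 0)
        (fun t _ => (hd t).continuousAt.continuousWithinAt)
        (fun t _ => (hd t).differentiableAt.differentiableWithinAt) fun t ht => ?_
      rw [interior_Ici] at ht
      rw [(hd t).deriv, h.lyap_lyapSol, map_neg, map_neg]
      exact neg_nonpos.2 ((posSemidef_iff_real.1 (hpos F G M t (le_of_lt ht) hM)).2 v)
    have hlim := tendsto_linear (quadLin v) (h.tendsto_apply (lyapSol F G M))
    rw [map_zero] at hlim
    have h0 : quadLin v (lyapFlow F G 0 (lyapSol F G M)) = v ⬝ᵥ (lyapSol F G M *ᵥ v) := by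
      rw [lyapFlow_zero]; rfl
    rw [← h0]
    refine le_of_tendsto hlim ?_
    filter_upwards [eventually_ge_atTop 0] with t ht
    exact hanti Set.self_mem_Ici ht ht

/-- Polarization. -/
theorem apply_eq_quadLin {M : Matrix (Fin n) (Fin n) ℝ} (hM : Mᵀ = M) (i j : Fin n) :
    M i j = (quadLin (Pi.single i 1 + Pi.single j 1) M - quadLin (Pi.single i 1) M -
      quadLin (Pi.single j 1) M) / 2 := by
  have hs : M j i = M i j := congrFun (congrFun hM i) j
  simp only [quadLin_apply, Matrix.mulVec_add, add_dotProduct, dotProduct_add,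
    Matrix.mulVec_single_one, single_one_dotProduct, Matrix.col_apply, hs]
  ring

theorem tendsto_zero_of_quadLin {f : ℝ → Matrix (Fin n) (Fin n) ℝ}
    (hf : ∀ᶠ t in atTop, (f t)ᵀ = f t)
    (h : ∀ v, Tendsto (fun t => quadLin v (f t)) atTop (𝓝 0)) : Tendsto f atTop (𝓝 0) := by
  refine tendsto_pi_nhds.2 fun i => tendsto_pi_nhds.2 fun j => ?_
  have : Tendsto (fun t => (quadLin (Pi.single i 1 + Pi.single j 1) (f t) -
      quadLin (Pi.single i 1) (f t) - quadLin (Pi.single j 1) (f t)) / 2) atTop (𝓝 0) := by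
    simpa using (((h (Pi.single i 1 + Pi.single j 1)).sub (h (Pi.single i 1))).sub
      (h (Pi.single j 1))).div_const 2
  refine this.congr' ?_
  filter_upwards [hf] with t ht
  exact (apply_eq_quadLin ht i j).symm

/-- A positive semidefinite solution of a Lyapunov equation with positive definite right-hand side
is positive definite. -/
theorem posDef_of_lyap_eq {F G S M : Matrix (Fin n) (Fin n) ℝ} (hS : S.PosSemidef)
    (hM : M.PosDef) (h : lyap F G S = -M) : S.PosDef := by
  obtain ⟨hsym, hnn⟩ := posSemidef_iff_real.1 hS
  refine posDef_iff_real.2 ⟨hsym, fun v hv => lt_of_le_of_ne (hnn v) fun h0 => ?_⟩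
  have hz : S *ᵥ v = 0 := by
    have := (hS.dotProduct_mulVec_zero_iff v).1 (by simpa using h0.symm)
    exact this
  -- if `v` is in the kernel of `S`, only the noise term of the equation survives
  have hz' : v ᵥ* S = 0 := by rw [← Matrix.mulVec_transpose, hsym, hz]
  have h1 : quadLin v (lyap F G S) = (Gᵀ *ᵥ v) ⬝ᵥ (S *ᵥ (Gᵀ *ᵥ v)) := by
    rw [lyap_apply, map_add, map_add, quadLin_apply, quadLin_apply, quadLin_apply,
      ← Matrix.mulVec_mulVec, hz, ← Matrix.mulVec_mulVec, Matrix.dotProduct_mulVec v S, hz',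
      ← Matrix.mulVec_mulVec, ← Matrix.mulVec_mulVec, Matrix.dotProduct_mulVec v G,
      ← Matrix.mulVec_transpose]
    simp
  have h2 := hnn (Gᵀ *ᵥ v)
  rw [← h1, h, map_neg, quadLin_apply] at h2
  linarith [(posDef_iff_real.1 hM).2 v hv]

theorem exists_smul_sub_posSemidef {S M : Matrix (Fin n) (Fin n) ℝ} (hS : S.PosSemidef)
    (hM : M.PosDef) : ∃ a : ℝ, 0 < a ∧ (a • M - S).PosSemidef := by
  obtain ⟨hMs, hMp⟩ := posDef_iff_real.1 hM
  obtain ⟨hSs, hSp⟩ := posSemidef_iff_real.1 hS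
  have hcS : Continuous fun v : Fin n → ℝ => v ⬝ᵥ (S *ᵥ v) := by fun_prop
  have hcM : Continuous fun v : Fin n → ℝ => v ⬝ᵥ (M *ᵥ v) := by fun_prop
  have hne : ∀ v ∈ Metric.sphere (0 : Fin n → ℝ) 1, v ⬝ᵥ (M *ᵥ v) ≠ 0 := fun v hv =>
    (hMp v (ne_zero_of_mem_unit_sphere ⟨v, hv⟩)).ne'
  obtain ⟨b, hb⟩ := (isCompact_sphere (0 : Fin n → ℝ) 1).exists_bound_of_continuousOn
    (f := fun v => (v ⬝ᵥ (S *ᵥ v)) / (v ⬝ᵥ (M *ᵥ v))) (hcS.continuousOn.div hcM.continuousOn hne)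
  refine ⟨|b| + 1, by positivity, posSemidef_iff_real.2 ⟨?_, fun v => ?_⟩⟩
  · rw [Matrix.transpose_sub, Matrix.transpose_smul, hMs, hSs]
  · rcases eq_or_ne v 0 with rfl | hv
    · simp
    · have hv0 : 0 < ‖v‖ := norm_pos_iff.2 hv
      have hu : ‖v‖⁻¹ • v ∈ Metric.sphere (0 : Fin n → ℝ) 1 := by
        rw [mem_sphere_zero_iff_norm, norm_smul, norm_inv, norm_norm, inv_mul_cancel₀ hv0.ne']
      have h1 := (le_abs_self _).trans (hb _ hu)
      have hMv := hMp v hv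
      simp only [Matrix.mulVec_smul, dotProduct_smul, smul_dotProduct, smul_eq_mul] at h1
      rw [mul_div_mul_left _ _ (inv_ne_zero hv0.ne'), mul_div_mul_left _ _ (inv_ne_zero hv0.ne'),
        div_le_iff₀ hMv] at h1
      rw [Matrix.sub_mulVec, Matrix.smul_mulVec, dotProduct_sub, dotProduct_smul, smul_eq_mul]
      nlinarith [le_abs_self b]

/-- Lyapunov's criterion: if the Lyapunov equation with positive definite right-hand side has a
positive semidefinite solution, then all second moments decay. -/
theorem tendsto_lyapFlow_of_lyap_eq (hpos : FlowPositive n) {F G S M : Matrix (Fin n) (Fin n) ℝ}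
    (hS : S.PosSemidef) (hM : M.PosDef) (h : lyap F G S = -M)
    {N : Matrix (Fin n) (Fin n) ℝ} (hN : N.PosSemidef) :
    Tendsto (fun t => lyapFlow F G t N) atTop (𝓝 0) := by
  obtain ⟨a, ha, haS⟩ := exists_smul_sub_posSemidef hS hM
  obtain ⟨b, hb, hbN⟩ := exists_smul_sub_posSemidef hN (posDef_of_lyap_eq hS hM h)
  refine tendsto_zero_of_quadLin ?_ fun v => ?_
  · filter_upwards [eventually_ge_atTop 0] with t ht
    exact (posSemidef_iff_real.1 (hpos F G N t ht hN)).1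
  -- `exp (t / a) vᵀ (Φ t S) v` is non-increasing, since `S ≤ a M`
  have hd : ∀ t, HasDerivAt (fun t => Real.exp (t / a) * quadLin v (lyapFlow F G t S))
      (Real.exp (t / a) * (1 / a) * quadLin v (lyapFlow F G t S) +
        Real.exp (t / a) * quadLin v (lyapFlow F G t (lyap F G S))) t := fun t =>
    ((hasDerivAt_id t).div_const a).exp.mul (hasDerivAt_linear_lyapFlow (quadLin v) F G S t)
  have hanti : AntitoneOn (fun t => Real.exp (t / a) * quadLin v (lyapFlow F G t S))
      (Set.Ici 0) := by
    refine antitoneOn_of_deriv_nonpos (convex_Ici 0)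
      (fun t _ => (hd t).continuousAt.continuousWithinAt)
      (fun t _ => (hd t).differentiableAt.differentiableWithinAt) fun t ht => ?_
    rw [interior_Ici] at ht
    rw [(hd t).deriv, h, map_neg, map_neg]
    have h1 := (posSemidef_iff_real.1 (hpos F G _ t (le_of_lt ht) haS)).2 v
    rw [← quadLin_apply, map_sub, map_smul, map_sub, map_smul, smul_eq_mul] at h1
    have h2 : (1 / a) * quadLin v (lyapFlow F G t S) ≤ quadLin v (lyapFlow F G t M) := by
      rw [one_div, inv_mul_le_iff₀ ha]; linarith
    have := mul_le_mul_of_nonneg_left h2 (Real.exp_pos (t / a)).le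
    linarith
  have hS0 : ∀ t, 0 ≤ t → quadLin v (lyapFlow F G t S) ≤
      quadLin v S * Real.exp (-(t / a)) := by
    intro t ht
    have h1 := hanti Set.self_mem_Ici ht ht
    simp only [zero_div, Real.exp_zero, one_mul, lyapFlow_zero] at h1
    rw [Real.exp_neg, ← div_eq_mul_inv, le_div_iff₀ (Real.exp_pos _), mul_comm]
    exact h1
  have hexp : Tendsto (fun t : ℝ => b * (quadLin v S * Real.exp (-(t / a)))) atTop (𝓝 0) := by
    have h1 : Tendsto (fun t : ℝ => Real.exp (-(t / a))) atTop (𝓝 0) :=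
      Real.tendsto_exp_neg_atTop_nhds_zero.comp (tendsto_id.atTop_div_const ha)
    simpa using (h1.const_mul (quadLin v S)).const_mul b
  refine squeeze_zero' ?_ ?_ hexp
  · filter_upwards [eventually_ge_atTop 0] with t ht
    exact (posSemidef_iff_real.1 (hpos F G N t ht hN)).2 v
  · filter_upwards [eventually_ge_atTop 0] with t ht
    have h1 := (posSemidef_iff_real.1 (hpos F G _ t ht hbN)).2 v
    rw [← quadLin_apply, map_sub, map_smul, map_sub, map_smul, smul_eq_mul] at h1
    have h2 := mul_le_mul_of_nonneg_left (hS0 t ht) hb.le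
    linarith

end Lyapunov

section MomentFlow

attribute [local instance] Matrix.normedAddCommGroup Matrix.normedSpace
attribute [-instance] instTopologicalSpaceMatrix Matrix.instUniformSpace

variable {Ω : Type*} {mΩ : MeasurableSpace Ω} {P : Measure Ω} {𝓕 : Filtration ℝ≥0 mΩ}
  {W : ℝ≥0 → Ω → ℝ} {n : ℕ}

/-- The semigroup transports the mixed second moments of solutions. -/
theorem moment_eq_lyapFlow (hW : IsBrownianMotion P 𝓕 W) {F G : Matrix (Fin n) (Fin n) ℝ}
    {ξ ξ' : Ω → Fin n → ℝ} (hξ : IsInitialState P 𝓕 ξ) (hξ' : IsInitialState P 𝓕 ξ')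
    {X X' : ℝ≥0 → Ω → Fin n → ℝ} (hX : IsSolution P 𝓕 W F G ξ X)
    (hX' : IsSolution P 𝓕 W F G ξ' X') {t : ℝ} (ht : 0 ≤ t) :
    moment P X X' t = lyapFlow F G t (Matrix.of fun i j => ∫ ω, ξ ω i * ξ' ω j ∂P) := by
  obtain ⟨h0, hc, hd⟩ := moment_deriv hW hξ hξ' hX hX'
  have hc' : Continuous (moment P X X') := continuous_pi fun i => continuous_pi fun j => hc i j
  have hd' : ∀ s ∈ Set.Ico 0 t, HasDerivWithinAt (moment P X X')
      (lyap F G (moment P X X' s)) (Set.Ici s) s := fun s hs =>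
    hasDerivWithinAt_pi.2 fun i => hasDerivWithinAt_pi.2 fun j => hd i j s hs.1
  have hu := ODE_solution_unique_of_mem_Icc_right (v := fun _ => lyap F G) (s := fun _ => Set.univ)
    (K := ‖lyap F G‖₊) (a := 0) (b := t)
    (fun _ _ => (lyap F G).lipschitz.lipschitzOnWith) hc'.continuousOn hd'
    (fun _ _ => Set.mem_univ _)
    (g := fun s => lyapFlow F G s (moment P X X' 0))
    (fun s _ => (hasDerivAt_lyapFlow F G _ s).continuousAt.continuousWithinAt)
    (fun s _ => (hasDerivAt_lyapFlow F G _ s).hasDerivWithinAt) (fun _ _ => Set.mem_univ _)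
    (by simp [lyapFlow_zero])
  rw [hu ⟨ht, le_rfl⟩, h0]

theorem isInitialState_const [IsProbabilityMeasure P] (v : Fin n → ℝ) :
    IsInitialState P 𝓕 fun _ => v :=
  ⟨aestronglyMeasurable_const, memLp_const v⟩

/-- A matrix of second moments is positive semidefinite. -/
theorem posSemidef_secondMoment {X : Ω → Fin n → ℝ} (hX : MemLp X 2 P) :
    (Matrix.of fun i j => ∫ ω, X ω i * X ω j ∂P).PosSemidef := by
  have hm := fun i => memLp_pi_iff.1 hX i
  have hint : ∀ i j, Integrable (fun ω => X ω i * X ω j) P :=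
    fun i j => (hm i).integrable_mul (hm j)
  refine posSemidef_iff_real.2 ⟨?_, fun v => ?_⟩
  · ext i j
    simp only [Matrix.transpose_apply, Matrix.of_apply, mul_comm]
  · have hq : v ⬝ᵥ ((Matrix.of fun i j => ∫ ω, X ω i * X ω j ∂P) *ᵥ v) =
        ∫ ω, (∑ i, v i * X ω i) ^ 2 ∂P := by
      have e1 : ∀ ω, (∑ i, v i * X ω i) ^ 2 =
          ∑ i, ∑ j, v i * (X ω i * X ω j * v j) := fun ω => by
        rw [sq, Finset.sum_mul_sum]
        exact Finset.sum_congr rfl fun i _ => Finset.sum_congr rfl fun j _ => by ring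
      simp only [e1]
      rw [integral_finsetSum _ fun i _ => integrable_finsetSum _ fun j _ =>
        ((hint i j).mul_const _).const_mul _]
      simp only [dotProduct, Matrix.mulVec, Matrix.of_apply, Finset.mul_sum]
      refine Finset.sum_congr rfl fun i _ => ?_
      rw [integral_finsetSum _ fun j _ => ((hint i j).mul_const _).const_mul _]
      refine Finset.sum_congr rfl fun j _ => ?_
      rw [integral_const_mul, integral_mul_const]
    rw [hq]
    exact integral_nonneg fun ω => sq_nonneg _

/-- The second-moment semigroup preserves positivity, because `Φ t (v vᵀ) = 𝔼 [X Xᵀ]` for the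
solution started at `v`. -/
theorem flowPositive [IsProbabilityMeasure P] (hW : IsBrownianMotion P 𝓕 W) (n : ℕ) :
    FlowPositive n := by
  intro F G M t ht hM
  obtain ⟨B, rfl⟩ := exists_transpose_mul_self hM
  rw [transpose_mul_self_eq_sum, map_sum]
  refine Matrix.posSemidef_sum _ fun k _ => ?_
  have hξ := isInitialState_const (P := P) (𝓕 := 𝓕) (B k)
  obtain ⟨X, hX⟩ := exists_isSolution hW F G hξ
  have h := moment_eq_lyapFlow hW hξ hξ hX hX ht
  have e : (Matrix.of fun i j => ∫ _, B k i * B k j ∂P) = Matrix.vecMulVec (B k) (B k) := by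
    ext i j
    simp [Matrix.vecMulVec_apply]
  rw [← e, ← h]
  exact posSemidef_secondMoment (hX.memLp t.toNNReal)

end MomentFlow

/-! ### Stabilizers and cost in terms of the Lyapunov equation -/

section ClosedLoop

attribute [local instance] Matrix.normedAddCommGroup Matrix.normedSpace
attribute [-instance] instTopologicalSpaceMatrix Matrix.instUniformSpace

variable {Ω : Type*} {mΩ : MeasurableSpace Ω} {P : Measure Ω} {n m : ℕ}

/-- The quadratic functional `𝔼 [Xᵀ M X] = tr (M 𝔼 [X Xᵀ])`. -/
theorem integral_quadratic {X : Ω → Fin n → ℝ} (hX : MemLp X 2 P)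
    (M : Matrix (Fin n) (Fin n) ℝ) :
    Integrable (fun ω => X ω ⬝ᵥ (M *ᵥ X ω)) P ∧ ∫ ω, X ω ⬝ᵥ (M *ᵥ X ω) ∂P =
      (M * Matrix.of fun i j => ∫ ω, X ω i * X ω j ∂P).trace := by
  have hm := fun i => memLp_pi_iff.1 hX i
  have hint : ∀ i j, Integrable (fun ω => X ω i * X ω j) P :=
    fun i j => (hm i).integrable_mul (hm j)
  have hint' : ∀ i j, Integrable (fun ω => M i j * (X ω j * X ω i)) P :=
    fun i j => (hint j i).const_mul _
  have e1 : ∀ ω, X ω ⬝ᵥ (M *ᵥ X ω) = ∑ i, ∑ j, M i j * (X ω j * X ω i) := fun ω => by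
    simp only [dotProduct, Matrix.mulVec, Finset.mul_sum]
    exact Finset.sum_congr rfl fun i _ => Finset.sum_congr rfl fun j _ => by ring
  simp only [e1]
  refine ⟨integrable_finsetSum _ fun i _ => integrable_finsetSum _ fun j _ =>
    hint' i j, ?_⟩
  rw [integral_finsetSum _ fun i _ => integrable_finsetSum _ fun j _ => hint' i j]
  simp only [Matrix.trace, Matrix.diag_apply, Matrix.mul_apply, Matrix.of_apply]
  refine Finset.sum_congr rfl fun i _ => ?_
  rw [integral_finsetSum _ fun j _ => hint' i j]
  exact Finset.sum_congr rfl fun j _ => integral_const_mul _ _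

variable (c : Coeffs n m) (N : Noise mΩ n) (K : Matrix (Fin m) (Fin n) ℝ)

/-- The weight `Q + Kᵀ R K` of the closed-loop cost. -/
def weight (c : Coeffs n m) (K : Matrix (Fin m) (Fin n) ℝ) : Matrix (Fin n) (Fin n) ℝ :=
  c.Q + Kᵀ * c.R * K

/-- The second moments of the closed-loop system with gain `K` decay. -/
def Stable (c : Coeffs n m) (K : Matrix (Fin m) (Fin n) ℝ) : Prop :=
  LyapStable (c.A + c.B * K) (c.C + c.D * K)

/-- Decay of the semigroup on positive semidefinite matrices already stabilizes, since second
moments are positive semidefinite. -/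
theorem mem_stabilizers_of_tendsto [IsProbabilityMeasure N.P]
    (hW : IsBrownianMotion N.P N.𝓕 N.W)
    (h : ∀ M : Matrix (Fin n) (Fin n) ℝ, M.PosSemidef →
      Tendsto (fun t => lyapFlow (c.A + c.B * K) (c.C + c.D * K) t M) atTop (𝓝 0)) :
    K ∈ stabilizers c N := by
  intro ξ hξ X hX
  have h1 := tendsto_linear (traceLin 1) (h _ (posSemidef_secondMoment hξ.2))
  rw [map_zero] at h1
  refine (h1.comp (NNReal.tendsto_coe_atTop.2 tendsto_id)).congr fun t => ?_
  have hm := moment_eq_lyapFlow hW hξ hξ hX hX t.2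
  have hq := (integral_quadratic (hX.memLp t) 1).2
  simp only [Matrix.one_mulVec] at hq
  have e : (t : ℝ).toNNReal = t := Real.toNNReal_coe
  rw [hq, Function.comp_apply, traceLin_apply]
  erw [← hm]
  rw [moment]
  simp [e]

/-- Conversely, the solutions started at the standard basis vectors recover the whole semigroup:
their mixed second moments are its values at the matrix units. -/
theorem mem_stabilizers_iff [IsProbabilityMeasure N.P] (hW : IsBrownianMotion N.P N.𝓕 N.W) :
    K ∈ stabilizers c N ↔ Stable c K := by
  refine ⟨fun hK => ?_, fun h => mem_stabilizers_of_tendsto c N K hW fun M _ => h.tendsto_apply M⟩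
  choose X hX using fun a : Fin n => exists_isSolution hW (c.A + c.B * K) (c.C + c.D * K)
    (isInitialState_const (P := N.P) (𝓕 := N.𝓕) (Pi.single a (1 : ℝ)))
  have hc := fun a : Fin n => isInitialState_const (P := N.P) (𝓕 := N.𝓕) (Pi.single a (1 : ℝ))
  refine lyapStable_of_single fun a b => ?_
  have hdec := fun a => hK _ (hc a) (X a) (hX a)
  have hsum : Tendsto (fun t : ℝ => (∫ ω, X a t.toNNReal ω ⬝ᵥ X a t.toNNReal ω ∂N.P) +
      ∫ ω, X b t.toNNReal ω ⬝ᵥ X b t.toNNReal ω ∂N.P) atTop (𝓝 0) := by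
    simpa using ((hdec a).comp tendsto_real_toNNReal_atTop).add
      ((hdec b).comp tendsto_real_toNNReal_atTop)
  have hent : ∀ i j, Tendsto (fun t => moment N.P (X a) (X b) t i j) atTop (𝓝 0) := by
    intro i j
    refine squeeze_zero_norm (fun t => ?_) hsum
    have ha := hX a |>.memLp t.toNNReal
    have hb := hX b |>.memLp t.toNNReal
    have qa := (integral_quadratic ha 1).1
    have qb := (integral_quadratic hb 1).1
    simp only [Matrix.one_mulVec] at qa qb
    rw [← integral_add qa qb]
    refine norm_integral_le_of_norm_le (qa.add qb) (Eventually.of_forall fun ω => ?_)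
    have hle : ∀ (v : Fin n → ℝ) (i : Fin n), v i ^ 2 ≤ v ⬝ᵥ v := fun v i => by
      simp only [dotProduct, ← sq]
      exact Finset.single_le_sum (f := fun i => v i ^ 2) (fun _ _ => sq_nonneg _)
        (Finset.mem_univ i)
    have h1 := hle (X a t.toNNReal ω) i
    have h2 := hle (X b t.toNNReal ω) j
    rw [Real.norm_eq_abs, abs_mul]
    nlinarith [sq_nonneg (|X a t.toNNReal ω i| - |X b t.toNNReal ω j|),
      sq_abs (X a t.toNNReal ω i), sq_abs (X b t.toNNReal ω j),
      sq_nonneg (X a t.toNNReal ω i), sq_nonneg (X b t.toNNReal ω j)]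
  have hlim : Tendsto (moment N.P (X a) (X b)) atTop (𝓝 0) :=
    tendsto_pi_nhds.2 fun i => tendsto_pi_nhds.2 fun j => hent i j
  refine hlim.congr' ?_
  filter_upwards [eventually_ge_atTop 0] with t ht
  rw [moment_eq_lyapFlow hW (hc a) (hc b) (hX a) (hX b) ht]
  congr 1
  ext i j
  simp [Matrix.single, Pi.single_apply, eq_comm]
  split_ifs <;> simp_all

variable {c N K}

theorem weight_posDef (hQ : c.Q.PosDef) (hR : c.R.PosDef) : (weight c K).PosDef := by
  have := hR.posSemidef.conjTranspose_mul_mul_same K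
  rw [Matrix.conjTranspose_eq_transpose_of_trivial] at this
  exact hQ.add_posSemidef this

/-- The second moment of the closed-loop state accumulated over all times, when the initial
second moment is `Z`. -/
def accum (c : Coeffs n m) (Z : Matrix (Fin n) (Fin n) ℝ) (K : Matrix (Fin m) (Fin n) ℝ) :
    Matrix (Fin n) (Fin n) ℝ :=
  lyapSol (c.A + c.B * K) (c.C + c.D * K) Z

/-- The cost of a stabilizing gain, as a function of the initial second moment `Z`. -/
def cost (c : Coeffs n m) (Z : Matrix (Fin n) (Fin n) ℝ) (K : Matrix (Fin m) (Fin n) ℝ) : ℝ :=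
  (weight c K * accum c Z K).trace

/-- The running cost is `tr (Q_K Φ t Σ₀)`, which is minus the derivative of `tr (Q_K Φ t S)`. -/
theorem processCost_eq [IsProbabilityMeasure N.P] (hW : IsBrownianMotion N.P N.𝓕 N.W)
    (hξ : IsInitialState N.P N.𝓕 N.ξ₀) (hQ : c.Q.PosDef) (hR : c.R.PosDef) (hK : Stable c K)
    {X : ℝ≥0 → Ω → Fin n → ℝ} (hX : IsClosedLoop c N K N.ξ₀ X) :
    processCost c N K X = ENNReal.ofReal (cost c (Sigma0 N) K) := by
  have hw := (weight_posDef (K := K) hQ hR).posSemidef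
  have hpos := flowPositive hW n
  have hS₀ : (Sigma0 N).PosSemidef := posSemidef_secondMoment hξ.2
  set Φ := lyapFlow (c.A + c.B * K) (c.C + c.D * K) with hΦ
  have hin : ∀ t : ℝ, 0 ≤ t → ∫⁻ ω, ENNReal.ofReal (X t.toNNReal ω ⬝ᵥ
      ((c.Q + Kᵀ * c.R * K) *ᵥ X t.toNNReal ω)) ∂N.P =
      ENNReal.ofReal (traceLin (weight c K) (Φ t (Sigma0 N))) := by
    intro t ht
    obtain ⟨hi, he⟩ := integral_quadratic (hX.memLp t.toNNReal) (weight c K)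
    have hm := moment_eq_lyapFlow hW hξ hξ hX hX ht
    rw [traceLin_apply, hΦ]
    rw [moment] at hm
    unfold Sigma0
    rw [← hm, ← he, ofReal_integral_eq_lintegral_ofReal hi
      (Eventually.of_forall fun ω => (posSemidef_iff_real.1 hw).2 _)]
    rfl
  have hd := hasDerivAt_linear_lyapFlow (traceLin (weight c K)) (c.A + c.B * K) (c.C + c.D * K)
    (accum c (Sigma0 N) K)
  have hval : ∀ t, traceLin (weight c K) (lyapFlow (c.A + c.B * K) (c.C + c.D * K) t
      (lyap (c.A + c.B * K) (c.C + c.D * K) (accum c (Sigma0 N) K))) =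
      -traceLin (weight c K) (Φ t (Sigma0 N)) := fun t => by
    rw [accum, hK.lyap_lyapSol, map_neg, map_neg]
  have hnn : ∀ t, 0 ≤ t → 0 ≤ traceLin (weight c K) (Φ t (Sigma0 N)) := fun t ht =>
    trace_mul_nonneg hw (hpos _ _ _ t ht hS₀)
  simp only [hval] at hd
  have hlim := tendsto_linear (traceLin (weight c K)) (hK.tendsto_apply (accum c (Sigma0 N) K))
  rw [map_zero] at hlim
  have hi1 := integrableOn_Ioi_deriv_of_nonpos' (a := 0) (fun t _ => hd t)
    (fun t ht => neg_nonpos.2 (hnn t (le_of_lt ht))) hlim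
  have hi2 := integral_Ioi_of_hasDerivAt_of_nonpos' (a := 0) (fun t _ => hd t)
    (fun t ht => neg_nonpos.2 (hnn t (le_of_lt ht))) hlim
  have hi1' : IntegrableOn (fun t => traceLin (weight c K) (Φ t (Sigma0 N))) (Set.Ioi 0) := by
    simpa using hi1.neg
  rw [integral_neg, lyapFlow_zero, zero_sub, neg_inj] at hi2
  rw [processCost, setLIntegral_congr_fun measurableSet_Ici fun t ht => hin t ht,
    Measure.restrict_congr_set Ioi_ae_eq_Ici.symm,
    ← ofReal_integral_eq_lintegral_ofReal hi1' ?_, hi2]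
  · rfl
  · exact (ae_restrict_iff' measurableSet_Ioi).2
      (Eventually.of_forall fun t ht => hnn t (le_of_lt ht))

theorem costE_eq [IsProbabilityMeasure N.P] (hW : IsBrownianMotion N.P N.𝓕 N.W)
    (hξ : IsInitialState N.P N.𝓕 N.ξ₀) (hQ : c.Q.PosDef) (hR : c.R.PosDef) (hK : Stable c K) :
    costE c N K = ENNReal.ofReal (cost c (Sigma0 N) K) := by
  obtain ⟨X, hX⟩ := exists_isSolution hW (c.A + c.B * K) (c.C + c.D * K) hξ
  refine le_antisymm ((iInf₂_le X hX).trans (processCost_eq hW hξ hQ hR hK hX).le)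
    (le_iInf₂ fun Y hY => (processCost_eq hW hξ hQ hR hK hY).ge)

theorem accum_posSemidef (hpos : FlowPositive n) (hK : Stable c K)
    {Z : Matrix (Fin n) (Fin n) ℝ} (hZ : Z.PosSemidef) : (accum c Z K).PosSemidef :=
  LyapStable.lyapSol_posSemidef hpos hK hZ

theorem cost_nonneg (hpos : FlowPositive n) (hQ : c.Q.PosDef) (hR : c.R.PosDef) (hK : Stable c K)
    {Z : Matrix (Fin n) (Fin n) ℝ} (hZ : Z.PosSemidef) : 0 ≤ cost c Z K :=
  trace_mul_nonneg (weight_posDef hQ hR).posSemidef (accum_posSemidef hpos hK hZ)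

/-- On the stabilizers, the real-valued cost is not affected by the junk value of
`ENNReal.toReal`. -/
theorem J_eq [IsProbabilityMeasure N.P] (hW : IsBrownianMotion N.P N.𝓕 N.W)
    (hξ : IsInitialState N.P N.𝓕 N.ξ₀) (hQ : c.Q.PosDef) (hR : c.R.PosDef) (hK : Stable c K) :
    J c N K = cost c (Sigma0 N) K := by
  rw [J, costE_eq hW hξ hQ hR hK, ENNReal.toReal_ofReal]
  exact cost_nonneg (flowPositive hW n) hQ hR hK (posSemidef_secondMoment hξ.2)

end ClosedLoop

/-! ### Norms and extreme eigenvalues of matrices -/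

section Quantities

variable {k l : ℕ}

/-- The Euclidean norm of a coordinate vector. -/
def vnorm (v : Fin k → ℝ) : ℝ := ‖(WithLp.toLp 2 v : EuclideanSpace ℝ (Fin k))‖

theorem vnorm_nonneg (v : Fin k → ℝ) : 0 ≤ vnorm v := norm_nonneg _

theorem vnorm_sq (v : Fin k → ℝ) : vnorm v ^ 2 = v ⬝ᵥ v := by
  rw [vnorm, EuclideanSpace.real_norm_sq_eq]
  simp [dotProduct, sq]

theorem vnorm_add_le (v w : Fin k → ℝ) : vnorm (v + w) ≤ vnorm v + vnorm w := by
  rw [vnorm, WithLp.toLp_add]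
  exact norm_add_le _ _

theorem abs_dotProduct_le (v w : Fin k → ℝ) : |v ⬝ᵥ w| ≤ vnorm v * vnorm w := by
  have := abs_real_inner_le_norm (WithLp.toLp 2 v : EuclideanSpace ℝ (Fin k)) (WithLp.toLp 2 w)
  rw [EuclideanSpace.inner_toLp_toLp] at this
  simpa [vnorm, dotProduct_comm] using this

theorem specNorm_nonneg (M : Matrix (Fin k) (Fin l) ℝ) : 0 ≤ specNorm M := norm_nonneg _

theorem vnorm_mulVec_le_specNorm (M : Matrix (Fin k) (Fin l) ℝ) (v : Fin l → ℝ) :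
    vnorm (M *ᵥ v) ≤ specNorm M * vnorm v := by
  have := (LinearMap.toContinuousLinearMap (Matrix.toEuclideanLin M)).le_opNorm (WithLp.toLp 2 v)
  simpa [vnorm, specNorm] using this

theorem frobNorm_nonneg (M : Matrix (Fin k) (Fin l) ℝ) : 0 ≤ frobNorm M := Real.sqrt_nonneg _

theorem frobNorm_sq (M : Matrix (Fin k) (Fin l) ℝ) : frobNorm M ^ 2 = ∑ i, ∑ j, M i j ^ 2 :=
  Real.sq_sqrt (Finset.sum_nonneg fun _ _ => Finset.sum_nonneg fun _ _ => sq_nonneg _)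

theorem frobNorm_sq_eq_trace (M : Matrix (Fin k) (Fin l) ℝ) : frobNorm M ^ 2 = (Mᵀ * M).trace := by
  rw [frobNorm_sq, Finset.sum_comm]
  simp [Matrix.trace, Matrix.mul_apply, sq]

theorem frobNorm_sq_eq_sum (M : Matrix (Fin k) (Fin l) ℝ) :
    frobNorm M ^ 2 = ∑ i, M i ⬝ᵥ M i := by
  rw [frobNorm_sq]
  simp [dotProduct, sq]

theorem vnorm_mulVec_le_frobNorm (M : Matrix (Fin k) (Fin l) ℝ) (v : Fin l → ℝ) :
    vnorm (M *ᵥ v) ≤ frobNorm M * vnorm v := by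
  refine (sq_le_sq₀ (vnorm_nonneg _) (mul_nonneg (frobNorm_nonneg _) (vnorm_nonneg _))).1 ?_
  rw [mul_pow, vnorm_sq, frobNorm_sq_eq_sum, Finset.sum_mul, dotProduct]
  refine Finset.sum_le_sum fun i _ => ?_
  have h := abs_dotProduct_le (M i) v
  have h2 := mul_self_le_mul_self (abs_nonneg _) h
  rw [abs_mul_abs_self] at h2
  calc (M *ᵥ v) i * (M *ᵥ v) i = (M i ⬝ᵥ v) * (M i ⬝ᵥ v) := rfl
    _ ≤ _ := h2
    _ = vnorm (M i) ^ 2 * vnorm v ^ 2 := by ring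
    _ = _ := by rw [vnorm_sq]

/-- The quadratic form of `A + B K` is bounded through the spectral norms of `A` and `B`. -/
theorem abs_dotProduct_add_mul_mulVec_le (A : Matrix (Fin k) (Fin k) ℝ)
    (B : Matrix (Fin k) (Fin l) ℝ) (K : Matrix (Fin l) (Fin k) ℝ) (v : Fin k → ℝ) :
    |v ⬝ᵥ ((A + B * K) *ᵥ v)| ≤ (specNorm A + specNorm B * frobNorm K) * (v ⬝ᵥ v) := by
  refine (abs_dotProduct_le _ _).trans ?_
  rw [Matrix.add_mulVec, ← Matrix.mulVec_mulVec, ← vnorm_sq]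
  have h1 := vnorm_add_le (A *ᵥ v) (B *ᵥ (K *ᵥ v))
  have h2 := vnorm_mulVec_le_specNorm A v
  have h3 := vnorm_mulVec_le_specNorm B (K *ᵥ v)
  have h4 := mul_le_mul_of_nonneg_left (vnorm_mulVec_le_frobNorm K v) (specNorm_nonneg B)
  have h5 := mul_le_mul_of_nonneg_left (h1.trans (add_le_add h2 (h3.trans h4))) (vnorm_nonneg v)
  refine h5.trans_eq ?_
  ring

theorem spectrum_finite_nonempty (hk : 0 < k) {M : Matrix (Fin k) (Fin k) ℝ} (hM : Mᵀ = M) :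
    (spectrum ℝ M).Finite ∧ (spectrum ℝ M).Nonempty := by
  have hM' : M.IsHermitian := by
    rw [Matrix.IsHermitian, Matrix.conjTranspose_eq_transpose_of_trivial, hM]
  have : Nonempty (Fin k) := ⟨⟨0, hk⟩⟩
  rw [hM'.spectrum_real_eq_range_eigenvalues]
  exact ⟨Set.finite_range _, Set.range_nonempty _⟩

theorem lamMin_mem (hk : 0 < k) {M : Matrix (Fin k) (Fin k) ℝ} (hM : Mᵀ = M) :
    lamMin M ∈ spectrum ℝ M :=
  (spectrum_finite_nonempty hk hM).2.csInf_mem (spectrum_finite_nonempty hk hM).1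

theorem lamMin_le_lamMax (hk : 0 < k) {M : Matrix (Fin k) (Fin k) ℝ} (hM : Mᵀ = M) :
    lamMin M ≤ lamMax M :=
  le_csSup (spectrum_finite_nonempty hk hM).1.bddAbove (lamMin_mem hk hM)

/-- The smallest eigenvalue is attained at an eigenvector. -/
theorem exists_mulVec_eq_lamMin (hk : 0 < k) {M : Matrix (Fin k) (Fin k) ℝ} (hM : Mᵀ = M) :
    ∃ v : Fin k → ℝ, v ≠ 0 ∧ M *ᵥ v = lamMin M • v := by
  have h := lamMin_mem hk hM
  rw [← Matrix.spectrum_toLin', ← Module.End.hasEigenvalue_iff_mem_spectrum] at h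
  obtain ⟨v, hv⟩ := h.exists_hasEigenvector
  exact ⟨v, hv.2, by simpa using hv.apply_eq_smul⟩

theorem posSemidef_sub_lamMin {M : Matrix (Fin k) (Fin k) ℝ} (hM : Mᵀ = M) :
    (M - lamMin M • (1 : Matrix (Fin k) (Fin k) ℝ)).PosSemidef := by
  rw [Matrix.posSemidef_iff_isHermitian_and_spectrum_nonneg]
  refine ⟨?_, fun x hx => ?_⟩
  · rw [Matrix.IsHermitian, Matrix.conjTranspose_eq_transpose_of_trivial, Matrix.transpose_sub, hM,
      Matrix.transpose_smul, Matrix.transpose_one]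
  · have hk : 0 < k := by
      rcases Nat.eq_zero_or_pos k with rfl | h
      · exact absurd (isUnit_of_subsingleton _) hx
      · exact h
    have h2 : x + lamMin M ∈ spectrum ℝ M := by
      rw [spectrum.mem_iff] at hx ⊢
      convert hx using 2
      rw [Algebra.algebraMap_eq_smul_one, Algebra.algebraMap_eq_smul_one, add_smul]
      abel
    have := csInf_le (spectrum_finite_nonempty hk hM).1.bddBelow h2
    change lamMin M ≤ x + lamMin M at this
    change 0 ≤ x
    linarith

theorem lamMin_mul_le {M : Matrix (Fin k) (Fin k) ℝ} (hM : Mᵀ = M) (v : Fin k → ℝ) :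
    lamMin M * (v ⬝ᵥ v) ≤ v ⬝ᵥ (M *ᵥ v) := by
  have := (posSemidef_iff_real.1 (posSemidef_sub_lamMin hM)).2 v
  rw [Matrix.sub_mulVec, Matrix.smul_mulVec, Matrix.one_mulVec, dotProduct_sub, dotProduct_smul,
    smul_eq_mul] at this
  linarith

theorem dotProduct_self_pos_of_ne_zero {v : Fin k → ℝ} (hv : v ≠ 0) : 0 < v ⬝ᵥ v :=
  lt_of_le_of_ne (by rw [← vnorm_sq]; positivity) fun h => hv (dotProduct_self_eq_zero.1 h.symm)

theorem lamMin_pos (hk : 0 < k) {M : Matrix (Fin k) (Fin k) ℝ} (hM : M.PosDef) : 0 < lamMin M := by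
  obtain ⟨hs, hp⟩ := posDef_iff_real.1 hM
  obtain ⟨v, hv, e⟩ := exists_mulVec_eq_lamMin hk hs
  have h := hp v hv
  rw [e, dotProduct_smul, smul_eq_mul] at h
  exact pos_of_mul_pos_left h (dotProduct_self_pos_of_ne_zero hv).le

/-- `tr (M S) ≥ a tr M` if `M ≥ 0` and `S ≥ a`. -/
theorem mul_trace_le {M S : Matrix (Fin k) (Fin k) ℝ} {a : ℝ} (hM : M.PosSemidef)
    (hS : (S - a • (1 : Matrix (Fin k) (Fin k) ℝ)).PosSemidef) :
    a * M.trace ≤ (M * S).trace := by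
  have := trace_mul_nonneg hM hS
  rw [Matrix.mul_sub, Matrix.trace_sub, Matrix.mul_smul, Matrix.trace_smul, Matrix.mul_one,
    smul_eq_mul] at this
  linarith

theorem trace_mul_le {M S : Matrix (Fin k) (Fin k) ℝ} {a : ℝ} (hM : M.PosSemidef)
    (hS : (S - a • (1 : Matrix (Fin k) (Fin k) ℝ)).PosSemidef) :
    a * M.trace ≤ (S * M).trace := by
  rw [Matrix.trace_mul_comm]; exact mul_trace_le hM hS

theorem posSemidef_transpose_mul_self (M : Matrix (Fin k) (Fin l) ℝ) : (Mᵀ * M).PosSemidef := by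
  simpa [Matrix.conjTranspose_eq_transpose_of_trivial] using
    Matrix.posSemidef_conjTranspose_mul_self M

theorem frobNorm_mul_le {p : ℕ} (M : Matrix (Fin k) (Fin l) ℝ) (N : Matrix (Fin l) (Fin p) ℝ) :
    frobNorm (M * N) ^ 2 ≤ frobNorm M ^ 2 * frobNorm N ^ 2 := by
  rw [frobNorm_sq, frobNorm_sq M, frobNorm_sq N, Finset.sum_mul]
  refine Finset.sum_le_sum fun i _ => ?_
  rw [Finset.sum_comm, Finset.mul_sum]
  refine Finset.sum_le_sum fun j _ => ?_
  rw [Matrix.mul_apply]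
  exact Finset.sum_mul_sq_le_sq_mul_sq _ _ _

theorem frobNorm_transpose (M : Matrix (Fin k) (Fin l) ℝ) : frobNorm Mᵀ = frobNorm M := by
  rw [frobNorm, frobNorm, Finset.sum_comm]
  rfl

theorem trace_mul_le_trace_mul_trace {M S : Matrix (Fin k) (Fin k) ℝ} (hM : M.PosSemidef)
    (hS : S.PosSemidef) : (M * S).trace ≤ M.trace * S.trace := by
  obtain ⟨U, rfl⟩ := exists_transpose_mul_self hM
  obtain ⟨V, rfl⟩ := exists_transpose_mul_self hS
  have h := frobNorm_mul_le U Vᵀ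
  rw [frobNorm_sq_eq_trace, frobNorm_transpose, frobNorm_sq_eq_trace, frobNorm_sq_eq_trace,
    Matrix.transpose_mul, Matrix.transpose_transpose] at h
  refine le_trans (le_of_eq ?_) h
  rw [Matrix.mul_assoc V, Matrix.trace_mul_comm V]
  simp only [Matrix.mul_assoc]

/-- Multiplication by a matrix `S ≥ a ≥ 0` expands the Frobenius norm by at least `a`. -/
theorem mul_frobNorm_le_frobNorm_mul {E : Matrix (Fin l) (Fin k) ℝ} {S : Matrix (Fin k) (Fin k) ℝ}
    (hS : S.PosSemidef) {a : ℝ} (ha : 0 ≤ a) (h : ∀ v, a * (v ⬝ᵥ v) ≤ v ⬝ᵥ (S *ᵥ v)) :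
    a ^ 2 * frobNorm E ^ 2 ≤ frobNorm (E * S) ^ 2 := by
  rw [frobNorm_sq_eq_sum, frobNorm_sq_eq_sum, Finset.mul_sum]
  refine Finset.sum_le_sum fun i _ => ?_
  have e : (E * S) i = S *ᵥ E i := by
    rw [← (posSemidef_iff_real.1 hS).1, Matrix.mulVec_transpose, (posSemidef_iff_real.1 hS).1]
    exact Matrix.mul_apply_eq_vecMul E S i
  rw [e, ← vnorm_sq, ← vnorm_sq, ← mul_pow]
  refine pow_le_pow_left₀ (mul_nonneg ha (vnorm_nonneg _)) ?_ 2
  have h1 := (h (E i)).trans ((le_abs_self _).trans (abs_dotProduct_le _ _))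
  rw [← vnorm_sq] at h1
  rcases (vnorm_nonneg (E i)).eq_or_lt with h0 | h0
  · rw [← h0, mul_zero]; exact vnorm_nonneg _
  · exact le_of_mul_le_mul_left (by linarith) h0

end Quantities

/-! ### The second-order expansion of the cost -/

section Expansion

attribute [local instance] Matrix.normedAddCommGroup Matrix.normedSpace
attribute [-instance] instTopologicalSpaceMatrix Matrix.instUniformSpace

variable {n m : ℕ}

/-- The matrix representing a linear functional through the trace pairing. -/
def traceRep (φ : Matrix (Fin n) (Fin n) ℝ →ₗ[ℝ] ℝ) : Matrix (Fin n) (Fin n) ℝ :=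
  Matrix.of fun i j => φ (Matrix.single j i 1)

theorem trace_traceRep_mul (φ : Matrix (Fin n) (Fin n) ℝ →ₗ[ℝ] ℝ) (M : Matrix (Fin n) (Fin n) ℝ) :
    (traceRep φ * M).trace = φ M := by
  conv_rhs => rw [Matrix.matrix_eq_sum_single M]
  simp only [map_sum, Matrix.trace, Matrix.diag_apply, Matrix.mul_apply, traceRep, Matrix.of_apply]
  rw [Finset.sum_comm]
  refine Finset.sum_congr rfl fun i _ => Finset.sum_congr rfl fun j _ => ?_
  rw [← mul_one (M i j), ← smul_eq_mul (M i j) 1, ← Matrix.smul_single, map_smul, smul_eq_mul,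
    smul_eq_mul, mul_one, mul_comm]

variable (c : Coeffs n m) (Z : Matrix (Fin n) (Fin n) ℝ) (K : Matrix (Fin m) (Fin n) ℝ)

/-- The functional assigning to an initial second moment the cost of the gain `K`. -/
def costLin : Matrix (Fin n) (Fin n) ℝ →ₗ[ℝ] ℝ :=
  -((traceLin (weight c K)).comp (Ring.inverse (lyap (c.A + c.B * K) (c.C + c.D * K))).toLinearMap)

theorem costLin_apply : costLin c K Z = cost c Z K := by
  rw [cost, accum, lyapSol, Matrix.mul_neg, Matrix.trace_neg]
  rfl

/-- The value matrix `P` of the gain `K`: the cost is `tr (P Z)` for the initial second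
moment `Z`. -/
def valueMat : Matrix (Fin n) (Fin n) ℝ := traceRep (costLin c K)

theorem trace_valueMat_mul : (valueMat c K * Z).trace = cost c Z K := by
  rw [valueMat, trace_traceRep_mul, costLin_apply]

/-- The matrix `E = Bᵀ P + Dᵀ P (C + D K) + R K`; the gradient of the cost is `2 E S`. -/
def gradFactor : Matrix (Fin m) (Fin n) ℝ :=
  c.Bᵀ * valueMat c K + c.Dᵀ * valueMat c K * (c.C + c.D * K) + c.R * K

/-- The matrix `R + Dᵀ P D`. -/
def curvature : Matrix (Fin m) (Fin m) ℝ := c.R + c.Dᵀ * valueMat c K * c.D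

variable {c Z K}

theorem weight_transpose (hQ : c.Q.PosDef) (hR : c.R.PosDef) : (weight c K)ᵀ = weight c K :=
  (posDef_iff_real.1 (weight_posDef hQ hR)).1

theorem valueMat_posSemidef (hpos : FlowPositive n) (hQ : c.Q.PosDef) (hR : c.R.PosDef)
    (hK : Stable c K) : (valueMat c K).PosSemidef := by
  refine posSemidef_iff_real.2 ⟨?_, fun v => ?_⟩
  · refine Matrix.ext_iff_trace_mul_right.2 fun M => ?_
    rw [← Matrix.trace_transpose, Matrix.transpose_mul, Matrix.transpose_transpose,
      Matrix.trace_mul_comm, trace_valueMat_mul, trace_valueMat_mul, cost, cost, accum,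
      LyapStable.lyapSol_transpose hK, ← Matrix.trace_transpose, Matrix.transpose_mul,
      Matrix.transpose_transpose, weight_transpose hQ hR, Matrix.trace_mul_comm]
    rfl
  · have h := cost_nonneg hpos hQ hR hK (posSemidef_vecMulVec v)
    rw [← trace_valueMat_mul, Matrix.mul_vecMulVec, Matrix.trace_vecMulVec, dotProduct_comm] at h
    exact h

theorem trace_valueMat_mul_lyap (hK : Stable c K) (S : Matrix (Fin n) (Fin n) ℝ) :
    (valueMat c K * lyap (c.A + c.B * K) (c.C + c.D * K) S).trace = -(weight c K * S).trace := by
  rw [trace_valueMat_mul, cost, accum, LyapStable.lyapSol_lyap hK, Matrix.mul_neg,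
    Matrix.trace_neg]

theorem trace_sym_swap {P S : Matrix (Fin n) (Fin n) ℝ} (hP : Pᵀ = P) (hS : Sᵀ = S)
    (M : Matrix (Fin n) (Fin n) ℝ) : (P * M * S).trace = (P * (S * Mᵀ)).trace := by
  rw [← Matrix.trace_transpose, Matrix.transpose_mul, Matrix.transpose_mul, hP, hS,
    ← Matrix.mul_assoc, Matrix.trace_mul_comm]

/-- The exact second-order expansion of the cost between two stabilizing gains. -/
theorem cost_sub_cost (hpos : FlowPositive n) (hQ : c.Q.PosDef) (hR : c.R.PosDef)
    (hZ : Z.PosSemidef) (hK : Stable c K) {K' : Matrix (Fin m) (Fin n) ℝ} (hK' : Stable c K') :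
    cost c Z K' - cost c Z K =
      ((K' - K)ᵀ * curvature c K * (K' - K) * accum c Z K').trace +
        2 * ((K' - K)ᵀ * gradFactor c K * accum c Z K').trace := by
  obtain ⟨Δ, rfl⟩ : ∃ Δ, K' = K + Δ := ⟨K' - K, by abel⟩
  rw [add_sub_cancel_left]
  have hPs := (posSemidef_iff_real.1 (valueMat_posSemidef hpos hQ hR hK)).1
  have hSs := (posSemidef_iff_real.1 (accum_posSemidef hpos hK' hZ)).1
  have hRs := (posDef_iff_real.1 hR).1
  have hL : lyap (c.A + c.B * (K + Δ)) (c.C + c.D * (K + Δ)) (accum c Z (K + Δ)) = -Z :=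
    LyapStable.lyap_lyapSol hK' Z
  have h1 : cost c Z K = -(valueMat c K *
      lyap (c.A + c.B * (K + Δ)) (c.C + c.D * (K + Δ)) (accum c Z (K + Δ))).trace := by
    rw [hL, Matrix.mul_neg, Matrix.trace_neg, neg_neg, trace_valueMat_mul]
  have h2 := trace_valueMat_mul_lyap hK (accum c Z (K + Δ))
  rw [h1, cost]
  set S := accum c Z (K + Δ)
  simp only [curvature, gradFactor]
  generalize valueMat c K = P at *
  have t1 : (P * (c.B * Δ * S)).trace = (P * (S * (Δᵀ * c.Bᵀ))).trace := by
    rw [← Matrix.mul_assoc, trace_sym_swap hPs hSs, Matrix.transpose_mul]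
  have t2 : (P * (c.D * Δ * S * (c.C + c.D * K)ᵀ)).trace =
      (P * ((c.C + c.D * K) * S * (Δᵀ * c.Dᵀ))).trace := by
    rw [← Matrix.trace_transpose, Matrix.transpose_mul, hPs, Matrix.trace_mul_comm]
    simp only [Matrix.transpose_mul, Matrix.transpose_transpose, hSs, Matrix.mul_assoc]
  have t3 : (Kᵀ * c.R * Δ * S).trace = (Δᵀ * c.R * K * S).trace := by
    rw [← Matrix.trace_transpose, Matrix.transpose_mul, hSs, Matrix.trace_mul_comm]
    simp only [Matrix.transpose_mul, Matrix.transpose_transpose, hRs, Matrix.mul_assoc]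
  have e1 : (P * lyap (c.A + c.B * (K + Δ)) (c.C + c.D * (K + Δ)) S).trace =
      (P * lyap (c.A + c.B * K) (c.C + c.D * K) S).trace +
      2 * (P * (S * (Δᵀ * c.Bᵀ))).trace + 2 * (P * ((c.C + c.D * K) * S * (Δᵀ * c.Dᵀ))).trace +
      (P * (c.D * Δ * S * (Δᵀ * c.Dᵀ))).trace := by
    have : lyap (c.A + c.B * (K + Δ)) (c.C + c.D * (K + Δ)) S =
        lyap (c.A + c.B * K) (c.C + c.D * K) S + c.B * Δ * S + S * (Δᵀ * c.Bᵀ) +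
        c.D * Δ * S * (c.C + c.D * K)ᵀ + (c.C + c.D * K) * S * (Δᵀ * c.Dᵀ) +
        c.D * Δ * S * (Δᵀ * c.Dᵀ) := by
      simp only [lyap_apply, Matrix.mul_add, Matrix.add_mul, Matrix.transpose_add,
        Matrix.transpose_mul]
      abel
    rw [this]
    simp only [Matrix.mul_add, Matrix.trace_add]
    linarith
  have e2 : (weight c (K + Δ) * S).trace = (weight c K * S).trace + 2 * (Δᵀ * c.R * K * S).trace +
      (Δᵀ * c.R * Δ * S).trace := by
    have : weight c (K + Δ) = weight c K + Δᵀ * c.R * K + Kᵀ * c.R * Δ + Δᵀ * c.R * Δ := by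
      simp only [weight, Matrix.mul_add, Matrix.add_mul, Matrix.transpose_add]
      abel
    rw [this]
    simp only [Matrix.add_mul, Matrix.trace_add]
    linarith
  -- cyclic permutations bring all terms to the form `tr (Δᵀ ⋯ S)`
  have c1 : (P * (S * (Δᵀ * c.Bᵀ))).trace = (Δᵀ * (c.Bᵀ * P) * S).trace := by
    rw [← Matrix.mul_assoc, Matrix.trace_mul_comm, ← Matrix.mul_assoc]
    simp only [Matrix.mul_assoc]
  have c2 : (P * ((c.C + c.D * K) * S * (Δᵀ * c.Dᵀ))).trace =
      (Δᵀ * (c.Dᵀ * P * (c.C + c.D * K)) * S).trace := by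
    rw [← Matrix.mul_assoc, Matrix.trace_mul_comm]
    simp only [Matrix.mul_assoc]
  have c3 : (P * (c.D * Δ * S * (Δᵀ * c.Dᵀ))).trace = (Δᵀ * (c.Dᵀ * P * c.D) * Δ * S).trace := by
    rw [← Matrix.mul_assoc, Matrix.trace_mul_comm]
    simp only [Matrix.mul_assoc]
  have d1 : (Δᵀ * (c.R + c.Dᵀ * P * c.D) * Δ * S).trace =
      (Δᵀ * c.R * Δ * S).trace + (Δᵀ * (c.Dᵀ * P * c.D) * Δ * S).trace := by
    rw [Matrix.mul_add, Matrix.add_mul, Matrix.add_mul, Matrix.trace_add]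
  have d2 : (Δᵀ * (c.Bᵀ * P + c.Dᵀ * P * (c.C + c.D * K) + c.R * K) * S).trace =
      (Δᵀ * (c.Bᵀ * P) * S).trace + (Δᵀ * (c.Dᵀ * P * (c.C + c.D * K)) * S).trace +
      (Δᵀ * c.R * K * S).trace := by
    rw [Matrix.mul_add, Matrix.mul_add, Matrix.add_mul, Matrix.add_mul, Matrix.trace_add,
      Matrix.trace_add, Matrix.mul_assoc Δᵀ c.R K]
  rw [d1, d2, e2, e1, h2, c1, c2, c3]
  ring

/-- `R + Dᵀ P D ≥ λ₁(R)`. -/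
theorem curvature_sub_posSemidef (hpos : FlowPositive n) (hQ : c.Q.PosDef) (hR : c.R.PosDef)
    (hK : Stable c K) :
    (curvature c K - lamMin c.R • (1 : Matrix (Fin m) (Fin m) ℝ)).PosSemidef := by
  have h1 := posSemidef_sub_lamMin (posDef_iff_real.1 hR).1
  have h2 := (valueMat_posSemidef hpos hQ hR hK).conjTranspose_mul_mul_same c.D
  rw [Matrix.conjTranspose_eq_transpose_of_trivial] at h2
  convert h1.add h2 using 1
  rw [curvature]
  abel

/-- The quadratic term of the expansion dominates `λ₁(R) tr (Δᵀ Δ S)`. -/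
theorem mul_trace_le_trace_curvature (hpos : FlowPositive n) (hQ : c.Q.PosDef) (hR : c.R.PosDef)
    (hK : Stable c K) {S : Matrix (Fin n) (Fin n) ℝ} (hS : S.PosSemidef)
    (Δ : Matrix (Fin m) (Fin n) ℝ) :
    lamMin c.R * (Δᵀ * Δ * S).trace ≤ (Δᵀ * curvature c K * Δ * S).trace := by
  have h := (curvature_sub_posSemidef hpos hQ hR hK).conjTranspose_mul_mul_same Δ
  rw [Matrix.conjTranspose_eq_transpose_of_trivial] at h
  have h2 := trace_mul_nonneg h hS
  rw [Matrix.mul_sub, Matrix.sub_mul, Matrix.sub_mul, Matrix.trace_sub, Matrix.mul_smul,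
    Matrix.smul_mul, Matrix.smul_mul, Matrix.trace_smul, Matrix.mul_one, smul_eq_mul] at h2
  linarith

/-- The cost exceeds the cost of any other gain by at most a multiple of `‖E‖²`. -/
theorem cost_sub_le (hm : 0 < m) (hpos : FlowPositive n) (hQ : c.Q.PosDef) (hR : c.R.PosDef)
    (hZ : Z.PosSemidef) (hK : Stable c K) {K' : Matrix (Fin m) (Fin n) ℝ} (hK' : Stable c K') :
    cost c Z K - cost c Z K' ≤
      frobNorm (gradFactor c K) ^ 2 * (accum c Z K').trace / lamMin c.R := by
  have hr := lamMin_pos hm hR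
  have hS := accum_posSemidef hpos hK' hZ
  have h1 := cost_sub_cost hpos hQ hR hZ hK hK'
  have h2 := mul_trace_le_trace_curvature hpos hQ hR hK hS (K' - K)
  set S := accum c Z K'
  set E := gradFactor c K
  set Δ := K' - K
  have hSs := (posSemidef_iff_real.1 hS).1
  -- completing the square
  have h3 := trace_mul_nonneg (posSemidef_transpose_mul_self (lamMin c.R • Δ + E)) hS
  have e1 : (Eᵀ * Δ * S).trace = (Δᵀ * E * S).trace := by
    rw [← Matrix.trace_transpose, Matrix.transpose_mul, hSs, Matrix.trace_mul_comm]
    simp only [Matrix.transpose_mul, Matrix.transpose_transpose]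
  have e2 : ((lamMin c.R • Δ + E)ᵀ * (lamMin c.R • Δ + E) * S).trace =
      lamMin c.R ^ 2 * (Δᵀ * Δ * S).trace + 2 * lamMin c.R * (Δᵀ * E * S).trace +
        (Eᵀ * E * S).trace := by
    simp only [Matrix.transpose_add, Matrix.transpose_smul, Matrix.add_mul, Matrix.mul_add,
      Matrix.smul_mul, Matrix.mul_smul, Matrix.trace_add, Matrix.trace_smul, smul_eq_mul, e1]
    ring
  have h4 := trace_mul_le_trace_mul_trace (posSemidef_transpose_mul_self E) hS
  rw [← frobNorm_sq_eq_trace] at h4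
  rw [le_div_iff₀ hr]
  rw [e2] at h3
  have h5 := mul_le_mul_of_nonneg_left h2 hr.le
  have h6 : (cost c Z K - cost c Z K') * lamMin c.R =
      -(lamMin c.R * (Δᵀ * curvature c K * Δ * S).trace) -
        2 * lamMin c.R * (Δᵀ * E * S).trace := by
    linear_combination (-lamMin c.R) * h1
  rw [h6]
  nlinarith

end Expansion

/-! ### A priori bounds on sublevel sets -/

section Estimates

attribute [local instance] Matrix.normedAddCommGroup Matrix.normedSpace
attribute [-instance] instTopologicalSpaceMatrix Matrix.instUniformSpace

variable {n m : ℕ} {c : Coeffs n m} {Z S : Matrix (Fin n) (Fin n) ℝ}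
  {K : Matrix (Fin m) (Fin n) ℝ} {a : ℝ}

/-- The bound `‖A‖ + ‖B‖² a / (λ₁(R) λ₁(Z))` which, up to a factor of two, controls `‖A + B K‖` on
the sublevel set of the cost at the level `a`. -/
def driftBound (c : Coeffs n m) (Z : Matrix (Fin n) (Fin n) ℝ) (a : ℝ) : ℝ :=
  specNorm c.A + specNorm c.B ^ 2 * a / (lamMin c.R * lamMin Z)

/-- Testing the Lyapunov equation against an eigenvector for the smallest eigenvalue of its solution
bounds that eigenvalue from below. -/
theorem lamMin_le_of_lyap_eq (hn : 0 < n) (hZ : Z.PosDef) (hS : S.PosSemidef)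
    (hL : lyap (c.A + c.B * K) (c.C + c.D * K) S = -Z) :
    0 < lamMin S ∧ lamMin Z ≤ 2 * lamMin S * (specNorm c.A + specNorm c.B * frobNorm K) := by
  have hσ := lamMin_pos hn (posDef_of_lyap_eq hS hZ hL)
  refine ⟨hσ, ?_⟩
  obtain ⟨hs, hp⟩ := posSemidef_iff_real.1 hS
  obtain ⟨v, hv, e⟩ := exists_mulVec_eq_lamMin hn hs
  have hvv := dotProduct_self_pos_of_ne_zero hv
  have hZv := lamMin_mul_le (posDef_iff_real.1 hZ).1 v
  have hF := neg_le_of_abs_le (abs_dotProduct_add_mul_mulVec_le c.A c.B K v)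
  set F := c.A + c.B * K
  set G := c.C + c.D * K
  have e' : v ᵥ* S = lamMin S • v := by rw [← Matrix.mulVec_transpose, hs, e]
  have h1 : quadLin v (lyap F G S) =
      2 * lamMin S * (v ⬝ᵥ (F *ᵥ v)) + (Gᵀ *ᵥ v) ⬝ᵥ (S *ᵥ (Gᵀ *ᵥ v)) := by
    have a1 : v ⬝ᵥ ((F * S) *ᵥ v) = lamMin S * (v ⬝ᵥ (F *ᵥ v)) := by
      rw [← Matrix.mulVec_mulVec, e, Matrix.mulVec_smul, dotProduct_smul, smul_eq_mul]
    have a2 : v ⬝ᵥ ((S * Fᵀ) *ᵥ v) = lamMin S * (v ⬝ᵥ (F *ᵥ v)) := by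
      rw [← Matrix.mulVec_mulVec, Matrix.dotProduct_mulVec, e', smul_dotProduct, smul_eq_mul,
        Matrix.mulVec_transpose, dotProduct_comm, ← Matrix.dotProduct_mulVec]
    have a3 : v ⬝ᵥ ((G * S * Gᵀ) *ᵥ v) = (Gᵀ *ᵥ v) ⬝ᵥ (S *ᵥ (Gᵀ *ᵥ v)) := by
      rw [← Matrix.mulVec_mulVec, ← Matrix.mulVec_mulVec, Matrix.dotProduct_mulVec v G,
        ← Matrix.mulVec_transpose]
    rw [quadLin_apply, lyap_apply, Matrix.add_mulVec, Matrix.add_mulVec, dotProduct_add,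
      dotProduct_add, a1, a2, a3]
    ring
  rw [hL, map_neg, quadLin_apply] at h1
  have h2 := hp (Gᵀ *ᵥ v)
  have h3 : lamMin Z * (v ⬝ᵥ v) ≤
      2 * lamMin S * (specNorm c.A + specNorm c.B * frobNorm K) * (v ⬝ᵥ v) := by
    nlinarith [mul_le_mul_of_nonneg_left hF hσ.le]
  exact le_of_mul_le_mul_right h3 hvv

/-- Both parts of the running cost control norms: `Q` that of `S`, and `R` that of `K`. -/
theorem cost_bounds (hn : 0 < n) (hQ : c.Q.PosDef) (hR : c.R.PosDef)
    (hZ : Z.PosDef) (hS : S.PosSemidef) (hL : lyap (c.A + c.B * K) (c.C + c.D * K) S = -Z)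
    (ha : (weight c K * S).trace ≤ a) :
    lamMin c.Q * S.trace ≤ a ∧ lamMin c.R * lamMin S * frobNorm K ^ 2 ≤ a := by
  have hσ := (lamMin_le_of_lyap_eq hn hZ hS hL).1
  obtain ⟨hRs, -⟩ := posDef_iff_real.1 hR
  have hKR : (Kᵀ * c.R * K).PosSemidef := by
    have := hR.posSemidef.conjTranspose_mul_mul_same K
    rwa [Matrix.conjTranspose_eq_transpose_of_trivial] at this
  have h1 : lamMin c.Q * S.trace ≤ (c.Q * S).trace :=
    trace_mul_le hS (posSemidef_sub_lamMin (posDef_iff_real.1 hQ).1)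
  have h2 : lamMin S * (Kᵀ * c.R * K).trace ≤ (Kᵀ * c.R * K * S).trace :=
    mul_trace_le hKR (posSemidef_sub_lamMin (posSemidef_iff_real.1 hS).1)
  have h3 : lamMin c.R * frobNorm K ^ 2 ≤ (Kᵀ * c.R * K).trace := by
    have := (posSemidef_sub_lamMin hRs).conjTranspose_mul_mul_same K
    rw [Matrix.conjTranspose_eq_transpose_of_trivial] at this
    have := this.trace_nonneg
    rw [Matrix.mul_sub, Matrix.sub_mul, Matrix.trace_sub, Matrix.mul_smul, Matrix.mul_one,
      Matrix.smul_mul, Matrix.trace_smul, smul_eq_mul, ← frobNorm_sq_eq_trace] at this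
    linarith
  have h4 : 0 ≤ (c.Q * S).trace := trace_mul_nonneg hQ.posSemidef hS
  have h5 : 0 ≤ (Kᵀ * c.R * K * S).trace := trace_mul_nonneg hKR hS
  rw [weight, Matrix.add_mul, Matrix.trace_add] at ha
  have h6 := mul_le_mul_of_nonneg_left h3 hσ.le
  exact ⟨by linarith, by linarith⟩

/-- On a sublevel set of the cost, the smallest eigenvalue of the accumulated second moment is
bounded from below. -/
theorem lamMin_le_driftBound_mul (hn : 0 < n) (hm : 0 < m) (hQ : c.Q.PosDef) (hR : c.R.PosDef)
    (hZ : Z.PosDef) (hS : S.PosSemidef) (hL : lyap (c.A + c.B * K) (c.C + c.D * K) S = -Z)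
    (ha : (weight c K * S).trace ≤ a) : lamMin Z ≤ 4 * driftBound c Z a * lamMin S := by
  obtain ⟨hσ, h1⟩ := lamMin_le_of_lyap_eq hn hZ hS hL
  obtain ⟨-, h2⟩ := cost_bounds hn hQ hR hZ hS hL ha
  have hr := lamMin_pos hm hR
  have hz := lamMin_pos hn hZ
  have hA := specNorm_nonneg c.A
  have hB := specNorm_nonneg c.B
  have hK := frobNorm_nonneg K
  obtain ⟨q, hq⟩ : ∃ q, q = specNorm c.B ^ 2 * a / (lamMin c.R * lamMin Z) := ⟨_, rfl⟩
  have hq' : q * (lamMin c.R * lamMin Z) = specNorm c.B ^ 2 * a := by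
    rw [hq, div_mul_cancel₀ _ (mul_pos hr hz).ne']
  have ha0 : 0 ≤ a := le_trans (by positivity) h2
  have hq0 : 0 ≤ q := by rw [hq]; positivity
  obtain ⟨y, hy⟩ : ∃ y, y = specNorm c.B * frobNorm K := ⟨_, rfl⟩
  have hy0 : 0 ≤ y := by rw [hy]; positivity
  rw [← hy] at h1
  -- `y = ‖B‖ ‖K‖` satisfies the quadratic inequality `y² ≤ 2 q (‖A‖ + y)`
  have h3 : y ^ 2 ≤ 2 * q * (specNorm c.A + y) := by
    have e : y ^ 2 * (lamMin c.R * lamMin S) ≤ specNorm c.B ^ 2 * a := by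
      rw [hy, mul_pow]
      nlinarith [mul_le_mul_of_nonneg_left h2 (sq_nonneg (specNorm c.B))]
    have e2 : y ^ 2 * lamMin c.R * lamMin Z ≤
        y ^ 2 * lamMin c.R * (2 * lamMin S * (specNorm c.A + y)) :=
      mul_le_mul_of_nonneg_left h1 (by positivity)
    have e3 : y ^ 2 * (lamMin c.R * lamMin S) * (2 * (specNorm c.A + y)) ≤
        q * (lamMin c.R * lamMin Z) * (2 * (specNorm c.A + y)) := by
      rw [hq']; exact mul_le_mul_of_nonneg_right e (by positivity)
    refine le_of_mul_le_mul_right ?_ (mul_pos hr hz)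
    linarith
  have h4 : y ≤ 2 * q + specNorm c.A := by
    by_contra! h
    nlinarith [mul_nonneg hq0 hA, mul_nonneg hA hy0]
  have h5 : specNorm c.A + y ≤ 2 * driftBound c Z a := by
    rw [driftBound, ← hq]; linarith
  have h6 := mul_le_mul_of_nonneg_left h5 hσ.le
  linarith

theorem driftBound_pos (hn : 0 < n) (hm : 0 < m) (hQ : c.Q.PosDef) (hR : c.R.PosDef)
    (hZ : Z.PosDef) (hS : S.PosSemidef) (hL : lyap (c.A + c.B * K) (c.C + c.D * K) S = -Z)
    (ha : (weight c K * S).trace ≤ a) : 0 < driftBound c Z a := by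
  have h1 := lamMin_le_driftBound_mul hn hm hQ hR hZ hS hL ha
  have h2 := (lamMin_le_of_lyap_eq hn hZ hS hL).1
  have h3 := lamMin_pos hn hZ
  by_contra! h
  nlinarith

end Estimates

/-! ### Smoothness and the gradient of the cost -/

section Smoothness

attribute [local instance] Matrix.normedAddCommGroup Matrix.normedSpace
attribute [-instance] instTopologicalSpaceMatrix Matrix.instUniformSpace

variable {V : Type*} [NormedAddCommGroup V] [NormedSpace ℝ V] {k l p : ℕ} {x : V}

theorem contDiffAt_matrix {f : V → Matrix (Fin k) (Fin l) ℝ} :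
    ContDiffAt ℝ 1 f x ↔ ∀ i j, ContDiffAt ℝ 1 (fun y => f y i j) x := by
  refine Iff.trans (contDiffAt_pi (F' := fun _ : Fin k => Fin l → ℝ)) ?_
  exact forall_congr' fun i => contDiffAt_pi

theorem contDiffAt_matrix_mul {f : V → Matrix (Fin k) (Fin l) ℝ}
    {g : V → Matrix (Fin l) (Fin p) ℝ} (hf : ContDiffAt ℝ 1 f x) (hg : ContDiffAt ℝ 1 g x) :
    ContDiffAt ℝ 1 (fun y => f y * g y) x := by
  rw [contDiffAt_matrix] at *
  intro i j
  simp only [Matrix.mul_apply]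
  exact ContDiffAt.sum fun r _ => (hf i r).mul (hg r j)

theorem contDiffAt_matrix_transpose {f : V → Matrix (Fin k) (Fin l) ℝ} (hf : ContDiffAt ℝ 1 f x) :
    ContDiffAt ℝ 1 (fun y => (f y)ᵀ) x := by
  rw [contDiffAt_matrix] at *
  exact fun i j => hf j i

theorem contDiffAt_matrix_trace {f : V → Matrix (Fin k) (Fin k) ℝ} (hf : ContDiffAt ℝ 1 f x) :
    ContDiffAt ℝ 1 (fun y => (f y).trace) x := by
  rw [contDiffAt_matrix] at hf
  exact ContDiffAt.sum fun i _ => hf i i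

variable {n m : ℕ} {c : Coeffs n m} {Z : Matrix (Fin n) (Fin n) ℝ} {K : Matrix (Fin m) (Fin n) ℝ}

theorem contDiffAt_affine (A : Matrix (Fin n) (Fin n) ℝ) (B : Matrix (Fin n) (Fin m) ℝ) :
    ContDiffAt ℝ 1 (fun K : Matrix (Fin m) (Fin n) ℝ => A + B * K) K :=
  contDiffAt_const.add (contDiffAt_matrix_mul contDiffAt_const contDiffAt_id)

/-- The closed-loop Lyapunov operator depends smoothly on the gain. -/
theorem contDiff_lyap (c : Coeffs n m) :
    ContDiff ℝ 1 fun K : Matrix (Fin m) (Fin n) ℝ => lyap (c.A + c.B * K) (c.C + c.D * K) := by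
  refine contDiff_clm_apply_iff.2 fun M => contDiff_iff_contDiffAt.2 fun K => ?_
  simp only [lyap_apply]
  have hF := contDiffAt_affine (K := K) c.A c.B
  have hG := contDiffAt_affine (K := K) c.C c.D
  exact ((contDiffAt_matrix_mul hF contDiffAt_const).add
    (contDiffAt_matrix_mul contDiffAt_const (contDiffAt_matrix_transpose hF))).add
    (contDiffAt_matrix_mul (contDiffAt_matrix_mul hG contDiffAt_const)
      (contDiffAt_matrix_transpose hG))

/-- Stability is an open condition, because it is witnessed by the norm of the semigroup at a single
time. -/
theorem isOpen_stable (c : Coeffs n m) : IsOpen {K | Stable c K} := by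
  have e : {K | Stable c K} = ⋃ t > (0 : ℝ),
      {K | ‖lyapFlow (c.A + c.B * K) (c.C + c.D * K) t‖ < 1} := by
    ext K
    simp only [Stable, lyapStable_iff, Set.mem_iUnion, Set.mem_ofPred_eq, exists_prop]
  rw [e]
  refine isOpen_iUnion fun t => isOpen_iUnion fun _ => isOpen_lt ?_ continuous_const
  let _ : NormedAlgebra ℚ (Matrix (Fin n) (Fin n) ℝ →L[ℝ] Matrix (Fin n) (Fin n) ℝ) :=
    .restrictScalars ℚ ℝ _
  exact (NormedSpace.exp_continuous.comp ((contDiff_lyap c).continuous.const_smul t)).norm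

theorem contDiffAt_inverse_lyap (hK : Stable c K) (M : Matrix (Fin n) (Fin n) ℝ) :
    ContDiffAt ℝ 1 (fun K => Ring.inverse (lyap (c.A + c.B * K) (c.C + c.D * K)) M) K := by
  obtain ⟨u, hu⟩ := LyapStable.isUnit hK
  have h := contDiffAt_ringInverse (n := 1) ℝ u
  rw [hu] at h
  exact (h.comp K (contDiff_lyap c).contDiffAt).clm_apply contDiffAt_const

theorem contDiffAt_accum (hK : Stable c K) (Z : Matrix (Fin n) (Fin n) ℝ) :
    ContDiffAt ℝ 1 (fun K => accum c Z K) K :=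
  (contDiffAt_inverse_lyap hK Z).neg

theorem contDiffAt_weight : ContDiffAt ℝ 1 (fun K => weight c K) K :=
  contDiffAt_const.add (contDiffAt_matrix_mul (contDiffAt_matrix_mul
    (contDiffAt_matrix_transpose contDiffAt_id) contDiffAt_const) contDiffAt_id)

theorem contDiffAt_cost (hK : Stable c K) (Z : Matrix (Fin n) (Fin n) ℝ) :
    ContDiffAt ℝ 1 (cost c Z) K :=
  contDiffAt_matrix_trace (contDiffAt_matrix_mul contDiffAt_weight (contDiffAt_accum hK Z))

theorem contDiffAt_valueMat (hK : Stable c K) : ContDiffAt ℝ 1 (valueMat c) K := by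
  refine contDiffAt_matrix.2 fun i j => ?_
  refine (contDiffAt_cost hK (Matrix.single j i 1)).congr_of_eventuallyEq
    (Eventually.of_forall fun K => ?_)
  rw [← costLin_apply]
  rfl

theorem contDiffAt_gradFactor (hK : Stable c K) : ContDiffAt ℝ 1 (gradFactor c) K :=
  ((contDiffAt_matrix_mul contDiffAt_const (contDiffAt_valueMat hK)).add
    (contDiffAt_matrix_mul (contDiffAt_matrix_mul contDiffAt_const (contDiffAt_valueMat hK))
      (contDiffAt_affine c.C c.D))).add (contDiffAt_matrix_mul contDiffAt_const contDiffAt_id)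

/-- The gradient `2 E S` of the cost. -/
def grad (c : Coeffs n m) (Z : Matrix (Fin n) (Fin n) ℝ) (K : Matrix (Fin m) (Fin n) ℝ) :
    Matrix (Fin m) (Fin n) ℝ :=
  (2 : ℝ) • (gradFactor c K * accum c Z K)

theorem contDiffAt_grad (hK : Stable c K) (Z : Matrix (Fin n) (Fin n) ℝ) :
    ContDiffAt ℝ 1 (grad c Z) K :=
  (contDiffAt_matrix_mul (contDiffAt_gradFactor hK) (contDiffAt_accum hK Z)).const_smul (2 : ℝ)

/-- The derivative is read off the expansion `cost_sub_cost`, where the accumulated second moment is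
that of the perturbed gain but converges to that of `K`. -/
theorem fderiv_cost (hpos : FlowPositive n) (hQ : c.Q.PosDef) (hR : c.R.PosDef)
    (hZ : Z.PosSemidef) (hK : Stable c K) (H : Matrix (Fin m) (Fin n) ℝ) :
    fderiv ℝ (cost c Z) K H = (Hᵀ * grad c Z K).trace := by
  have hd := (contDiffAt_cost hK Z).differentiableAt one_ne_zero
  have hline : HasDerivAt (fun t : ℝ => K + t • H) H 0 := by
    simpa using ((hasDerivAt_id (0 : ℝ)).smul_const H).const_add K
  have h0 : K + (0 : ℝ) • H = K := by simp
  have h1 : HasDerivAt (fun t : ℝ => cost c Z (K + t • H)) (fderiv ℝ (cost c Z) K H) 0 :=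
    hd.hasFDerivAt.comp_hasDerivAt_of_eq (0 : ℝ) hline h0.symm
  have hS : Tendsto (fun t : ℝ => accum c Z (K + t • H)) (𝓝[≠] 0) (𝓝 (accum c Z K)) := by
    have h2 : ContinuousAt (fun K => accum c Z K) (K + (0 : ℝ) • H) := by
      rw [h0]; exact (contDiffAt_accum hK Z).continuousAt
    have h3 := ContinuousAt.comp (f := fun t : ℝ => K + t • H) h2 hline.continuousAt
    have h4 := h3.tendsto
    rw [Function.comp_apply, h0] at h4
    exact h4.mono_left nhdsWithin_le_nhds
  have hst : ∀ᶠ t : ℝ in 𝓝[≠] 0, Stable c (K + t • H) := by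
    refine nhdsWithin_le_nhds (hline.continuousAt.eventually_mem ((isOpen_stable c).mem_nhds ?_))
    rw [h0]; exact hK
  rw [hasDerivAt_iff_tendsto_slope_zero] at h1
  refine tendsto_nhds_unique h1 ?_
  have hid : Tendsto (fun t : ℝ => t) (𝓝[≠] 0) (𝓝 0) := tendsto_id.mono_left nhdsWithin_le_nhds
  have l1 := tendsto_linear (traceLin (Hᵀ * curvature c K * H)) hS
  have l2 := tendsto_linear (traceLin (Hᵀ * gradFactor c K)) hS
  have l3 := (hid.mul l1).add (l2.const_mul 2)
  have e : (Hᵀ * grad c Z K).trace = 0 * traceLin (Hᵀ * curvature c K * H) (accum c Z K) +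
      2 * traceLin (Hᵀ * gradFactor c K) (accum c Z K) := by
    rw [grad, Matrix.mul_smul, Matrix.trace_smul, ← Matrix.mul_assoc, zero_mul, zero_add]
    rfl
  rw [e]
  refine l3.congr' ?_
  filter_upwards [hst, self_mem_nhdsWithin] with t ht ht0
  have ht0' : t ≠ 0 := ht0
  have := cost_sub_cost hpos hQ hR hZ hK ht
  rw [add_sub_cancel_left] at this
  rw [zero_add, h0, this]
  simp only [traceLin_apply, Matrix.transpose_smul, Matrix.smul_mul, Matrix.mul_smul,
    Matrix.trace_smul, smul_eq_mul]
  field_simp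

theorem gradMat_cost (hpos : FlowPositive n) (hQ : c.Q.PosDef) (hR : c.R.PosDef)
    (hZ : Z.PosSemidef) (hK : Stable c K) : gradMat (cost c Z) K = grad c Z K := by
  ext i j
  refine (fderiv_cost hpos hQ hR hZ hK (Matrix.single i j 1)).trans ?_
  rw [Matrix.transpose_single, Matrix.trace_single_mul]
  simp

end Smoothness

/-! ### Forward solutions of descent equations -/

section Descent

variable {V : Type*} [NormedAddCommGroup V] [NormedSpace ℝ V] [FiniteDimensional ℝ V]

/-- A bounded, globally Lipschitz vector field has forward solutions for all times. -/
theorem exists_forward_solution {w : V → V} {k : ℝ≥0} (hw : LipschitzWith k w) {b : ℝ≥0}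
    (hb : ∀ x, ‖w x‖ ≤ b) (x₀ : V) :
    ∃ y : ℝ → V, y 0 = x₀ ∧ ∀ t, 0 ≤ t → HasDerivWithinAt y (w (y t)) (Set.Ici 0) t := by
  have : CompleteSpace V := FiniteDimensional.complete ℝ V
  have hex : ∀ j : ℕ, ∃ α : ℝ → V, α 0 = x₀ ∧ ∀ t ∈ Set.Icc (0 : ℝ) (j + 1),
      HasDerivWithinAt α (w (α t)) (Set.Icc 0 (j + 1)) t := by
    intro j
    have hj : (0 : ℝ) ≤ j + 1 := by positivity
    have hPL : IsPicardLindelof (fun _ => w) (tmin := 0) (tmax := j + 1) ⟨0, ⟨le_rfl, hj⟩⟩ x₀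
        (b * (j + 1)) 0 b k := by
      refine IsPicardLindelof.of_time_independent (fun x _ => hb x) hw.lipschitzOnWith ?_
      simp [hj]
    exact hPL.exists_eq_forall_mem_Icc_hasDerivWithinAt₀
  choose α h0 hα using hex
  -- the solutions on `[0, j + 1]` are glued by uniqueness
  have huniq : ∀ i j : ℕ, i ≤ j → Set.EqOn (α i) (α j) (Set.Icc 0 (i + 1)) := by
    intro i j hij
    have hij' : (i : ℝ) + 1 ≤ j + 1 := by gcongr
    have hder : ∀ l : ℕ, i ≤ l → ∀ t ∈ Set.Ico (0 : ℝ) (i + 1),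
        HasDerivWithinAt (α l) (w (α l t)) (Set.Ici t) t := by
      intro l hl t ht
      have hl' : (i : ℝ) + 1 ≤ l + 1 := by gcongr
      have ht' : t ∈ Set.Ico (0 : ℝ) (l + 1) := ⟨ht.1, ht.2.trans_le hl'⟩
      exact (hα l t ⟨ht'.1, ht'.2.le⟩).mono_of_mem_nhdsWithin (Icc_mem_nhdsGE_of_mem ht')
    refine ODE_solution_unique_of_mem_Icc_right (v := fun _ => w) (s := fun _ => Set.univ) (K := k)
      (fun _ _ => hw.lipschitzOnWith)
      (fun t ht => (hα i t ht).continuousWithinAt) (hder i le_rfl) (fun _ _ => Set.mem_univ _)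
      (fun t ht => ((hα j t ⟨ht.1, ht.2.trans hij'⟩).continuousWithinAt).mono
        (Set.Icc_subset_Icc_right hij')) (hder j hij) (fun _ _ => Set.mem_univ _) ?_
    rw [h0, h0]
  have hy : ∀ j : ℕ, Set.EqOn (fun t => α ⌊t⌋₊ t) (α j) (Set.Ico 0 (j + 1)) := by
    intro j t ht
    refine huniq ⌊t⌋₊ j ?_ ⟨ht.1, (Nat.lt_floor_add_one t).le⟩
    have := (Nat.floor_lt ht.1).2 (by exact_mod_cast ht.2 : t < ((j + 1 : ℕ) : ℝ))
    omega
  refine ⟨fun t => α ⌊t⌋₊ t, by simp [h0], fun t ht => ?_⟩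
  have htj : t ∈ Set.Ico (0 : ℝ) (((⌊t⌋₊ : ℕ) : ℝ) + 1) := ⟨ht, Nat.lt_floor_add_one t⟩
  have h1 : HasDerivWithinAt (α ⌊t⌋₊) (w (α ⌊t⌋₊ t)) (Set.Ici 0) t := by
    refine (hα ⌊t⌋₊ t ⟨htj.1, htj.2.le⟩).mono_of_mem_nhdsWithin ?_
    filter_upwards [self_mem_nhdsWithin, nhdsWithin_le_nhds (Iio_mem_nhds htj.2)] with s h1 h2
    exact ⟨h1, le_of_lt h2⟩
  refine h1.congr_of_eventuallyEq ?_ rfl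
  filter_upwards [self_mem_nhdsWithin, nhdsWithin_le_nhds (Iio_mem_nhds htj.2)] with s h1 h2
  exact hy ⌊t⌋₊ ⟨h1, h2⟩

/-- A continuously differentiable field agrees near a compact set with a bounded, globally
Lipschitz one. -/
theorem exists_lipschitz_cutoff {U C : Set V} (hU : IsOpen U) (hC : IsCompact C) (hCU : C ⊆ U)
    {v : V → V} (hv : ∀ x ∈ U, ContDiffAt ℝ 1 v x) :
    ∃ (w : V → V) (k b : ℝ≥0), LipschitzWith k w ∧ (∀ x, ‖w x‖ ≤ b) ∧ ∀ x ∈ C, w =ᶠ[𝓝 x] v := by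
  obtain ⟨L, hL, hCL, hLU⟩ := exists_compact_between hC hU hCU
  obtain ⟨χ, h1, h0, -⟩ := exists_contMDiffMap_one_nhds_of_subset_interior (n := 1)
    (modelWithCornersSelf ℝ V) hC.isClosed hCL
  have hχ : ContDiff ℝ 1 χ := χ.contMDiff.contDiff
  have hz : ∀ x ∉ L, χ x • v x = 0 := fun x hx => by rw [h0 x hx, zero_smul]
  have hw : ContDiff ℝ 1 fun x => χ x • v x := by
    refine contDiff_iff_contDiffAt.2 fun x => ?_
    by_cases hx : x ∈ U
    · exact hχ.contDiffAt.smul (hv x hx)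
    · refine (contDiffAt_const (c := (0 : V))).congr_of_eventuallyEq ?_
      filter_upwards [hL.isClosed.isOpen_compl.mem_nhds fun h => hx (hLU h)] with y hy
      exact hz y hy
  have hs : HasCompactSupport fun x => χ x • v x := HasCompactSupport.intro hL hz
  obtain ⟨k, hk⟩ := hw.lipschitzWith_of_hasCompactSupport hs one_ne_zero
  obtain ⟨b, hb⟩ := hs.exists_bound_of_continuous hw.continuous
  refine ⟨_, k, b.toNNReal, hk, fun x => (hb x).trans (Real.le_coe_toNNReal b), fun x hx => ?_⟩
  filter_upwards [h1.filter_mono (nhds_le_nhdsSet hx)] with y hy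
  rw [hy, one_smul]

/-- A field along which a function with compact sublevel set decreases has forward solutions for
all times, which do not leave the sublevel set. -/
theorem exists_descent_solution {U : Set V} (hU : IsOpen U) {f : V → ℝ} {v : V → V} {a : ℝ}
    (hv : ∀ x ∈ U, ContDiffAt ℝ 1 v x) (hf : ∀ x ∈ U, DifferentiableAt ℝ f x)
    (hdec : ∀ x ∈ U, fderiv ℝ f x (v x) ≤ 0) (hC : IsCompact {x | x ∈ U ∧ f x ≤ a}) {x₀ : V}
    (hx₀ : x₀ ∈ U ∧ f x₀ ≤ a) :
    ∃ y : ℝ → V, y 0 = x₀ ∧ (∀ t, 0 ≤ t → y t ∈ U) ∧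
      ∀ t, 0 ≤ t → HasDerivWithinAt y (v (y t)) (Set.Ici 0) t := by
  obtain ⟨w, k, b, hk, hb, hw⟩ := exists_lipschitz_cutoff hU hC (fun x hx => hx.1) hv
  obtain ⟨y, hy0, hy⟩ := exists_forward_solution hk hb x₀
  have hcont : ContinuousOn y (Set.Ici 0) := fun t ht => (hy t ht).continuousWithinAt
  have hmem : ∀ T, 0 ≤ T → y T ∈ {x | x ∈ U ∧ f x ≤ a} := by
    intro T hT
    refine IsClosed.Icc_subset_of_forall_exists_gt (a := 0) (b := T)
      (s := y ⁻¹' {x | x ∈ U ∧ f x ≤ a}) ?_ (by rw [Set.mem_preimage, hy0]; exact hx₀) ?_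
      ⟨hT, le_rfl⟩
    · rw [Set.inter_comm]
      exact (hcont.mono Set.Icc_subset_Ici_self).preimage_isClosed_of_isClosed isClosed_Icc
        hC.isClosed
    -- near `t` the trajectory stays where the cutoff is inactive, and there `f` decreases
    · rintro t ⟨htC, ht0, htT⟩ z hz
      have htC' : y t ∈ U ∧ f (y t) ≤ a := htC
      have hcw : ContinuousWithinAt y (Set.Ici t) t :=
        (hcont t ht0).mono (Set.Ici_subset_Ici.2 ht0)
      have hev : ∀ᶠ x in 𝓝 (y t), x ∈ U ∧ w x = v x :=
        (hU.eventually_mem htC'.1).and (hw _ htC')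
      obtain ⟨u, hu, hut⟩ := (mem_nhdsGE_iff_exists_Icc_subset).1 (hcw.eventually hev)
      have hu' : t < u := hu
      have hut' : ∀ s ∈ Set.Icc t u, y s ∈ U ∧ w (y s) = v (y s) := hut
      have hanti : AntitoneOn (fun s => f (y s)) (Set.Icc t u) := by
        have hd : ∀ s ∈ Set.Icc t u,
            HasDerivWithinAt (fun s => f (y s)) (fderiv ℝ f (y s) (v (y s))) (Set.Ici 0) s := by
          intro s hs
          have h1 := hy s (ht0.trans hs.1)
          rw [(hut' s hs).2] at h1
          exact (hf _ (hut' s hs).1).hasFDerivAt.comp_hasDerivWithinAt s h1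
        have hd' : ∀ s ∈ Set.Ioo t u,
            HasDerivAt (fun s => f (y s)) (fderiv ℝ f (y s) (v (y s))) s := fun s hs =>
          (hd s ⟨hs.1.le, hs.2.le⟩).hasDerivAt (Ici_mem_nhds (ht0.trans_lt hs.1))
        refine antitoneOn_of_deriv_nonpos (convex_Icc t u) (fun s hs =>
          ((hd s hs).continuousWithinAt).mono fun r hr => ht0.trans hr.1) ?_ ?_
        · rw [interior_Icc]
          exact fun s hs => (hd' s hs).differentiableAt.differentiableWithinAt
        · rw [interior_Icc]
          intro s hs
          rw [(hd' s hs).deriv]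
          exact hdec _ (hut' s ⟨hs.1.le, hs.2.le⟩).1
      have hz' : t < z := hz
      refine ⟨min u z, ⟨(hut' _ ⟨(lt_min hu' hz').le, min_le_left _ _⟩).1, ?_⟩,
        lt_min hu' hz', min_le_right _ _⟩
      exact (hanti ⟨le_rfl, hu'.le⟩ ⟨(lt_min hu' hz').le, min_le_left _ _⟩
        (lt_min hu' hz').le).trans htC'.2
  refine ⟨y, hy0, fun t ht => (hmem t ht).1, fun t ht => ?_⟩
  have h1 := hy t ht
  rwa [(hw _ (hmem t ht)).self_of_nhds] at h1

end Descent

/-! ### Compactness of sublevel sets -/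

section Sublevel

attribute [local instance] Matrix.normedAddCommGroup Matrix.normedSpace
attribute [-instance] instTopologicalSpaceMatrix Matrix.instUniformSpace

variable {n m : ℕ} {c : Coeffs n m} {Z : Matrix (Fin n) (Fin n) ℝ}

theorem norm_le_frobNorm {k l : ℕ} (M : Matrix (Fin k) (Fin l) ℝ) : ‖M‖ ≤ frobNorm M := by
  refine (Matrix.norm_le_iff (frobNorm_nonneg M)).2 fun i j => ?_
  rw [Real.norm_eq_abs]
  refine Real.abs_le_sqrt ?_
  exact (Finset.single_le_sum (f := fun j => M i j ^ 2) (fun _ _ => sq_nonneg _)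
    (Finset.mem_univ j)).trans (Finset.single_le_sum (f := fun i => ∑ j, M i j ^ 2)
    (fun _ _ => Finset.sum_nonneg fun _ _ => sq_nonneg _) (Finset.mem_univ i))

theorem frobNorm_le_trace {k : ℕ} {S : Matrix (Fin k) (Fin k) ℝ} (hS : S.PosSemidef) :
    frobNorm S ≤ S.trace := by
  refine (sq_le_sq₀ (frobNorm_nonneg S) hS.trace_nonneg).1 ?_
  rw [frobNorm_sq_eq_trace, (posSemidef_iff_real.1 hS).1, sq]
  exact trace_mul_le_trace_mul_trace hS hS

theorem isClosed_posSemidef (k : ℕ) : IsClosed {S : Matrix (Fin k) (Fin k) ℝ | S.PosSemidef} := by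
  have e : {S : Matrix (Fin k) (Fin k) ℝ | S.PosSemidef} =
      (⋂ i, ⋂ j, {S | S j i = S i j}) ∩ ⋂ v, {S | 0 ≤ quadLin v S} := by
    ext S
    simp only [Set.mem_ofPred_eq, posSemidef_iff_real, Set.mem_inter_iff, Set.mem_iInter,
      quadLin_apply, ← Matrix.ext_iff, Matrix.transpose_apply]
  rw [e]
  have hent : ∀ i j, Continuous fun S : Matrix (Fin k) (Fin k) ℝ => S i j := fun i j =>
    (continuous_apply j).comp (continuous_apply i)
  exact (isClosed_iInter fun i => isClosed_iInter fun j => isClosed_eq (hent j i) (hent i j)).inter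
    (isClosed_iInter fun v => isClosed_le continuous_const
      (LinearMap.toContinuousLinearMap (quadLin v)).continuous)

/-- The sublevel sets of the cost are compact. They are projections of the closed and bounded set
of pairs `(K, S)` with `S ≥ 0` solving the Lyapunov equation for `K`; by Lyapunov's criterion, the
gains of such pairs are stabilizing. -/
theorem isCompact_sublevel (hn : 0 < n) (hm : 0 < m) (hpos : FlowPositive n)
    (hcrit : ∀ K : Matrix (Fin m) (Fin n) ℝ, (∀ M : Matrix (Fin n) (Fin n) ℝ, M.PosSemidef →
      Tendsto (fun t => lyapFlow (c.A + c.B * K) (c.C + c.D * K) t M) atTop (𝓝 0)) → Stable c K)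
    (hQ : c.Q.PosDef) (hR : c.R.PosDef) (hZ : Z.PosDef) (a : ℝ) :
    IsCompact {K | Stable c K ∧ cost c Z K ≤ a} := by
  have e : {K | Stable c K ∧ cost c Z K ≤ a} = Prod.fst ''
      {p : Matrix (Fin m) (Fin n) ℝ × Matrix (Fin n) (Fin n) ℝ | p.2.PosSemidef ∧
        lyap (c.A + c.B * p.1) (c.C + c.D * p.1) p.2 = -Z ∧ (weight c p.1 * p.2).trace ≤ a} := by
    ext K
    constructor
    · rintro ⟨hK, ha⟩
      exact ⟨(K, accum c Z K), ⟨accum_posSemidef hpos hK hZ.posSemidef,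
        LyapStable.lyap_lyapSol hK Z, ha⟩, rfl⟩
    · rintro ⟨⟨K', S⟩, ⟨hS, hL, ha⟩, rfl⟩
      have hK : Stable c K' := hcrit K' fun M hM => tendsto_lyapFlow_of_lyap_eq hpos hS hZ hL hM
      refine ⟨hK, ?_⟩
      rw [cost, accum, ← LyapStable.eq_lyapSol hK hL]
      exact ha
  rw [e]
  refine IsCompact.image ?_ continuous_fst
  refine Metric.isCompact_of_isClosed_isBounded ?_ ?_
  · have h1 : Continuous fun p : Matrix (Fin m) (Fin n) ℝ × Matrix (Fin n) (Fin n) ℝ =>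
        lyap (c.A + c.B * p.1) (c.C + c.D * p.1) p.2 :=
      ((contDiff_lyap c).continuous.comp continuous_fst).clm_apply continuous_snd
    have h2 : Continuous fun p : Matrix (Fin m) (Fin n) ℝ × Matrix (Fin n) (Fin n) ℝ =>
        (weight c p.1 * p.2).trace :=
      (contDiff_iff_contDiffAt.2 fun p => contDiffAt_matrix_trace (contDiffAt_matrix_mul
        (contDiffAt_weight.comp p contDiffAt_fst) contDiffAt_snd)).continuous
    have h3 := isClosed_eq h1 (continuous_const (y := -Z))
    have h4 := isClosed_le h2 (continuous_const (y := a))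
    exact ((isClosed_posSemidef n).preimage continuous_snd).inter (h3.inter h4)
  · have hq := lamMin_pos hn hQ
    have hr := lamMin_pos hm hR
    have hz := lamMin_pos hn hZ
    refine isBounded_iff_forall_norm_le.2 ⟨max (√(a * (4 * driftBound c Z a) /
      (lamMin c.R * lamMin Z))) (a / lamMin c.Q), ?_⟩
    rintro ⟨K, S⟩ ⟨hS, hL, ha⟩
    have h1 := lamMin_le_driftBound_mul hn hm hQ hR hZ hS hL ha
    have h2 := driftBound_pos hn hm hQ hR hZ hS hL ha
    obtain ⟨h3, h4⟩ := cost_bounds hn hQ hR hZ hS hL ha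
    refine max_le_max ((norm_le_frobNorm K).trans (Real.le_sqrt_of_sq_le ?_))
      ((norm_le_frobNorm S).trans ((frobNorm_le_trace hS).trans ?_))
    · rw [le_div_iff₀ (mul_pos hr hz)]
      have h5 := mul_le_mul_of_nonneg_left h1 (mul_nonneg (sq_nonneg (frobNorm K)) hr.le)
      have h6 := mul_le_mul_of_nonneg_right h4 (mul_pos four_pos h2).le
      change frobNorm K ^ 2 * (lamMin c.R * lamMin Z) ≤ _
      linarith
    · rw [le_div_iff₀ hq]
      change S.trace * lamMin c.Q ≤ a
      linarith

end Sublevel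

/-! ### Gradient domination and convergence of the flow -/

section Convergence

attribute [local instance] Matrix.normedAddCommGroup Matrix.normedSpace
attribute [-instance] instTopologicalSpaceMatrix Matrix.instUniformSpace

variable {n m : ℕ} {c : Coeffs n m} {Z : Matrix (Fin n) (Fin n) ℝ} {a : ℝ}
  {K K' : Matrix (Fin m) (Fin n) ℝ}

theorem frobNorm_eq_zero {k l : ℕ} {M : Matrix (Fin k) (Fin l) ℝ} (h : frobNorm M = 0) : M = 0 :=
  norm_le_zero_iff.1 (h ▸ norm_le_frobNorm M)

theorem frobNorm_smul_sq {k l : ℕ} (r : ℝ) (M : Matrix (Fin k) (Fin l) ℝ) :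
    frobNorm (r • M) ^ 2 = r ^ 2 * frobNorm M ^ 2 := by
  simp only [frobNorm_sq, Matrix.smul_apply, smul_eq_mul, mul_pow, Finset.mul_sum]

theorem continuous_frobNorm (k l : ℕ) :
    Continuous (frobNorm : Matrix (Fin k) (Fin l) ℝ → ℝ) := by
  have hent : ∀ i j, Continuous fun S : Matrix (Fin k) (Fin l) ℝ => S i j := fun i j =>
    (continuous_apply j).comp (continuous_apply i)
  exact Real.continuous_sqrt.comp (continuous_finsetSum _ fun i _ =>
    continuous_finsetSum _ fun j _ => (hent i j).pow 2)

/-- The constant `4 a / (λ₁(R) λ₁(Q) λ₁(Z)²) (‖A‖ + ‖B‖² a / (λ₁(R) λ₁(Z)))²` in the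
gradient-domination inequality on the sublevel set of the cost at the level `a`. -/
def domConst (c : Coeffs n m) (Z : Matrix (Fin n) (Fin n) ℝ) (a : ℝ) : ℝ :=
  4 * a / (lamMin c.R * lamMin c.Q * lamMin Z ^ 2) * driftBound c Z a ^ 2

/-- A level that is attained on the stabilizers cannot be too small. -/
theorem le_level_mul_driftBound (hn : 0 < n) (hm : 0 < m) (hpos : FlowPositive n)
    (hQ : c.Q.PosDef) (hR : c.R.PosDef) (hZ : Z.PosDef) (hK : Stable c K) (ha : cost c Z K ≤ a) :
    0 < driftBound c Z a ∧ 0 < a ∧ lamMin c.Q * lamMin Z ≤ 4 * driftBound c Z a * a := by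
  have hS := accum_posSemidef hpos hK hZ.posSemidef
  have hL : lyap (c.A + c.B * K) (c.C + c.D * K) (accum c Z K) = -Z := LyapStable.lyap_lyapSol hK Z
  have hq := lamMin_pos hn hQ
  have hz := lamMin_pos hn hZ
  have h1 := lamMin_le_driftBound_mul hn hm hQ hR hZ hS hL ha
  have h2 := driftBound_pos hn hm hQ hR hZ hS hL ha
  have h3 := (cost_bounds hn hQ hR hZ hS hL ha).1
  -- the trace bounds the smallest eigenvalue, since it is the trace of `S - λ₁(S) ≥ 0` plus
  -- `n λ₁(S)`
  have h4 : lamMin (accum c Z K) ≤ (accum c Z K).trace := by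
    have h := (posSemidef_sub_lamMin (posSemidef_iff_real.1 hS).1).trace_nonneg
    rw [Matrix.trace_sub, Matrix.trace_smul, Matrix.trace_one, smul_eq_mul, Fintype.card_fin] at h
    have h5 := (lamMin_le_of_lyap_eq hn hZ hS hL).1
    have h6 : (1 : ℝ) ≤ n := by exact_mod_cast hn
    nlinarith
  have h5 : lamMin c.Q * lamMin (accum c Z K) ≤ a :=
    (mul_le_mul_of_nonneg_left h4 hq.le).trans h3
  have h6 : lamMin c.Q * lamMin Z ≤ 4 * driftBound c Z a * a := by
    have := mul_le_mul_of_nonneg_left h1 hq.le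
    have h7 := mul_le_mul_of_nonneg_left h5 (mul_pos four_pos h2).le
    linarith
  refine ⟨h2, ?_, h6⟩
  exact lt_of_lt_of_le (mul_pos hq (lamMin_le_of_lyap_eq hn hZ hS hL).1) h5

theorem domConst_pos (hn : 0 < n) (hm : 0 < m) (hpos : FlowPositive n)
    (hQ : c.Q.PosDef) (hR : c.R.PosDef) (hZ : Z.PosDef) (hK : Stable c K) (ha : cost c Z K ≤ a) :
    0 < domConst c Z a := by
  obtain ⟨h1, h2, -⟩ := le_level_mul_driftBound hn hm hpos hQ hR hZ hK ha
  have hq := lamMin_pos hn hQ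
  have hr := lamMin_pos hm hR
  have hz := lamMin_pos hn hZ
  unfold domConst
  positivity

/-- The gradient-domination (Polyak–Łojasiewicz) inequality. -/
theorem cost_sub_le_frobNorm_grad (hn : 0 < n) (hm : 0 < m) (hpos : FlowPositive n)
    (hQ : c.Q.PosDef) (hR : c.R.PosDef) (hZ : Z.PosDef) (hK : Stable c K) (ha : cost c Z K ≤ a)
    (hK' : Stable c K') (ha' : cost c Z K' ≤ a) :
    cost c Z K - cost c Z K' ≤ domConst c Z a * frobNorm (grad c Z K) ^ 2 := by
  have hS := accum_posSemidef hpos hK hZ.posSemidef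
  have hL : lyap (c.A + c.B * K) (c.C + c.D * K) (accum c Z K) = -Z := LyapStable.lyap_lyapSol hK Z
  have hS' := accum_posSemidef hpos hK' hZ.posSemidef
  have hL' : lyap (c.A + c.B * K') (c.C + c.D * K') (accum c Z K') = -Z :=
    LyapStable.lyap_lyapSol hK' Z
  have hq := lamMin_pos hn hQ
  have hr := lamMin_pos hm hR
  have hz := lamMin_pos hn hZ
  have hσ := (lamMin_le_of_lyap_eq hn hZ hS hL).1
  have h1 := cost_sub_le hm hpos hQ hR hZ.posSemidef hK hK'
  have h2 := mul_frobNorm_le_frobNorm_mul (E := gradFactor c K) hS hσ.le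
    (lamMin_mul_le (posSemidef_iff_real.1 hS).1)
  have h3 := lamMin_le_driftBound_mul hn hm hQ hR hZ hS hL ha
  have hd := driftBound_pos hn hm hQ hR hZ hS hL ha
  have h4 := (cost_bounds hn hQ hR hZ hS' hL' ha').1
  refine h1.trans ?_
  rw [grad, frobNorm_smul_sq]
  set e := frobNorm (gradFactor c K) ^ 2 with he
  have he0 : 0 ≤ e := sq_nonneg _
  set f := frobNorm (gradFactor c K * accum c Z K) ^ 2
  have h5 : lamMin Z ^ 2 ≤ 16 * driftBound c Z a ^ 2 * lamMin (accum c Z K) ^ 2 := by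
    have := pow_le_pow_left₀ hz.le h3 2
    calc _ ≤ _ := this
      _ = _ := by ring
  have h6 : lamMin Z ^ 2 * e ≤ 16 * driftBound c Z a ^ 2 * f := by
    have u1 := mul_le_mul_of_nonneg_right h5 he0
    have u2 := mul_le_mul_of_nonneg_left h2 (by positivity : 0 ≤ 16 * driftBound c Z a ^ 2)
    linarith
  have ha0 := (le_level_mul_driftBound hn hm hpos hQ hR hZ hK ha).2.1
  have h7 : e * (accum c Z K').trace * (lamMin c.Q * lamMin Z ^ 2) ≤
      16 * driftBound c Z a ^ 2 * f * a := by
    have u1 := mul_le_mul_of_nonneg_left h4 (by positivity : 0 ≤ lamMin Z ^ 2 * e)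
    have u2 := mul_le_mul_of_nonneg_right h6 ha0.le
    linarith
  -- the factor `4` in `domConst` is `16`, from `h5`, divided by `2 ^ 2`, from the gradient `2 E S`
  have e1 : domConst c Z a * (2 ^ 2 * f) =
      16 * driftBound c Z a ^ 2 * f * a / (lamMin c.Q * lamMin Z ^ 2) / lamMin c.R := by
    unfold domConst
    field_simp
    ring
  rw [e1]
  refine div_le_div_of_nonneg_right ?_ hr.le
  rw [le_div_iff₀ (by positivity)]
  exact h7

/-- Around a critical point, the cost grows quadratically. -/
theorem mul_frobNorm_sub_sq_le (hn : 0 < n) (hm : 0 < m) (hpos : FlowPositive n)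
    (hQ : c.Q.PosDef) (hR : c.R.PosDef) (hZ : Z.PosDef) (hK : Stable c K) (ha : cost c Z K ≤ a)
    (hK' : Stable c K') (hg : grad c Z K' = 0) :
    lamMin c.R * lamMin Z * frobNorm (K - K') ^ 2 ≤
      4 * driftBound c Z a * (cost c Z K - cost c Z K') := by
  have hS := accum_posSemidef hpos hK hZ.posSemidef
  have hL : lyap (c.A + c.B * K) (c.C + c.D * K) (accum c Z K) = -Z := LyapStable.lyap_lyapSol hK Z
  have hS' := accum_posSemidef hpos hK' hZ.posSemidef
  have hL' : lyap (c.A + c.B * K') (c.C + c.D * K') (accum c Z K') = -Z :=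
    LyapStable.lyap_lyapSol hK' Z
  have hr := lamMin_pos hm hR
  have hσ' := (lamMin_le_of_lyap_eq hn hZ hS' hL').1
  have h0 : gradFactor c K' = 0 := by
    have h2 := mul_frobNorm_le_frobNorm_mul (E := gradFactor c K') hS' hσ'.le
      (lamMin_mul_le (posSemidef_iff_real.1 hS').1)
    have h3 : gradFactor c K' * accum c Z K' = 0 := by
      rw [grad] at hg
      exact (smul_eq_zero.1 hg).resolve_left two_ne_zero
    have h4 : frobNorm (0 : Matrix (Fin m) (Fin n) ℝ) ^ 2 = 0 := by simp [frobNorm_sq]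
    rw [h3, h4] at h2
    -- the accumulated second moment is invertible, so that `E S = 0` implies `E = 0`
    have h5 : frobNorm (gradFactor c K') ^ 2 = 0 :=
      le_antisymm (nonpos_of_mul_nonpos_right h2 (by positivity)) (sq_nonneg _)
    exact frobNorm_eq_zero (pow_eq_zero_iff two_ne_zero |>.1 h5)
  have h1 := cost_sub_cost hpos hQ hR hZ.posSemidef hK' hK
  rw [h0, Matrix.mul_zero, Matrix.zero_mul, Matrix.trace_zero, mul_zero, add_zero] at h1
  have h2 := mul_trace_le_trace_curvature hpos hQ hR hK' hS (K - K')
  have h3 := mul_trace_le (posSemidef_transpose_mul_self (K - K'))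
    (posSemidef_sub_lamMin (posSemidef_iff_real.1 hS).1)
  rw [← frobNorm_sq_eq_trace] at h3
  have h4 := lamMin_le_driftBound_mul hn hm hQ hR hZ hS hL ha
  have hd := driftBound_pos hn hm hQ hR hZ hS hL ha
  rw [h1]
  have u1 := mul_le_mul_of_nonneg_left h4 (by positivity : 0 ≤ lamMin c.R * frobNorm (K - K') ^ 2)
  have u2 := mul_le_mul_of_nonneg_left ((mul_le_mul_of_nonneg_left h3 hr.le).trans h2)
    (by positivity : 0 ≤ 4 * driftBound c Z a)
  linarith

/-- The stabilizers form an open set, so that a minimizer is a critical point. -/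
theorem grad_eq_zero_of_isMin (hpos : FlowPositive n) (hQ : c.Q.PosDef) (hR : c.R.PosDef)
    (hZ : Z.PosDef) (hK : Stable c K) (hmin : ∀ K', Stable c K' → cost c Z K ≤ cost c Z K') :
    grad c Z K = 0 := by
  have hloc : IsLocalMin (cost c Z) K := by
    filter_upwards [(isOpen_stable c).mem_nhds hK] with K' hK'
    exact hmin K' hK'
  have h := fderiv_cost hpos hQ hR hZ.posSemidef hK (grad c Z K)
  rw [hloc.fderiv_eq_zero, ← frobNorm_sq_eq_trace] at h
  exact frobNorm_eq_zero (pow_eq_zero_iff two_ne_zero |>.1 h.symm)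

theorem exists_isMin
    (hC : IsCompact {K' | Stable c K' ∧ cost c Z K' ≤ cost c Z K}) (hK : Stable c K) :
    ∃ Ks, Stable c Ks ∧ ∀ K', Stable c K' → cost c Z Ks ≤ cost c Z K' := by
  obtain ⟨Ks, hKs, hmin⟩ := hC.exists_isMinOn ⟨K, hK, le_rfl⟩ (f := cost c Z) fun K' hK' =>
    (contDiffAt_cost hK'.1 Z).continuousAt.continuousWithinAt
  refine ⟨Ks, hKs.1, fun K' hK' => ?_⟩
  rcases le_total (cost c Z K') (cost c Z K) with h | h
  · exact hmin ⟨hK', h⟩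
  · exact hKs.2.trans h

theorem exists_gradientFlow (hpos : FlowPositive n)
    (hQ : c.Q.PosDef) (hR : c.R.PosDef) (hZ : Z.PosDef)
    (hC : IsCompact {K' | Stable c K' ∧ cost c Z K' ≤ cost c Z K}) (hK : Stable c K) :
    ∃ y : ℝ → Matrix (Fin m) (Fin n) ℝ, y 0 = K ∧ (∀ t, 0 ≤ t → Stable c (y t)) ∧
      ∀ t, 0 ≤ t → HasDerivWithinAt y (-grad c Z (y t)) (Set.Ici 0) t := by
  refine exists_descent_solution (isOpen_stable c) (f := cost c Z) (v := fun K => -grad c Z K)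
    (fun K hK => (contDiffAt_grad hK Z).neg)
    (fun K hK => (contDiffAt_cost hK Z).differentiableAt one_ne_zero) (fun K hK => ?_) hC
    ⟨hK, le_rfl⟩
  rw [map_neg, fderiv_cost hpos hQ hR hZ.posSemidef hK, ← frobNorm_sq_eq_trace]
  exact neg_nonpos.2 (sq_nonneg _)

theorem antitoneOn_of_deriv_within_Ici {g g' : ℝ → ℝ} {s : Set ℝ} (hs : Convex ℝ s)
    (hs0 : s ⊆ Set.Ici 0) (hg : ∀ t, 0 ≤ t → HasDerivWithinAt g (g' t) (Set.Ici 0) t)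
    (hneg : ∀ t ∈ s, g' t ≤ 0) : AntitoneOn g s := by
  refine antitoneOn_of_hasDerivWithinAt_nonpos hs
    (fun t ht => (hg t (hs0 ht)).continuousWithinAt.mono hs0)
    (fun t ht => (hg t (hs0 (interior_subset ht))).mono (interior_subset.trans hs0))
    fun t ht => hneg t (interior_subset ht)

variable {y : ℝ → Matrix (Fin m) (Fin n) ℝ}

/-- Along the gradient flow the cost has derivative `-‖∇J‖²`. -/
theorem hasDerivWithinAt_cost (hpos : FlowPositive n) (hQ : c.Q.PosDef) (hR : c.R.PosDef)
    (hZ : Z.PosDef) (hst : ∀ t, 0 ≤ t → Stable c (y t))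
    (hy : ∀ t, 0 ≤ t → HasDerivWithinAt y (-grad c Z (y t)) (Set.Ici 0) t) {t : ℝ} (ht : 0 ≤ t) :
    HasDerivWithinAt (fun t => cost c Z (y t)) (-frobNorm (grad c Z (y t)) ^ 2) (Set.Ici 0) t := by
  have hf := ((contDiffAt_cost (hst t ht) Z).differentiableAt one_ne_zero).hasFDerivAt
  have h := hf.comp_hasDerivWithinAt t (hy t ht)
  rwa [map_neg, fderiv_cost hpos hQ hR hZ.posSemidef (hst t ht), ← frobNorm_sq_eq_trace] at h

theorem antitoneOn_cost (hpos : FlowPositive n) (hQ : c.Q.PosDef) (hR : c.R.PosDef)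
    (hZ : Z.PosDef) (hst : ∀ t, 0 ≤ t → Stable c (y t))
    (hy : ∀ t, 0 ≤ t → HasDerivWithinAt y (-grad c Z (y t)) (Set.Ici 0) t) :
    AntitoneOn (fun t => cost c Z (y t)) (Set.Ici 0) :=
  antitoneOn_of_deriv_within_Ici (convex_Ici 0) subset_rfl
    (fun _ ht => hasDerivWithinAt_cost hpos hQ hR hZ hst hy ht)
    fun _ _ => neg_nonpos.2 (sq_nonneg _)

theorem exists_min_frobNorm_grad (hpos : FlowPositive n) (hQ : c.Q.PosDef) (hR : c.R.PosDef)
    (hZ : Z.PosDef) (hst : ∀ t, 0 ≤ t → Stable c (y t))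
    (hy : ∀ t, 0 ≤ t → HasDerivWithinAt y (-grad c Z (y t)) (Set.Ici 0) t) {T : ℝ} (hT : 0 < T) :
    ∃ t ∈ Set.Icc 0 T, (∀ s ∈ Set.Icc 0 T,
      frobNorm (grad c Z (y t)) ^ 2 ≤ frobNorm (grad c Z (y s)) ^ 2) ∧
      frobNorm (grad c Z (y t)) ^ 2 ≤ cost c Z (y 0) / T := by
  have hcont : ContinuousOn (fun t => frobNorm (grad c Z (y t)) ^ 2) (Set.Icc 0 T) := fun t ht =>
    (((continuous_frobNorm m n).continuousAt.comp_continuousWithinAt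
      ((contDiffAt_grad (hst t ht.1) Z).continuousAt.comp_continuousWithinAt
        (hy t ht.1).continuousWithinAt)).pow 2).mono Set.Icc_subset_Ici_self
  obtain ⟨t, ht, hmin⟩ := isCompact_Icc.exists_isMinOn ⟨0, le_rfl, hT.le⟩ hcont
  refine ⟨t, ht, fun s hs => hmin hs, ?_⟩
  -- `J + s min ‖∇J‖²` decreases on `[0, T]`
  have hanti : AntitoneOn (fun s => cost c Z (y s) + s * frobNorm (grad c Z (y t)) ^ 2)
      (Set.Icc 0 T) := by
    refine antitoneOn_of_deriv_within_Ici (convex_Icc 0 T) Set.Icc_subset_Ici_self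
      (fun s hs => (hasDerivWithinAt_cost hpos hQ hR hZ hst hy hs).add
        ((hasDerivWithinAt_id s _).mul_const _)) fun s hs => ?_
    have : frobNorm (grad c Z (y t)) ^ 2 ≤ frobNorm (grad c Z (y s)) ^ 2 := hmin hs
    linarith
  have h := hanti ⟨le_rfl, hT.le⟩ ⟨hT.le, le_rfl⟩ hT.le
  have h2 := cost_nonneg hpos hQ hR (hst T hT.le) hZ.posSemidef
  rw [le_div_iff₀ hT]
  simp only [zero_mul, add_zero] at h
  linarith

/-- Exponential decay of the optimality gap. -/
theorem cost_sub_le_exp (hn : 0 < n) (hm : 0 < m) (hpos : FlowPositive n)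
    (hQ : c.Q.PosDef) (hR : c.R.PosDef) (hZ : Z.PosDef) (hst : ∀ t, 0 ≤ t → Stable c (y t))
    (hy : ∀ t, 0 ≤ t → HasDerivWithinAt y (-grad c Z (y t)) (Set.Ici 0) t)
    (hK' : Stable c K') (hmin : ∀ K, Stable c K → cost c Z K' ≤ cost c Z K) {t : ℝ} (ht : 0 ≤ t) :
    cost c Z (y t) - cost c Z K' ≤ (cost c Z (y 0) - cost c Z K') *
      Real.exp (-t / domConst c Z (cost c Z (y 0))) := by
  have hμ := domConst_pos hn hm hpos hQ hR hZ (hst 0 le_rfl) le_rfl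
  set μ := domConst c Z (cost c Z (y 0)) with hμdef
  have hmono := antitoneOn_cost hpos hQ hR hZ hst hy
  -- gradient domination makes `exp (t / μ)` times the optimality gap non-increasing
  have hanti : AntitoneOn (fun s => Real.exp (s / μ) * (cost c Z (y s) - cost c Z K'))
      (Set.Ici 0) := by
    refine antitoneOn_of_deriv_within_Ici (convex_Ici 0) subset_rfl
      (fun s hs => (((hasDerivWithinAt_id s _).div_const μ).exp).mul
        ((hasDerivWithinAt_cost hpos hQ hR hZ hst hy hs).sub_const _)) fun s hs => ?_
    have h1 := cost_sub_le_frobNorm_grad hn hm hpos hQ hR hZ (hst s hs)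
      (hmono Set.self_mem_Ici hs hs) hK' (hmin _ (hst 0 le_rfl))
    rw [← hμdef] at h1
    have h2 : 1 / μ * (cost c Z (y s) - cost c Z K') ≤ frobNorm (grad c Z (y s)) ^ 2 := by
      rw [one_div, inv_mul_le_iff₀ hμ]; exact h1
    have h3 := mul_le_mul_of_nonneg_left h2 (Real.exp_pos (s / μ)).le
    simp only [id]
    linarith
  have h := hanti Set.self_mem_Ici ht ht
  simp only [zero_div, Real.exp_zero, one_mul] at h
  rw [neg_div, Real.exp_neg, ← div_eq_mul_inv, le_div_iff₀ (Real.exp_pos _), mul_comm]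
  exact h

/-- Exponential convergence of the gains, with an explicit constant. -/
theorem frobNorm_sub_sq_le_exp (hn : 0 < n) (hm : 0 < m) (hpos : FlowPositive n)
    (hQ : c.Q.PosDef) (hR : c.R.PosDef) (hZ : Z.PosDef) (hst : ∀ t, 0 ≤ t → Stable c (y t))
    (hy : ∀ t, 0 ≤ t → HasDerivWithinAt y (-grad c Z (y t)) (Set.Ici 0) t)
    (hK' : Stable c K') (hmin : ∀ K, Stable c K → cost c Z K' ≤ cost c Z K) {t : ℝ} (ht : 0 ≤ t) :
    lamMin c.R * lamMin Z * frobNorm (y t - K') ^ 2 ≤ 4 * driftBound c Z (cost c Z (y 0)) *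
      ((cost c Z (y 0) - cost c Z K') * Real.exp (-t / domConst c Z (cost c Z (y 0)))) := by
  refine (mul_frobNorm_sub_sq_le hn hm hpos hQ hR hZ (hst t ht)
    (antitoneOn_cost hpos hQ hR hZ hst hy Set.self_mem_Ici ht ht) hK'
    (grad_eq_zero_of_isMin hpos hQ hR hZ hK' hmin)).trans ?_
  have hd := (le_level_mul_driftBound hn hm hpos hQ hR hZ (hst 0 le_rfl) le_rfl).1
  exact mul_le_mul_of_nonneg_left (cost_sub_le_exp hn hm hpos hQ hR hZ hst hy hK' hmin ht)
    (by positivity)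

theorem tendsto_gradientFlow (hn : 0 < n) (hm : 0 < m) (hpos : FlowPositive n)
    (hQ : c.Q.PosDef) (hR : c.R.PosDef) (hZ : Z.PosDef) (hst : ∀ t, 0 ≤ t → Stable c (y t))
    (hy : ∀ t, 0 ≤ t → HasDerivWithinAt y (-grad c Z (y t)) (Set.Ici 0) t)
    (hK' : Stable c K') (hmin : ∀ K, Stable c K → cost c Z K' ≤ cost c Z K) :
    Tendsto y atTop (𝓝 K') := by
  have hr := lamMin_pos hm hR
  have hz := lamMin_pos hn hZ
  have hμ := domConst_pos hn hm hpos hQ hR hZ (hst 0 le_rfl) le_rfl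
  set b := 4 * driftBound c Z (cost c Z (y 0)) * (cost c Z (y 0) - cost c Z K') /
    (lamMin c.R * lamMin Z)
  have hexp : Tendsto (fun t : ℝ => √(b * Real.exp (-(t / domConst c Z (cost c Z (y 0))))))
      atTop (𝓝 0) := by
    have h1 := (Real.tendsto_exp_neg_atTop_nhds_zero.comp
      (tendsto_id.atTop_div_const hμ)).const_mul b
    have h2 := (Real.continuous_sqrt.tendsto _).comp h1
    rw [mul_zero, Real.sqrt_zero] at h2
    exact h2
  rw [tendsto_iff_norm_sub_tendsto_zero]
  refine squeeze_zero' (Eventually.of_forall fun _ => norm_nonneg _) ?_ hexp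
  filter_upwards [eventually_ge_atTop 0] with t ht
  refine (norm_le_frobNorm _).trans (Real.le_sqrt_of_sq_le ?_)
  have h := frobNorm_sub_sq_le_exp hn hm hpos hQ hR hZ hst hy hK' hmin ht
  rw [neg_div] at h
  rw [div_mul_eq_mul_div, le_div_iff₀ (mul_pos hr hz)]
  linarith

end Convergence

/-! ### The gradient flow of the stochastic problem -/

section StochasticFlow

attribute [local instance] Matrix.normedAddCommGroup Matrix.normedSpace
attribute [-instance] instTopologicalSpaceMatrix Matrix.instUniformSpace

variable {Ω : Type*} {mΩ : MeasurableSpace Ω} {n m : ℕ} {c : Coeffs n m} {N : Noise mΩ n}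
  {K K₀ : Matrix (Fin m) (Fin n) ℝ} [IsProbabilityMeasure N.P]

/-- `J` agrees with `cost` near `K`, because the stabilizers form an open set. -/
theorem differentiableAt_J (hW : IsBrownianMotion N.P N.𝓕 N.W)
    (hξ : IsInitialState N.P N.𝓕 N.ξ₀) (hQ : c.Q.PosDef) (hR : c.R.PosDef) (hK : Stable c K) :
    DifferentiableAt ℝ (J c N) K ∧ gradMat (J c N) K = grad c (Sigma0 N) K := by
  have he : J c N =ᶠ[𝓝 K] cost c (Sigma0 N) := by
    filter_upwards [(isOpen_stable c).mem_nhds hK] with K' hK'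
    exact J_eq hW hξ hQ hR hK'
  refine ⟨((contDiffAt_cost hK (Sigma0 N)).differentiableAt one_ne_zero).congr_of_eventuallyEq he,
    ?_⟩
  rw [← gradMat_cost (Z := Sigma0 N) (flowPositive hW n) hQ hR (posSemidef_secondMoment hξ.2) hK]
  unfold gradMat
  have := he.fderiv_eq (𝕜 := ℝ)
  ext i j
  exact congrArg (fun T => T (Matrix.single i j 1)) this

theorem IsGradientFlow.hasDerivWithinAt_grad (hW : IsBrownianMotion N.P N.𝓕 N.W)
    (hξ : IsInitialState N.P N.𝓕 N.ξ₀) (hQ : c.Q.PosDef) (hR : c.R.PosDef)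
    {y : ℝ → Matrix (Fin m) (Fin n) ℝ} (hy : IsGradientFlow c N K₀ y) :
    (∀ t, 0 ≤ t → Stable c (y t)) ∧
      ∀ t, 0 ≤ t → HasDerivWithinAt y (-grad c (Sigma0 N) (y t)) (Set.Ici 0) t := by
  have hst : ∀ t, 0 ≤ t → Stable c (y t) := fun t ht =>
    (mem_stabilizers_iff c N (y t) hW).1 (hy.mem t ht)
  refine ⟨hst, fun t ht => ?_⟩
  rw [← (differentiableAt_J hW hξ hQ hR (hst t ht)).2]
  exact hy.deriv t ht

theorem isCompact_sublevel_cost (hn : 0 < n) (hm : 0 < m) (hW : IsBrownianMotion N.P N.𝓕 N.W)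
    (hQ : c.Q.PosDef) (hR : c.R.PosDef)
    (hS : (Sigma0 N).PosDef) (a : ℝ) : IsCompact {K | Stable c K ∧ cost c (Sigma0 N) K ≤ a} :=
  isCompact_sublevel hn hm (flowPositive hW n) (fun K h => (mem_stabilizers_iff c N K hW).1
    (mem_stabilizers_of_tendsto c N K hW h)) hQ hR hS a

theorem exists_isGradientFlow (hn : 0 < n) (hm : 0 < m) (hW : IsBrownianMotion N.P N.𝓕 N.W)
    (hξ : IsInitialState N.P N.𝓕 N.ξ₀) (hQ : c.Q.PosDef) (hR : c.R.PosDef)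
    (hS : (Sigma0 N).PosDef) (hK : Stable c K₀) : ∃ y, IsGradientFlow c N K₀ y := by
  obtain ⟨y, h0, hst, hy⟩ := exists_gradientFlow (flowPositive hW n) hQ hR hS
    (isCompact_sublevel_cost hn hm hW hQ hR hS _) hK
  refine ⟨y, h0, fun t ht => (mem_stabilizers_iff c N (y t) hW).2 (hst t ht), fun t ht => ?_,
    fun t ht => (differentiableAt_J hW hξ hQ hR (hst t ht)).1, fun t ht => ?_⟩
  · rw [costE_eq hW hξ hQ hR (hst t ht)]
    exact ENNReal.ofReal_ne_top
  · rw [(differentiableAt_J hW hξ hQ hR (hst t ht)).2]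
    exact hy t ht

theorem tendsto_gradMat_J (hn : 0 < n) (hm : 0 < m) (hW : IsBrownianMotion N.P N.𝓕 N.W)
    (hξ : IsInitialState N.P N.𝓕 N.ξ₀) (hQ : c.Q.PosDef) (hR : c.R.PosDef)
    (hS : (Sigma0 N).PosDef) {y : ℝ → Matrix (Fin m) (Fin n) ℝ} (hy : IsGradientFlow c N K₀ y) :
    Tendsto (fun t => gradMat (J c N) (y t)) atTop (𝓝 0) := by
  obtain ⟨hst, hd⟩ := hy.hasDerivWithinAt_grad hW hξ hQ hR
  have hpos := flowPositive hW n
  obtain ⟨Ks, hKs, hmin⟩ := exists_isMin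
    (isCompact_sublevel_cost hn hm hW hQ hR hS _) (hst 0 le_rfl)
  have h1 := (contDiffAt_grad hKs (Sigma0 N)).continuousAt.tendsto.comp
    (tendsto_gradientFlow hn hm hpos hQ hR hS hst hd hKs hmin)
  rw [grad_eq_zero_of_isMin hpos hQ hR hS hKs hmin] at h1
  refine h1.congr' ?_
  filter_upwards [eventually_ge_atTop 0] with t ht
  exact (differentiableAt_J hW hξ hQ hR (hst t ht)).2.symm

theorem tendsto_isOptimal (hn : 0 < n) (hm : 0 < m) (hW : IsBrownianMotion N.P N.𝓕 N.W)
    (hξ : IsInitialState N.P N.𝓕 N.ξ₀) (hQ : c.Q.PosDef) (hR : c.R.PosDef)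
    (hS : (Sigma0 N).PosDef) {y : ℝ → Matrix (Fin m) (Fin n) ℝ} (hy : IsGradientFlow c N K₀ y)
    (hK : Stable c K) (hmin : ∀ K', Stable c K' → cost c (Sigma0 N) K ≤ cost c (Sigma0 N) K') :
    Tendsto y atTop (𝓝 K) := by
  obtain ⟨hst, hd⟩ := hy.hasDerivWithinAt_grad hW hξ hQ hR
  exact tendsto_gradientFlow hn hm (flowPositive hW n) hQ hR hS hst hd hK hmin

end StochasticFlow

/-! ### Comparison of constants -/

section Constants

variable {Ω : Type*} {mΩ : MeasurableSpace Ω} {n m : ℕ} {c : Coeffs n m} {N : Noise mΩ n}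
  {K K₀ : Matrix (Fin m) (Fin n) ℝ}

/-- Only the first summand of the smoothness constant is needed; the others are nonnegative. -/
theorem le_Lconst (hq : 0 < lamMin c.Q) (hr : 0 < lamMin c.R) (hr' : lamMin c.R ≤ lamMax c.R)
    (hz : 0 < lamMin (Sigma0 N)) (hJ : 0 < J c N K₀) :
    2 * J c N K₀ * lamMin c.R / lamMin c.Q ≤ Lconst c N K₀ := by
  have hA := specNorm_nonneg c.A
  have hB := specNorm_nonneg c.B
  have hC := specNorm_nonneg c.C
  have hD := specNorm_nonneg c.D
  have hCF := frobNorm_nonneg c.C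
  have hDF := frobNorm_nonneg c.D
  have hmu : 0 ≤ muTilde c N K₀ := by unfold muTilde; positivity
  have hxi : 0 ≤ xiConst c N K₀ := by unfold xiConst; positivity
  have e : 2 * J c N K₀ * lamMin c.R / lamMin c.Q = 2 * J c N K₀ / lamMin c.Q * lamMin c.R := by
    ring
  rw [e, Lconst]
  refine mul_le_mul_of_nonneg_left ?_ (by positivity)
  have h1 : 0 ≤ J c N K₀ * specNorm c.D ^ 2 / lamMin (Sigma0 N) := by positivity
  have h2 : 0 ≤ (specNorm c.B + specNorm c.C * specNorm c.D +
      2 * specNorm c.B * frobNorm c.D ^ 2 * J c N K₀ / (lamMin (Sigma0 N) * lamMin c.R) +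
      specNorm c.A * frobNorm c.D ^ 2 / specNorm c.B) * xiConst c N K₀ := by positivity
  linarith

/-- The constant from quadratic growth, `4 d / (r z)`, is at most `16 μ² L`; here `r`, `q`, `z`
are the smallest eigenvalues of `R`, `Q`, `Σ₀`, and `j` is the initial cost. -/
theorem growth_const_le {r q z d j L : ℝ} (hr : 0 < r) (hq : 0 < q) (hz : 0 < z) (hd : 0 < d)
    (hj : 0 < j) (h : q * z ≤ 4 * d * j) (hL : 2 * j * r / q ≤ L) :
    4 * d ≤ r * z * (16 * (4 * j / (r * q * z ^ 2) * d ^ 2) ^ 2 * L) := by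
  have h3 : (q * z) ^ 3 ≤ (4 * d * j) ^ 3 := pow_le_pow_left₀ (by positivity) h 3
  have h4 : 4 * d ≤ r * z * (16 * (4 * j / (r * q * z ^ 2) * d ^ 2) ^ 2 * (2 * j * r / q)) := by
    have e : r * z * (16 * (4 * j / (r * q * z ^ 2) * d ^ 2) ^ 2 * (2 * j * r / q)) =
        8 * d * (4 * d * j) ^ 3 / (q * z) ^ 3 := by
      field_simp
      ring
    rw [e, le_div_iff₀ (by positivity)]
    nlinarith [mul_le_mul_of_nonneg_left h3 hd.le, mul_pos hd (by positivity : 0 < (4 * d * j) ^ 3)]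
  refine h4.trans ?_
  gcongr

end Constants

end SLQ

end

theorem theorem4p1 {Ω : Type*} {mΩ : MeasurableSpace Ω} {n m : ℕ} (hn : 0 < n) (hm : 0 < m)
    (c : SLQ.Coeffs n m) (N : SLQ.Noise mΩ n)
    (hP : IsProbabilityMeasure N.P)
    (hW : SLQ.IsBrownianMotion N.P N.𝓕 N.W)
    (hξ : SLQ.IsInitialState N.P N.𝓕 N.ξ₀)
    (hQ : c.Q.PosDef) (hR : c.R.PosDef) (hS : (SLQ.Sigma0 N).PosDef)
    (K₀ : Matrix (Fin m) (Fin n) ℝ) (hK₀ : K₀ ∈ SLQ.stabilizers c N) :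
    (∃ Ks, SLQ.IsOptimal c N Ks) ∧
    (∃ K : ℝ → Matrix (Fin m) (Fin n) ℝ, SLQ.IsGradientFlow c N K₀ K) ∧
    ∀ K : ℝ → Matrix (Fin m) (Fin n) ℝ, SLQ.IsGradientFlow c N K₀ K →
      -- monotonicity of the cost, and invariance of the sublevel set
      (AntitoneOn (fun t => SLQ.J c N (K t)) (Set.Ici 0) ∧
        ∀ t, 0 ≤ t → K t ∈ SLQ.sublevel c N K₀) ∧
      -- decay of the gradient, with a rate
      (Tendsto (fun t => SLQ.gradMat (SLQ.J c N) (K t)) atTop (𝓝 0) ∧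
        ∀ T : ℝ, 0 < T → ∃ t ∈ Set.Icc 0 T,
          (∀ s ∈ Set.Icc 0 T,
            SLQ.frobNorm (SLQ.gradMat (SLQ.J c N) (K t)) ^ 2 ≤
              SLQ.frobNorm (SLQ.gradMat (SLQ.J c N) (K s)) ^ 2) ∧
          SLQ.frobNorm (SLQ.gradMat (SLQ.J c N) (K t)) ^ 2 ≤ SLQ.J c N K₀ / T) ∧
      -- exponential convergence to the global minimum point
      (∀ Ks, SLQ.IsOptimal c N Ks →
        Tendsto K atTop (𝓝 Ks) ∧
        0 < SLQ.mu c N K₀ ∧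
        (∀ t, 0 ≤ t → SLQ.J c N (K t) - SLQ.J c N Ks ≤
          (SLQ.J c N K₀ - SLQ.J c N Ks) * Real.exp (-t / SLQ.mu c N K₀)) ∧
        (c.B ≠ 0 → ∀ t, 0 ≤ t → SLQ.frobNorm (K t - Ks) ≤
          4 * SLQ.mu c N K₀ * √(SLQ.Lconst c N K₀ * (SLQ.J c N K₀ - SLQ.J c N Ks)) *
            Real.exp (-t / (2 * SLQ.mu c N K₀)))) := by
  have hpos := SLQ.flowPositive hW n
  have hiff := fun K => SLQ.mem_stabilizers_iff c N K hW
  have hJ := fun K (hK : SLQ.Stable c K) => SLQ.J_eq hW hξ hQ hR hK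
  have hst₀ := (hiff K₀).1 hK₀
  have hq := SLQ.lamMin_pos hn hQ
  have hr := SLQ.lamMin_pos hm hR
  have hz := SLQ.lamMin_pos hn hS
  refine ⟨?_, SLQ.exists_isGradientFlow hn hm hW hξ hQ hR hS hst₀, fun y hy => ?_⟩
  · obtain ⟨Ks, hKs, hmin⟩ := SLQ.exists_isMin
      (SLQ.isCompact_sublevel_cost hn hm hW hQ hR hS _) hst₀
    refine ⟨Ks, (hiff Ks).2 hKs, fun K hK => ?_⟩
    rw [hJ Ks hKs, hJ K ((hiff K).1 hK)]
    exact hmin K ((hiff K).1 hK)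
  obtain ⟨hst, hd⟩ := hy.hasDerivWithinAt_grad hW hξ hQ hR
  have hmono := SLQ.antitoneOn_cost hpos hQ hR hS hst hd
  have hgrad : ∀ t, 0 ≤ t → SLQ.gradMat (SLQ.J c N) (y t) = SLQ.grad c (SLQ.Sigma0 N) (y t) :=
    fun t ht => (SLQ.differentiableAt_J hW hξ hQ hR (hst t ht)).2
  have hy0 : SLQ.cost c (SLQ.Sigma0 N) (y 0) = SLQ.J c N K₀ := by rw [hy.initial, hJ K₀ hst₀]
  refine ⟨⟨fun s hs t ht hle => ?_, fun t ht => ?_⟩,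
    ⟨SLQ.tendsto_gradMat_J hn hm hW hξ hQ hR hS hy, fun T hT => ?_⟩, fun Ks hKs => ?_⟩
  · have := hmono hs ht hle
    simp only [hJ _ (hst s hs), hJ _ (hst t ht)]
    exact this
  · have h1 := hmono Set.self_mem_Ici ht ht
    simp only [hy.initial] at h1
    change SLQ.costE c N (y t) ≤ SLQ.costE c N K₀
    rw [SLQ.costE_eq hW hξ hQ hR (hst t ht), SLQ.costE_eq hW hξ hQ hR hst₀]
    exact ENNReal.ofReal_le_ofReal h1
  · obtain ⟨t, ht, h1, h2⟩ := SLQ.exists_min_frobNorm_grad hpos hQ hR hS hst hd hT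
    refine ⟨t, ht, fun s hs => ?_, ?_⟩
    · rw [hgrad t ht.1, hgrad s hs.1]
      exact h1 s hs
    · rw [hgrad t ht.1, ← hy0]
      exact h2
  · have hKst := (hiff Ks).1 hKs.1
    have hmin : ∀ K, SLQ.Stable c K →
        SLQ.cost c (SLQ.Sigma0 N) Ks ≤ SLQ.cost c (SLQ.Sigma0 N) K := fun K hK => by
      rw [← hJ Ks hKst, ← hJ K hK]
      exact hKs.2 K ((hiff K).2 hK)
    have hμ : SLQ.domConst c (SLQ.Sigma0 N) (SLQ.cost c (SLQ.Sigma0 N) (y 0)) =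
        SLQ.mu c N K₀ := by rw [hy0]; rfl
    have hμpos := SLQ.domConst_pos hn hm hpos hQ hR hS (hst 0 le_rfl) le_rfl
    rw [hμ] at hμpos
    refine ⟨SLQ.tendsto_isOptimal hn hm hW hξ hQ hR hS hy hKst hmin, hμpos, fun t ht => ?_,
      fun _ t ht => ?_⟩
    · have h := SLQ.cost_sub_le_exp hn hm hpos hQ hR hS hst hd hKst hmin ht
      rw [hμ, hy0, ← hJ Ks hKst, ← hJ _ (hst t ht)] at h
      exact h
    · have h := SLQ.frobNorm_sub_sq_le_exp hn hm hpos hQ hR hS hst hd hKst hmin ht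
      obtain ⟨hdr, hJ0, hqz⟩ :=
        SLQ.le_level_mul_driftBound hn hm hpos hQ hR hS (hst 0 le_rfl) le_rfl
      have hgap := hmin _ (hst 0 le_rfl)
      rw [hμ, hy0, ← hJ Ks hKst] at h
      rw [hy0] at hdr hJ0 hqz
      rw [hy0, ← hJ Ks hKst] at hgap
      have hL := SLQ.le_Lconst (N := N) (K₀ := K₀) hq hr
        (SLQ.lamMin_le_lamMax hm (SLQ.posDef_iff_real.1 hR).1) hz hJ0
      have hL0 : 0 ≤ SLQ.Lconst c N K₀ := le_trans (by positivity) hL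
      have hgr : 4 * SLQ.driftBound c (SLQ.Sigma0 N) (SLQ.J c N K₀) ≤ SLQ.lamMin c.R *
          SLQ.lamMin (SLQ.Sigma0 N) * (16 * SLQ.mu c N K₀ ^ 2 * SLQ.Lconst c N K₀) :=
        SLQ.growth_const_le hr hq hz hdr hJ0 hqz hL
      set g := SLQ.J c N K₀ - SLQ.J c N Ks with hg
      have hg0 : 0 ≤ g := sub_nonneg.2 hgap
      -- both sides are nonnegative; it suffices to compare their squares
      have hexp : Real.exp (-t / SLQ.mu c N K₀) = Real.exp (-t / (2 * SLQ.mu c N K₀)) ^ 2 := by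
        rw [← Real.exp_nat_mul]
        congr 1
        field_simp
        norm_num
      refine (sq_le_sq₀ (SLQ.frobNorm_nonneg _) (by positivity)).1 ?_
      rw [mul_pow, mul_pow, mul_pow, Real.sq_sqrt (mul_nonneg hL0 hg0), ← hexp]
      refine le_of_mul_le_mul_left (h.trans ?_) (mul_pos hr hz)
      have h5 := mul_le_mul_of_nonneg_right hgr
        (mul_nonneg hg0 (Real.exp_pos (-t / SLQ.mu c N K₀)).le)
      linarith
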